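/- Let $n\ge 1$, and let $\mathscr F$ denote the Fourier transform $\mathscr Ff(\xi)=\int_{\mathbb R^n}e^{-2\pi i x\cdot\xi}f(x)\,dx$, extended to $\mathscr S'(\mathbb R^n)$. Let $\rho:\mathbb R^n\to[0,1]$ be smooth with $\rho(\xi)=1$ for $|\xi|\le\sqrt n/2$ and $\rho(\xi)=0$ for $|\xi|\ge\sqrt n$, and put, for $k\in\mathbb Z^n$, $$\sigma_k(\xi)=\rho(\xi-k)\Big(\sum_{l\in\mathbb Z^n}\rho(\xi-l)\Big)^{-1},\qquad \square_k=\mathscr F^{-1}\sigma_k\mathscr F .$$ For $s\in\mathbb R$, $1\le p\le\infty$, $1\le q<\infty$ let $M^s_{p,q}$ be the space of all $f\in\mathscr S'(\mathbb R^n)$ with $$\|f\|_{M^s_{p,q}}=\Big(\sum_{k\in\mathbb Z^n}(1+|k|)^{sq}\|\square_kf\|_{L^p(\mathbb R^n)}^q\Big)^{1/q}<\infty ,$$ and for $1\le\gamma\le\infty$ and a family $u=(u(t))_{t\in\mathbb R}$ in $\mathscr S'(\mathbb R^n)$ put $$\|u\|_{l^{s,q}_\square(L^\gamma(\mathbb R,L^p))}=\Big(\sum_{k\in\mathbb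 Z^n}(1+|k|)^{sq}\|\square_ku\|_{L^\gamma(\mathbb R;L^p(\mathbb R^n))}^q\Big)^{1/q}.$$ Here $L^\gamma(\mathbb R;X)$ denotes the Bochner space. Let $P:\mathbb R^n\to\mathbb R$ be measurable and $U(t)=\mathscr F^{-1}e^{itP(\xi)}\mathscr F$, $t\in\mathbb R$. Let $2\le p<\infty$, $\frac1p+\frac1{p'}=1$, $1\le q<\infty$, $\alpha,\delta\in\mathbb R$ and $0<\mu<1$, and suppose that there is a constant $A$ such that $$\|U(t)f\|_{M^\alpha_{p,q}}\le A\,(1+|t|)^{-\mu}\,\|f\|_{M^{\alpha+\delta}_{p',q}}\qquad\text{for all } t\in\mathbb R \text{ and all } f\in\mathscr S(\mathbb R^n).$$ Let $s\in\mathbb R$ and $\gamma=2/\mu$. Then there is a constant $C$ such that for every $f\in M^{s+\delta/2}_{2,q}$ the tempered distributions $U(t)f$, $t\in\mathbb R$, are well defined (that is, $\mathscr Ff$ is a function whose product with $e^{itP}$ is again a tempered distribution) and $$\|U(t)f\|_{l^{s,q}_\square(L^\gamma(\mathbb R,L^p))}\le C\,\|f\|_{M^{s+\delta/2}_{2,q}}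 .$$ If moreover $\gamma\ge q$, then also $$\|U(t)f\|_{L^\gamma(\mathbb R;M^s_{p,q})}\le C\,\|f\|_{M^{s+\delta/2}_{2,q}} .$$ -/

import Mathlib

open MeasureTheory
open scoped ENNReal NNReal SchwartzMap FourierTransform ContDiff

noncomputable section

namespace Strichartz

/-- The lattice point `k ∈ ℤⁿ`, seen as a vector of `ℝⁿ`; `‖latticePoint k‖` is its Euclidean
length `|k|`. -/
def latticePoint {n : ℕ} (k : Fin n → ℤ) : EuclideanSpace ℝ (Fin n) :=
  WithLp.toLp 2 (fun i => (k i : ℝ))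

/-- The generating bump functions: `ρ : ℝⁿ → [0, 1]` is smooth, equal to `1` for `|ξ| ≤ √n / 2`
and equal to `0` for `|ξ| ≥ √n`. -/
structure IsBump {n : ℕ} (ρ : EuclideanSpace ℝ (Fin n) → ℝ) : Prop where
  smooth : ContDiff ℝ ∞ ρ
  mem_Icc : ∀ ξ, ρ ξ ∈ Set.Icc (0 : ℝ) 1
  eq_one : ∀ ξ, ‖ξ‖ ≤ √(n : ℝ) / 2 → ρ ξ = 1
  eq_zero : ∀ ξ, √(n : ℝ) ≤ ‖ξ‖ → ρ ξ = 0

/-- `σ_k(ξ) = ρ(ξ - k) / ∑_l ρ(ξ - l)`. The sum has finitely many nonzero terms at each `ξ`. -/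
def sigma {n : ℕ} (ρ : EuclideanSpace ℝ (Fin n) → ℝ) (k : Fin n → ℤ)
    (ξ : EuclideanSpace ℝ (Fin n)) : ℝ :=
  ρ (ξ - latticePoint k) / ∑' l : Fin n → ℤ, ρ (ξ - latticePoint l)

theorem IsBump.locallyFinite {n : ℕ} {ρ : EuclideanSpace ℝ (Fin n) → ℝ} (hρ : IsBump ρ) :
    LocallyFinite fun k : Fin n → ℤ => Function.support fun ξ => ρ (ξ - latticePoint k) := by
  intro ξ
  refine ⟨Metric.ball ξ 1, Metric.ball_mem_nhds _ one_pos, ?_⟩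
  have hfin : Set.Finite (Set.pi Set.univ
      (fun i : Fin n => Set.Icc (⌊ξ i - (√n + 1)⌋) (⌈ξ i + (√n + 1)⌉))) :=
    Set.Finite.pi fun i => Set.finite_Icc _ _
  refine hfin.subset ?_
  rintro k ⟨η, hη, hb⟩
  rw [Set.mem_univ_pi]
  intro i
  have h1 : ‖η - latticePoint k‖ < √n := by
    by_contra h
    exact hη (hρ.eq_zero _ (not_lt.mp h))
  have h2 : ‖ξ - latticePoint k‖ ≤ √n + 1 := by
    have := norm_sub_le_norm_sub_add_norm_sub ξ η (latticePoint k)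
    rw [mem_ball_iff_norm, norm_sub_rev] at hb
    linarith
  have h3 := (PiLp.norm_apply_le (ξ - latticePoint k) i).trans h2
  simp only [latticePoint, PiLp.sub_apply, Real.norm_eq_abs, abs_le] at h3
  constructor
  · exact (Int.cast_le (R := ℝ)).mp
      ((Int.floor_le _).trans (by linarith : ξ i - (√n + 1) ≤ (k i : ℝ)))
  · exact (Int.cast_le (R := ℝ)).mp
      ((by linarith : (k i : ℝ) ≤ ξ i + (√n + 1)).trans (Int.le_ceil _))

theorem IsBump.one_le_tsum {n : ℕ} {ρ : EuclideanSpace ℝ (Fin n) → ℝ} (hρ : IsBump ρ) (ξ) :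
    (1:ℝ) ≤ ∑' l : Fin n → ℤ, ρ (ξ - latticePoint l) := by
  have hs : Summable fun l : Fin n → ℤ => ρ (ξ - latticePoint l) := by
    apply summable_of_hasFiniteSupport
    exact (IsBump.locallyFinite hρ).point_finite ξ
  let k : Fin n → ℤ := fun i => round (ξ i)
  have hk : ρ (ξ - latticePoint k) = 1 := by
    apply hρ.eq_one
    rw [EuclideanSpace.norm_eq]
    apply Real.sqrt_le_iff.mpr
    refine ⟨by positivity, ?_⟩
    calc ∑ i, ‖(ξ - latticePoint k) i‖^2 ≤ ∑ i : Fin n, (1/4 : ℝ) := by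
          apply Finset.sum_le_sum
          intro i _
          have := abs_sub_round (ξ i)
          simp only [latticePoint, PiLp.sub_apply, Real.norm_eq_abs, k]
          have h0 := abs_nonneg (ξ i - round (ξ i))
          nlinarith
      _ = _ := by
          simp [div_pow]
          ring
  rw [← hk]
  exact hs.le_tsum k fun j _ => (hρ.mem_Icc _).1

/-- The symbols `σ_k` are smooth with compact support, so that they multiply tempered
distributions. -/
theorem IsBump.hasTemperateGrowth_sigma {n : ℕ} {ρ : EuclideanSpace ℝ (Fin n) → ℝ} (hρ : IsBump ρ) (k : Fin n → ℤ) :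
    (fun ξ => ((sigma ρ k ξ : ℝ) : ℂ)).HasTemperateGrowth := by
  have hd : ContDiff ℝ ∞ fun ξ => ∑' l : Fin n → ℤ, ρ (ξ - latticePoint l) := by
    have : (fun ξ => ∑' l : Fin n → ℤ, ρ (ξ - latticePoint l)) =
        fun ξ => ∑ᶠ l : Fin n → ℤ, ρ (ξ - latticePoint l) := by
      funext ξ
      exact tsum_eq_finsum ((IsBump.locallyFinite hρ).point_finite ξ)
    rw [this]
    rw [← contMDiff_iff_contDiff]
    apply contMDiff_finsum (fun l => ?_) (IsBump.locallyFinite hρ)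
    rw [contMDiff_iff_contDiff]
    exact hρ.smooth.comp (by fun_prop)
  have hsm : ContDiff ℝ ∞ (fun ξ => ((sigma ρ k ξ : ℝ) : ℂ)) := by
    apply Complex.ofRealCLM.contDiff.comp
    apply ContDiff.div
    · exact hρ.smooth.comp (by fun_prop)
    · exact hd
    · intro ξ; have := IsBump.one_le_tsum hρ ξ; positivity
  refine HasCompactSupport.hasTemperateGrowth ?_ hsm
  apply HasCompactSupport.of_support_subset_isCompact (isCompact_closedBall (latticePoint k) (√n))
  intro ξ hξ
  by_contra h
  apply hξ
  simp only [sigma]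
  rw [hρ.eq_zero]
  · simp
  · rw [Metric.mem_closedBall, dist_eq_norm] at h; linarith

/-- The frequency-uniform decomposition operator `□_k = 𝓕⁻¹ σ_k 𝓕` on tempered distributions. -/
def box {n : ℕ} (ρ : EuclideanSpace ℝ (Fin n) → ℝ) (k : Fin n → ℤ)
    (u : 𝓢'(EuclideanSpace ℝ (Fin n), ℂ)) : 𝓢'(EuclideanSpace ℝ (Fin n), ℂ) :=
  𝓕⁻ (TemperedDistribution.smulLeftCLM ℂ (fun ξ => ((sigma ρ k ξ : ℝ) : ℂ)) (𝓕 u))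

/-- The tempered distribution `u` is the function `g`: `⟨u, φ⟩ = ∫ g φ` (an absolutely convergent
integral) for every Schwartz function `φ`. -/
def RepresentedBy {n : ℕ} (u : 𝓢'(EuclideanSpace ℝ (Fin n), ℂ))
    (g : EuclideanSpace ℝ (Fin n) → ℂ) : Prop :=
  ∀ φ : 𝓢(EuclideanSpace ℝ (Fin n), ℂ),
    Integrable (fun x => g x * φ x) volume ∧ u φ = ∫ x, g x * φ x

/-- `‖u‖_p`: the `L^p` norm of the tempered distribution `u` if `u` is an `L^p` function, and `∞`
otherwise. -/
def lebesgueNorm {n : ℕ} (p : ℝ≥0∞) (u : 𝓢'(EuclideanSpace ℝ (Fin n), ℂ)) : ℝ≥0∞ :=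
  ⨅ (g : EuclideanSpace ℝ (Fin n) → ℂ) (_ : MemLp g p volume) (_ : RepresentedBy u g),
    eLpNorm g p volume

/-- `(∑_k (1 + |k|)^{sq} a_k^q)^{1/q}`, and `sup_k (1 + |k|)^s a_k` for `q = ∞`. -/
def weightedSeqNorm {n : ℕ} (s : ℝ) (q : ℝ≥0∞) (a : (Fin n → ℤ) → ℝ≥0∞) : ℝ≥0∞ :=
  if q = ⊤ then ⨆ k, ENNReal.ofReal ((1 + ‖latticePoint k‖) ^ s) * a k
  else (∑' k, ENNReal.ofReal ((1 + ‖latticePoint k‖) ^ (s * q.toReal)) * a k ^ q.toReal)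
    ^ (1 / q.toReal)

/-- The norm of the modulation space `M^s_{p,q}(ℝⁿ)`; a tempered distribution belongs to the space
exactly when this is finite. -/
def modulationNorm {n : ℕ} (ρ : EuclideanSpace ℝ (Fin n) → ℝ) (s : ℝ) (p q : ℝ≥0∞)
    (u : 𝓢'(EuclideanSpace ℝ (Fin n), ℂ)) : ℝ≥0∞ :=
  weightedSeqNorm s q (fun k => lebesgueNorm p (box ρ k u))

/-- `u = 𝓕⁻¹ e^{itP(ξ)} 𝓕 f`: the Fourier transform of `f` is a function `F`, and the Fourier
transform of `u` is the function `e^{itP} F`. -/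
def IsEvolution {n : ℕ} (P : EuclideanSpace ℝ (Fin n) → ℝ) (t : ℝ)
    (f u : 𝓢'(EuclideanSpace ℝ (Fin n), ℂ)) : Prop :=
  ∃ F : EuclideanSpace ℝ (Fin n) → ℂ,
    RepresentedBy (𝓕 f) F ∧
    RepresentedBy (𝓕 u) (fun ξ => Complex.exp (Complex.I * (t : ℂ) * (P ξ : ℂ)) * F ξ)

open Classical in
/-- The dispersive group `U(t) = 𝓕⁻¹ e^{itP(ξ)} 𝓕`. The value is only meaningful when
`IsEvolution P t f (dispersiveGroup P t f)` holds, that is, when `e^{itP} 𝓕 f` makes sense as a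
tempered distribution. This is so for every `f` whose Fourier transform is a function of moderate
growth, in particular for Schwartz functions and for elements of `M^s_{2,q}`. -/
def dispersiveGroup {n : ℕ} (P : EuclideanSpace ℝ (Fin n) → ℝ) (t : ℝ)
    (f : 𝓢'(EuclideanSpace ℝ (Fin n), ℂ)) : 𝓢'(EuclideanSpace ℝ (Fin n), ℂ) :=
  if h : ∃ u, IsEvolution P t f u then h.choose else 0

/-- The norm of `L^γ(ℝ; L^p(ℝⁿ))` of a family `v(t)` of tempered distributions: the Bochner norm of
`v` if `v` is (almost everywhere) a strongly measurable `L^p`-valued function, `∞` otherwise. -/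
def timeLebesgueNorm {n : ℕ} (γ p : ℝ≥0∞) [Fact (1 ≤ p)]
    (v : ℝ → 𝓢'(EuclideanSpace ℝ (Fin n), ℂ)) : ℝ≥0∞ :=
  ⨅ (w : ℝ → Lp ℂ p (volume : Measure (EuclideanSpace ℝ (Fin n))))
    (_ : AEStronglyMeasurable w volume) (_ : ∀ᵐ t : ℝ, RepresentedBy (v t) (w t)),
    eLpNorm w γ volume

/-- The norm of `l^{s,q}_□(L^γ(ℝ; L^p(ℝⁿ)))`. -/
def boxNorm {n : ℕ} (ρ : EuclideanSpace ℝ (Fin n) → ℝ) (s : ℝ) (q γ p : ℝ≥0∞) [Fact (1 ≤ p)]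
    (u : ℝ → 𝓢'(EuclideanSpace ℝ (Fin n), ℂ)) : ℝ≥0∞ :=
  weightedSeqNorm s q (fun k => timeLebesgueNorm γ p (fun t => box ρ k (u t)))

/-- The norm of `L^γ(ℝ; M^s_{p,q}(ℝⁿ))`. The map `f ↦ ((1 + |k|)^s □_k f)_k` identifies `M^s_{p,q}`
isometrically with a subspace of `ℓ^q(ℤⁿ; L^p)`; the value is the Bochner norm of `u`, read
through this identification, if `u` is (almost everywhere) a strongly measurable
`M^s_{p,q}`-valued function, and `∞` otherwise. -/
def timeModulationNorm {n : ℕ} (ρ : EuclideanSpace ℝ (Fin n) → ℝ) (γ : ℝ≥0∞) (s : ℝ) (p q : ℝ≥0∞)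
    [Fact (1 ≤ p)] [Fact (1 ≤ q)] (u : ℝ → 𝓢'(EuclideanSpace ℝ (Fin n), ℂ)) : ℝ≥0∞ :=
  ⨅ (w : ℝ → lp (fun _ : Fin n → ℤ =>
      Lp ℂ p (volume : Measure (EuclideanSpace ℝ (Fin n)))) q)
    (_ : AEStronglyMeasurable w volume)
    (_ : ∀ᵐ t : ℝ, ∀ k : Fin n → ℤ,
      RepresentedBy ((((1 + ‖latticePoint k‖) ^ s : ℝ) : ℂ) • box ρ k (u t)) (w t k)),
    eLpNorm w γ volume

end Strichartz

end

namespace Strichartz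

/-! ### The diagonal Hardy--Littlewood--Sobolev inequality on the line -/

/-! The estimate is proved on one frequency block at a time, with a constant that depends on the
block only through `weight (δ / 2) k`; the blocks are then summed in the weighted ℓ^q norm.

Testing the dispersive hypothesis on □_k g and keeping only the k-th term on the left gives ‖□_k
U(t) □_k g‖_p ≤ D (1+|k|)^δ (1+|t|)^(-μ) ‖g‖_{p'} (`exists_box_dispersive_bound`). By the TT*
principle and the Hardy–Littlewood–Sobolev inequality in time, the L^γ(L^p) norm of □_k U(t) f is
then at most a constant times (1+|k|)^(δ/2) ∑ ‖□_l f‖_2, the sum running over l near k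
(`exists_block_bound`). Taking a square root halves δ, and γ = 2/μ is the exponent for which the
kernel |t|^(-μ) maps L^{γ'} to L^γ.

The duality is carried out at each time separately. For every t a Schwartz function of L^{p'} norm
at most one nearly norms □_k U(t) f, so that ‖□_k U(t) f‖_p ≤ 2 |⟨h, e t⟩| in L², where ⟨e t, e s⟩
decays like (1+|t-s|)^(-μ). Nothing makes this choice measurable in t, so the argument is applied to
Riemann sums (`sum_rpow_le_of_decay`). Continuity of t ↦ □_k U(t) f in L^p, a consequence of
Bernstein's inequality, and Fatou's lemma then recover the integral (`lintegral_rpow_le_of_decay`).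

The distributions U(t) f are well defined because the blocks of 𝓕 f are L² functions that overlap
compatibly and glue to a function of moderate growth (`exists_fourier_moderateGrowth`). The bound in
L^γ(M^s_{p,q}) follows from the block bounds by Minkowski's inequality, which needs q ≤ γ
(`exists_lp_valued_of_tsum_ne_top`). -/

theorem lintegral_comp_abs (g : ℝ → ℝ≥0∞) :
    ∫⁻ u : ℝ, g |u| = 2 * ∫⁻ u in Set.Ioi (0 : ℝ), g u := by
  have h1 : ∫⁻ u in Set.Ioi (0 : ℝ), g |u| = ∫⁻ u in Set.Ioi (0 : ℝ), g u :=
    setLIntegral_congr_fun measurableSet_Ioi fun u hu => by rw [abs_of_pos hu]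
  have h2 : ∫⁻ u in Set.Iio (0 : ℝ), g |u| = ∫⁻ u in Set.Ioi (0 : ℝ), g |u| := by
    have := (Measure.measurePreserving_neg (volume : Measure ℝ)).setLIntegral_comp_preimage_emb
      (Homeomorph.neg ℝ).measurableEmbedding (fun u => g |u|) (Set.Ioi 0)
    simpa using this
  rw [← lintegral_add_compl _ (measurableSet_Ioi (a := (0 : ℝ))), Set.compl_Ioi,
    setLIntegral_congr Iio_ae_eq_Iic.symm, h2, h1, two_mul]

/-- The kernel is dominated by |u|^(-μ), integrable at the origin because μ < 1. -/
theorem lintegral_decay_near {μ R : ℝ} (h0 : 0 < μ) (h1 : μ < 1) (hR : 0 ≤ R) :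
    ∫⁻ u : ℝ, Set.indicator {u | |u| ≤ R} (fun u => ENNReal.ofReal ((1 + |u|) ^ (-μ))) u ≤
      ENNReal.ofReal (2 / (1 - μ) * R ^ (1 - μ)) := by
  have e : ∀ u : ℝ, Set.indicator {u | |u| ≤ R} (fun u => ENNReal.ofReal ((1 + |u|) ^ (-μ))) u =
      Set.indicator (Set.Iic R) (fun u => ENNReal.ofReal ((1 + u) ^ (-μ))) |u| := by
    intro u
    by_cases h : |u| ≤ R <;> simp [Set.indicator, h]
  simp_rw [e]
  rw [lintegral_comp_abs, setLIntegral_indicator measurableSet_Iic, Set.Iic_inter_Ioi]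
  have h2 : ∫⁻ u in Set.Ioc 0 R, ENNReal.ofReal ((1 + u) ^ (-μ)) ≤
      ∫⁻ u in Set.Ioc 0 R, ENNReal.ofReal (u ^ (-μ)) := by
    refine setLIntegral_mono' measurableSet_Ioc fun u hu => ?_
    exact ENNReal.ofReal_le_ofReal
      (Real.rpow_le_rpow_of_nonpos hu.1 (by linarith) (by linarith))
  have hint : IntervalIntegrable (fun u : ℝ => u ^ (-μ)) volume 0 R :=
    intervalIntegral.intervalIntegrable_rpow' (by linarith)
  have h3 : ∫⁻ u in Set.Ioc 0 R, ENNReal.ofReal (u ^ (-μ)) =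
      ENNReal.ofReal (R ^ (1 - μ) / (1 - μ)) := by
    rw [← ofReal_integral_eq_lintegral_ofReal, ← intervalIntegral.integral_of_le hR,
      integral_rpow (Or.inl (by linarith))]
    · rw [Real.zero_rpow (by linarith), show -μ + 1 = 1 - μ by ring, sub_zero]
    · exact (intervalIntegrable_iff_integrableOn_Ioc_of_le hR).1 hint
    · filter_upwards [ae_restrict_mem measurableSet_Ioc] with u hu
      exact Real.rpow_nonneg hu.1.le _
  calc _ ≤ 2 * ENNReal.ofReal (R ^ (1 - μ) / (1 - μ)) := by gcongr; exact h2.trans h3.le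
    _ = _ := by
      rw [← ENNReal.ofReal_ofNat, ← ENNReal.ofReal_mul (by norm_num)]
      congr 1; ring

/-- The power 2/μ, conjugate to r = 2/(2-μ), turns the decay into |u|^(-2), whose tail is of size
1/R. -/
theorem lintegral_decay_far {μ R : ℝ} (h0 : 0 < μ) (hR : 0 < R) :
    ∫⁻ u : ℝ, Set.indicator {u | R < |u|}
      (fun u => ENNReal.ofReal ((1 + |u|) ^ (-μ)) ^ (2 / μ)) u ≤ ENNReal.ofReal (2 / R) := by
  have e : ∀ u : ℝ, Set.indicator {u | R < |u|}
      (fun u => ENNReal.ofReal ((1 + |u|) ^ (-μ)) ^ (2 / μ)) u =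
      Set.indicator (Set.Ioi R) (fun u => ENNReal.ofReal ((1 + u) ^ (-μ)) ^ (2 / μ)) |u| := by
    intro u
    by_cases h : R < |u| <;> simp [Set.indicator, h]
  simp_rw [e]
  rw [lintegral_comp_abs, setLIntegral_indicator measurableSet_Ioi, Set.Ioi_inter_Ioi,
    max_eq_left hR.le]
  have h2 : ∫⁻ u in Set.Ioi R, ENNReal.ofReal ((1 + u) ^ (-μ)) ^ (2 / μ) ≤
      ∫⁻ u in Set.Ioi R, ENNReal.ofReal (u ^ (-2 : ℝ)) := by
    refine setLIntegral_mono' measurableSet_Ioi fun u hu => ?_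
    have hu : R < u := hu
    rw [ENNReal.ofReal_rpow_of_nonneg (Real.rpow_nonneg (by linarith) _) (by positivity),
      ← Real.rpow_mul (by linarith), show -μ * (2 / μ) = -2 by field_simp]
    exact ENNReal.ofReal_le_ofReal
      (Real.rpow_le_rpow_of_nonpos (by linarith) (by linarith) (by linarith))
  have h3 : ∫⁻ u in Set.Ioi R, ENNReal.ofReal (u ^ (-2 : ℝ)) = ENNReal.ofReal (1 / R) := by
    rw [← ofReal_integral_eq_lintegral_ofReal, integral_Ioi_rpow_of_lt (by norm_num) hR]
    · congr 1
      norm_num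
      rw [Real.rpow_neg_one]
    · exact integrableOn_Ioi_rpow_of_lt (by norm_num) hR
    · filter_upwards [ae_restrict_mem measurableSet_Ioi] with u hu
      exact Real.rpow_nonneg (hR.trans hu).le _
  calc _ ≤ 2 * ENNReal.ofReal (1 / R) := by gcongr; exact h2.trans h3.le
    _ = _ := by
      rw [← ENNReal.ofReal_ofNat, ← ENNReal.ofReal_mul (by norm_num)]
      congr 1; ring

/-- The inner integral of the inequality, over the set where `f` is at most `f t = c`. -/
theorem lintegral_decay_sublevel {μ : ℝ} (h0 : 0 < μ) (h1 : μ < 1) {f : ℝ → ℝ≥0}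
    (hf : Measurable f) (hf1 : ∫⁻ s, (f s : ℝ≥0∞) ^ (2 / (2 - μ)) ≤ 1) (t : ℝ) {c : ℝ≥0}
    (hc : c ≠ 0) :
    ∫⁻ s, Set.indicator {s | f s ≤ c} (fun s => (f s : ℝ≥0∞) *
      ENNReal.ofReal ((1 + |t - s|) ^ (-μ))) s ≤
      ENNReal.ofReal (2 / (1 - μ) + 2) * (c : ℝ≥0∞) ^ (2 / (2 - μ) - 1) := by
  set r := 2 / (2 - μ) with hr
  have h2 : 0 < 2 - μ := by linarith
  have hr1 : 1 < r := by rw [hr, lt_div_iff₀ h2]; linarith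
  have hc' : (0 : ℝ) < c := by positivity
  -- This radius balances the two halves: the near part is of size c R^(1-μ), the far part of size
  -- R^(-μ/2) by Hölder, and both equal c^(r-1).
  set R : ℝ := (c : ℝ) ^ (-r) with hRdef
  have hR : 0 < R := Real.rpow_pos_of_pos hc' _
  set K : ℝ → ℝ≥0∞ := fun u => ENNReal.ofReal ((1 + |u|) ^ (-μ)) with hK
  have hKm : Measurable K := by fun_prop
  have hs1 : MeasurableSet {u : ℝ | |u| ≤ R} := measurableSet_le (by fun_prop) (by fun_prop)
  have hs2 : MeasurableSet {u : ℝ | R < |u|} := measurableSet_lt (by fun_prop) (by fun_prop)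
  have key : ∀ s, Set.indicator {s | f s ≤ c} (fun s => (f s : ℝ≥0∞) * K (t - s)) s ≤
      c * Set.indicator {u | |u| ≤ R} K (t - s) +
        f s * Set.indicator {u | R < |u|} K (t - s) := by
    intro s
    by_cases hs : f s ≤ c
    · rw [Set.indicator_of_mem (by exact hs)]
      by_cases hR' : |t - s| ≤ R
      · rw [Set.indicator_of_mem (by exact hR')]
        refine le_add_right ?_
        gcongr
      · rw [Set.indicator_of_mem (s := {u | R < |u|}) (by simpa using hR')]
        exact le_add_self
    · rw [Set.indicator_of_notMem (by exact hs)]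
      exact zero_le
  have hnear : ∫⁻ s, (c : ℝ≥0∞) * Set.indicator {u | |u| ≤ R} K (t - s) ≤
      ENNReal.ofReal (2 / (1 - μ)) * (c : ℝ≥0∞) ^ (r - 1) := by
    rw [lintegral_const_mul (f := fun s => Set.indicator {u | |u| ≤ R} K (t - s)) _
        ((hKm.indicator hs1).comp (by fun_prop : Measurable fun s => t - s)),
      lintegral_sub_left_eq_self (fun u => Set.indicator {u | |u| ≤ R} K u) t]
    calc _ ≤ (c : ℝ≥0∞) * ENNReal.ofReal (2 / (1 - μ) * R ^ (1 - μ)) := by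
          gcongr; exact lintegral_decay_near h0 h1 hR.le
      _ = _ := by
          rw [← ENNReal.ofReal_coe_nnreal, ← ENNReal.ofReal_mul hc'.le,
            ENNReal.ofReal_rpow_of_pos hc', ← ENNReal.ofReal_mul (by
              have : 0 < 1 - μ := by linarith
              positivity)]
          congr 1
          rw [hRdef, ← Real.rpow_mul hc'.le, mul_left_comm]
          congr 1
          rw [← Real.rpow_one_add' hc'.le]
          · congr 1
            rw [hr]; field_simp; ring
          · have : 1 + -r * (1 - μ) = r - 1 := by rw [hr]; field_simp; ring
            rw [this]; linarith
  have hfar : ∫⁻ s, (f s : ℝ≥0∞) * Set.indicator {u | R < |u|} K (t - s) ≤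
      ENNReal.ofReal 2 * (c : ℝ≥0∞) ^ (r - 1) := by
    have hconj : r.HolderConjugate (2 / μ) := by
      rw [Real.holderConjugate_iff]
      refine ⟨hr1, ?_⟩
      rw [hr]; field_simp; ring
    refine (ENNReal.lintegral_mul_le_Lp_mul_Lq volume hconj (by fun_prop)
      ((hKm.indicator hs2).comp (by fun_prop : Measurable fun s => t - s)).aemeasurable).trans ?_
    have e : ∀ s, (Set.indicator {u | R < |u|} K (t - s)) ^ (2 / μ) =
        Set.indicator {u | R < |u|} (fun u => K u ^ (2 / μ)) (t - s) := by
      intro s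
      by_cases h : R < |t - s| <;> simp [Set.indicator, h, h0]
    simp only [Function.comp_def, e]
    rw [lintegral_sub_left_eq_self
      (fun u => Set.indicator {u | R < |u|} (fun u => K u ^ (2 / μ)) u) t]
    calc _ ≤ (1 : ℝ≥0∞) ^ (1 / r) * (ENNReal.ofReal (2 / R)) ^ (1 / (2 / μ)) := by
          gcongr
          exact lintegral_decay_far h0 hR
      _ ≤ _ := by
          rw [ENNReal.one_rpow, one_mul, ENNReal.ofReal_rpow_of_pos (by positivity),
            ← ENNReal.ofReal_coe_nnreal, ENNReal.ofReal_rpow_of_pos hc',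
            ← ENNReal.ofReal_mul (by norm_num)]
          apply ENNReal.ofReal_le_ofReal
          rw [hRdef, Real.rpow_neg hc'.le, div_inv_eq_mul, Real.mul_rpow (by norm_num)
            (by positivity), ← Real.rpow_mul hc'.le]
          have e2 : r * (1 / (2 / μ)) = r - 1 := by rw [hr]; field_simp; ring
          rw [e2]
          gcongr
          calc (2 : ℝ) ^ (1 / (2 / μ)) ≤ 2 ^ (1 : ℝ) := by
                apply Real.rpow_le_rpow_of_exponent_le (by norm_num)
                rw [one_div_div]; linarith
            _ = 2 := by simp
  calc _ ≤ ∫⁻ s, (c * Set.indicator {u | |u| ≤ R} K (t - s) +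
        f s * Set.indicator {u | R < |u|} K (t - s)) := lintegral_mono key
    _ = _ := lintegral_add_left
        (((hKm.indicator hs1).comp (by fun_prop : Measurable fun s => t - s)).const_mul _) _
    _ ≤ _ := add_le_add hnear hfar
    _ = _ := by
        rw [← add_mul, ENNReal.ofReal_add (div_nonneg (by norm_num) (by linarith)) (by norm_num)]

/-- By symmetry it suffices to integrate over the region f s ≤ f t. There the inner integral is at
most a constant times f(t)^(r-1), and the remaining factor f(t) completes it to f(t)^r, of integral
at most one. -/
theorem lintegral_lintegral_decay_le_of_le_one {μ : ℝ} (h0 : 0 < μ) (h1 : μ < 1) {f : ℝ → ℝ≥0}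
    (hf : Measurable f) (hf1 : ∫⁻ s, (f s : ℝ≥0∞) ^ (2 / (2 - μ)) ≤ 1) :
    ∫⁻ t, ∫⁻ s, (f t : ℝ≥0∞) * f s * ENNReal.ofReal ((1 + |t - s|) ^ (-μ)) ≤
      2 * ENNReal.ofReal (2 / (1 - μ) + 2) := by
  set r := 2 / (2 - μ) with hr
  have h2 : 0 < 2 - μ := by linarith
  have hr1 : 1 < r := by rw [hr, lt_div_iff₀ h2]; linarith
  set G : ℝ → ℝ → ℝ≥0∞ := fun t s => Set.indicator {p : ℝ × ℝ | f p.2 ≤ f p.1}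
    (fun p => (f p.1 : ℝ≥0∞) * f p.2 * ENNReal.ofReal ((1 + |p.1 - p.2|) ^ (-μ))) (t, s) with hG
  have hGm : Measurable (Function.uncurry G) := by
    have : Function.uncurry G = Set.indicator {p : ℝ × ℝ | f p.2 ≤ f p.1}
      (fun p => (f p.1 : ℝ≥0∞) * f p.2 * ENNReal.ofReal ((1 + |p.1 - p.2|) ^ (-μ))) := rfl
    rw [this]
    refine Measurable.indicator (by fun_prop) (measurableSet_le (by fun_prop) (by fun_prop))
  have hle : ∀ t s, (f t : ℝ≥0∞) * f s * ENNReal.ofReal ((1 + |t - s|) ^ (-μ)) ≤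
      G t s + G s t := by
    intro t s
    rcases le_total (f s) (f t) with h | h
    · refine le_add_right ?_
      simp only [hG]
      rw [Set.indicator_of_mem (by exact h)]
    · refine le_add_left ?_
      simp only [hG]
      rw [Set.indicator_of_mem (by exact h), abs_sub_comm, mul_comm (f t : ℝ≥0∞)]
  have hone : ∫⁻ t, ∫⁻ s, G t s ≤ ENNReal.ofReal (2 / (1 - μ) + 2) := by
    calc _ ≤ ∫⁻ t, ENNReal.ofReal (2 / (1 - μ) + 2) * (f t : ℝ≥0∞) ^ r := by
          refine lintegral_mono fun t => ?_
          rcases eq_or_ne (f t) 0 with h | h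
          · have : ∀ s, G t s = 0 := by
              intro s
              simp [hG, Set.indicator, h]
            simp [this]
          · have : ∀ s, G t s = f t * Set.indicator {s | f s ≤ f t} (fun s => (f s : ℝ≥0∞) *
                ENNReal.ofReal ((1 + |t - s|) ^ (-μ))) s := by
              intro s
              by_cases hs : f s ≤ f t <;> simp [hG, Set.indicator, hs, mul_assoc]
            simp_rw [this]
            rw [lintegral_const_mul]
            · calc _ ≤ (f t : ℝ≥0∞) * (ENNReal.ofReal (2 / (1 - μ) + 2) *
                    (f t : ℝ≥0∞) ^ (r - 1)) := by
                    gcongr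
                    exact lintegral_decay_sublevel h0 h1 hf hf1 t h
                _ = _ := by
                    rw [mul_left_comm]
                    congr 1
                    nth_rw 1 [← ENNReal.rpow_one (f t : ℝ≥0∞)]
                    rw [← ENNReal.rpow_add _ _ (by simpa using h) (by simp)]
                    congr 1; ring
            · exact Measurable.indicator (by fun_prop) (measurableSet_le hf (by fun_prop))
      _ = ENNReal.ofReal (2 / (1 - μ) + 2) * ∫⁻ t, (f t : ℝ≥0∞) ^ r :=
          lintegral_const_mul _ (by fun_prop)
      _ ≤ ENNReal.ofReal (2 / (1 - μ) + 2) * 1 := by gcongr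
      _ = _ := mul_one _
  calc _ ≤ ∫⁻ t, ∫⁻ s, (G t s + G s t) :=
        lintegral_mono fun t => lintegral_mono fun s => hle t s
    _ = ∫⁻ t, ((∫⁻ s, G t s) + ∫⁻ s, G s t) := by
        refine lintegral_congr fun t => lintegral_add_left ?_ _
        exact hGm.comp (by fun_prop : Measurable fun s => (t, s))
    _ = (∫⁻ t, ∫⁻ s, G t s) + ∫⁻ t, ∫⁻ s, G s t :=
        lintegral_add_left (Measurable.lintegral_prod_right' hGm) _
    _ = (∫⁻ t, ∫⁻ s, G t s) + ∫⁻ t, ∫⁻ s, G t s := by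
        congr 1
        exact lintegral_lintegral_swap (f := fun t s => G s t)
          (hGm.comp measurable_swap).aemeasurable
    _ ≤ _ := by rw [two_mul]; exact add_le_add hone hone

/-- Hardy--Littlewood--Sobolev: `∬ f(t) f(s) (1 + |t - s|)^{-μ} ≤ C ‖f‖_r²`, `r = 2 / (2 - μ)`. -/
theorem lintegral_lintegral_decay_le {μ : ℝ} (h0 : 0 < μ) (h1 : μ < 1) {f : ℝ → ℝ≥0}
    (hf : Measurable f) {A : ℝ≥0} (hA : A ≠ 0)
    (hfA : ∫⁻ s, (f s : ℝ≥0∞) ^ (2 / (2 - μ)) ≤ (A : ℝ≥0∞) ^ (2 / (2 - μ))) :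
    ∫⁻ t, ∫⁻ s, (f t : ℝ≥0∞) * f s * ENNReal.ofReal ((1 + |t - s|) ^ (-μ)) ≤
      2 * ENNReal.ofReal (2 / (1 - μ) + 2) * (A : ℝ≥0∞) ^ 2 := by
  have hr0 : 0 ≤ 2 / (2 - μ) := div_nonneg (by norm_num) (by linarith)
  have hA' : (A : ℝ≥0∞) ≠ 0 := by simpa using hA
  have hg : ∀ s, ((f s / A : ℝ≥0) : ℝ≥0∞) = (A : ℝ≥0∞)⁻¹ * f s := by
    intro s
    rw [ENNReal.coe_div hA, ENNReal.div_eq_inv_mul]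
  have h := lintegral_lintegral_decay_le_of_le_one h0 h1 (f := fun s => f s / A) (by fun_prop) (by
    simp_rw [hg, ENNReal.mul_rpow_of_nonneg _ _ hr0]
    rw [lintegral_const_mul _ (by fun_prop)]
    calc _ ≤ ((A : ℝ≥0∞)⁻¹) ^ (2 / (2 - μ)) * (A : ℝ≥0∞) ^ (2 / (2 - μ)) := by gcongr
      _ = 1 := by
        rw [← ENNReal.mul_rpow_of_nonneg _ _ hr0, ENNReal.inv_mul_cancel hA' (by simp),
          ENNReal.one_rpow])
  have e : ∀ t s, (f t : ℝ≥0∞) * f s * ENNReal.ofReal ((1 + |t - s|) ^ (-μ)) =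
      (A : ℝ≥0∞) ^ 2 * (((f t / A : ℝ≥0) : ℝ≥0∞) * ((f s / A : ℝ≥0) : ℝ≥0∞) *
        ENNReal.ofReal ((1 + |t - s|) ^ (-μ))) := by
    intro t s
    have : ∀ s, (f s : ℝ≥0∞) = A * ((f s / A : ℝ≥0) : ℝ≥0∞) := by
      intro s
      rw [hg, ← mul_assoc, ENNReal.mul_inv_cancel hA' (by simp), one_mul]
    rw [this t, this s]
    ring
  simp_rw [e]
  rw [lintegral_congr fun t => lintegral_const_mul _ (by fun_prop),
    lintegral_const_mul _ (Measurable.lintegral_prod_right' (f := fun p : ℝ × ℝ =>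
      ((f p.1 / A : ℝ≥0) : ℝ≥0∞) * ((f p.2 / A : ℝ≥0) : ℝ≥0∞) *
        ENNReal.ofReal ((1 + |p.1 - p.2|) ^ (-μ))) (by fun_prop)), mul_comm]
  gcongr

/-! ### The `TT*` argument -/

theorem volume_floor_div_eq {ε : ℝ} (hε : 0 < ε) (j : ℤ) :
    volume {t : ℝ | ⌊t / ε⌋ = j} = ENNReal.ofReal ε := by
  have : {t : ℝ | ⌊t / ε⌋ = j} = Set.Ico (j * ε) ((j + 1) * ε) := by
    ext t
    simp only [Set.mem_ofPred_eq, Int.floor_eq_iff, Set.mem_Ico, le_div_iff₀ hε, div_lt_iff₀ hε]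
  rw [this, Real.volume_Ico]
  congr 1; ring

/-- Riemann sums become integrals of functions constant on the cells [jε, (j+1)ε), to which the
inequality on the line applies. -/
theorem lintegral_step {ε : ℝ} (hε : 0 < ε) (J : Finset ℤ) (c : ℤ → ℝ≥0∞) :
    ∫⁻ t : ℝ, (if ⌊t / ε⌋ ∈ J then c ⌊t / ε⌋ else 0) = ∑ j ∈ J, ENNReal.ofReal ε * c j := by
  have e : ∀ t : ℝ, (if ⌊t / ε⌋ ∈ J then c ⌊t / ε⌋ else 0) =
      ∑ j ∈ J, Set.indicator {t : ℝ | ⌊t / ε⌋ = j} (fun _ => c j) t := by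
    intro t
    simp only [Set.indicator, Set.mem_ofPred_eq, Finset.sum_ite_eq]
  have hm : ∀ j : ℤ, MeasurableSet {t : ℝ | ⌊t / ε⌋ = j} := fun j =>
    (Int.measurable_floor.comp (by fun_prop : Measurable fun t : ℝ => t / ε))
      (measurableSet_singleton j)
  simp_rw [e]
  rw [lintegral_finsetSum _ fun j _ => measurable_const.indicator (hm j)]
  refine Finset.sum_congr rfl fun j _ => ?_
  rw [lintegral_indicator_const (hm j), volume_floor_div_eq hε, mul_comm]

theorem sum_sum_decay_le {μ : ℝ} (h0 : 0 < μ) (h1 : μ < 1) {ε : ℝ} (hε : 0 < ε) (hε1 : ε ≤ 1)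
    (J : Finset ℤ) (a : ℤ → ℝ≥0) {A : ℝ≥0} (hA : A ≠ 0)
    (haA : ∑ j ∈ J, ENNReal.ofReal ε * (a j : ℝ≥0∞) ^ (2 / (2 - μ)) ≤
      (A : ℝ≥0∞) ^ (2 / (2 - μ))) :
    ∑ i ∈ J, ∑ j ∈ J, ENNReal.ofReal ε * (ENNReal.ofReal ε * ((a i : ℝ≥0∞) * a j *
      ENNReal.ofReal ((1 + |i * ε - j * ε|) ^ (-μ)))) ≤
      ENNReal.ofReal (4 * (2 / (1 - μ) + 2)) * (A : ℝ≥0∞) ^ 2 := by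
  have hr0 : 0 < 2 / (2 - μ) := div_pos (by norm_num) (by linarith)
  have hk : Measurable fun t : ℝ => ⌊t / ε⌋ :=
    Int.measurable_floor.comp (by fun_prop : Measurable fun t : ℝ => t / ε)
  set f : ℝ → ℝ≥0 := fun t => if ⌊t / ε⌋ ∈ J then a ⌊t / ε⌋ else 0 with hf
  have hfm : Measurable f :=
    (measurable_of_countable (fun k : ℤ => if k ∈ J then a k else 0)).comp hk
  have hmain := lintegral_lintegral_decay_le h0 h1 hfm hA (by
    rw [← lintegral_step hε] at haA
    refine le_trans (le_of_eq (lintegral_congr fun t => ?_)) haA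
    simp only [hf]
    split_ifs <;> simp [hr0])
  -- Moving t and s to the left ends of their cells changes t - s by less than ε ≤ 1, which costs a
  -- factor 2^μ ≤ 2.
  have hdec : ∀ t s : ℝ, (1 + |(⌊t / ε⌋ : ℝ) * ε - ⌊s / ε⌋ * ε|) ^ (-μ) ≤
      2 * (1 + |t - s|) ^ (-μ) := by
    have hfl : ∀ t : ℝ, (⌊t / ε⌋ : ℝ) * ε ≤ t ∧ t < (⌊t / ε⌋ : ℝ) * ε + ε := by
      intro t
      have h3 := (le_div_iff₀ hε).1 (Int.floor_le (t / ε))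
      have h4 := (div_lt_iff₀ hε).1 (Int.lt_floor_add_one (t / ε))
      exact ⟨h3, by linarith⟩
    intro t s
    obtain ⟨h3, h4⟩ := hfl t
    obtain ⟨h5, h6⟩ := hfl s
    set x := (⌊t / ε⌋ : ℝ) * ε
    set y := (⌊s / ε⌋ : ℝ) * ε
    have h7 : |t - s| ≤ |x - y| + 1 := by
      rw [abs_le]
      have := le_abs_self (x - y)
      have := neg_abs_le (x - y)
      constructor <;> linarith
    have h8 : (1 + |t - s|) ≤ 2 * (1 + |x - y|) := by linarith [abs_nonneg (x - y)]
    calc (1 + |x - y|) ^ (-μ) ≤ ((1 / 2) * (1 + |t - s|)) ^ (-μ) :=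
          Real.rpow_le_rpow_of_nonpos (by positivity) (by linarith) (by linarith)
      _ = (1 / 2 : ℝ) ^ (-μ) * (1 + |t - s|) ^ (-μ) :=
          Real.mul_rpow (by norm_num) (by positivity)
      _ ≤ 2 * (1 + |t - s|) ^ (-μ) := by
          gcongr
          rw [one_div, Real.inv_rpow (by norm_num), Real.rpow_neg (by norm_num), inv_inv]
          calc (2 : ℝ) ^ μ ≤ 2 ^ (1 : ℝ) :=
                Real.rpow_le_rpow_of_exponent_le (by norm_num) h1.le
            _ = 2 := by simp
  set c : ℤ → ℤ → ℝ≥0∞ := fun i j => (a i : ℝ≥0∞) * a j *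
      ENNReal.ofReal ((1 + |i * ε - j * ε|) ^ (-μ)) with hc
  calc _ = ∑ i ∈ J, ENNReal.ofReal ε * ∑ j ∈ J, ENNReal.ofReal ε * c i j := by
        simp_rw [Finset.mul_sum, hc]
    _ = ∑ i ∈ J, ENNReal.ofReal ε *
        ∫⁻ s : ℝ, (if ⌊s / ε⌋ ∈ J then c i ⌊s / ε⌋ else 0) := by
        refine Finset.sum_congr rfl fun i _ => ?_
        rw [lintegral_step hε J (c i)]
    _ = ∫⁻ t : ℝ, (if ⌊t / ε⌋ ∈ J then
        ∫⁻ s : ℝ, (if ⌊s / ε⌋ ∈ J then c ⌊t / ε⌋ ⌊s / ε⌋ else 0) else 0) := by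
        rw [lintegral_step hε J
          fun i => ∫⁻ s : ℝ, (if ⌊s / ε⌋ ∈ J then c i ⌊s / ε⌋ else 0)]
    _ ≤ ∫⁻ t, 2 * ∫⁻ s, (f t : ℝ≥0∞) * f s * ENNReal.ofReal ((1 + |t - s|) ^ (-μ)) := by
        refine lintegral_mono fun t => ?_
        by_cases ht : ⌊t / ε⌋ ∈ J
        · rw [if_pos ht, ← lintegral_const_mul _ (by fun_prop)]
          refine lintegral_mono fun s => ?_
          by_cases hs : ⌊s / ε⌋ ∈ J
          · simp only [if_pos hs, hf, if_pos ht, hc]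
            rw [mul_left_comm]
            gcongr
            rw [← ENNReal.ofReal_ofNat, ← ENNReal.ofReal_mul (by norm_num)]
            exact ENNReal.ofReal_le_ofReal (hdec t s)
          · simp [if_neg hs]
        · simp [if_neg ht]
    _ = 2 * ∫⁻ t, ∫⁻ s, (f t : ℝ≥0∞) * f s * ENNReal.ofReal ((1 + |t - s|) ^ (-μ)) :=
        lintegral_const_mul _ (Measurable.lintegral_prod_right' (f := fun p : ℝ × ℝ =>
          (f p.1 : ℝ≥0∞) * f p.2 * ENNReal.ofReal ((1 + |p.1 - p.2|) ^ (-μ))) (by fun_prop))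
    _ ≤ 2 * (2 * ENNReal.ofReal (2 / (1 - μ) + 2) * (A : ℝ≥0∞) ^ 2) := by gcongr
    _ = _ := by
        rw [ENNReal.ofReal_mul (by norm_num), show (4 : ℝ) = 2 * 2 by norm_num,
          ENNReal.ofReal_mul (by norm_num), ENNReal.ofReal_ofNat]
        ring

section TTStar

variable {H : Type*} [NormedAddCommGroup H] [InnerProductSpace ℂ H]

theorem exists_norm_eq_one_mul_eq_norm (z : ℂ) : ∃ u : ℂ, ‖u‖ = 1 ∧ u * z = ‖z‖ := by
  by_cases hz : z = 0
  · exact ⟨1, by simp, by simp [hz]⟩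
  · refine ⟨(starRingEnd ℂ) z / ‖z‖, ?_, ?_⟩
    · rw [norm_div, Complex.norm_real, norm_norm, RCLike.norm_conj, div_self (by simpa using hz)]
    · rw [div_mul_eq_mul_div, Complex.conj_mul', sq, mul_div_assoc, div_self
        (by simpa using hz), mul_one]

/-- The discrete form of the `TT*` argument. -/
theorem sum_rpow_le_of_decay {μ : ℝ} (h0 : 0 < μ) (h1 : μ < 1) {D : ℝ≥0} (h : H) {N : ℝ → ℝ≥0}
    {e : ℝ → H} (hN : ∀ t, (N t : ℝ) ≤ 2 * ‖inner ℂ h (e t)‖)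
    (he : ∀ t s, ‖inner ℂ (e t) (e s)‖ ≤ D * (1 + |t - s|) ^ (-μ))
    {ε : ℝ≥0} (hε : 0 < ε) (hε1 : ε ≤ 1) (J : Finset ℤ) :
    ∑ j ∈ J, ε * N (j * ε) ^ (2 / μ) ≤
      (2 * ‖h‖₊ * NNReal.sqrt (D * Real.toNNReal (4 * (2 / (1 - μ) + 2)))) ^ (2 / μ) := by
  set S := ∑ j ∈ J, ε * N (j * ε) ^ (2 / μ) with hS
  set B := Real.toNNReal (4 * (2 / (1 - μ) + 2)) with hB
  have h2μ : 0 < 2 - μ := by linarith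
  have hγ : 0 < 2 / μ := by positivity
  rcases eq_or_ne S 0 with hS0 | hS0
  · rw [hS0]; exact zero_le
  set r := 2 / (2 - μ) with hr
  have hr0 : 0 < r := by positivity
  -- The extremal choice in the duality of L^γ and L^r, γ = 2/μ: both a N and a^r equal N^γ.
  set a : ℤ → ℝ≥0 := fun j => N (j * ε) ^ (2 / μ - 1) with ha
  choose u hu1 hu2 using fun j : ℤ => exists_norm_eq_one_mul_eq_norm (inner ℂ h (e (j * ε)))
  -- This is the discretised adjoint T* applied to `a`; the unimodular `u j` turn the inner products
  -- with `h` into their moduli. Hence S ≤ 2 ⟨h, V⟩, and expanding ‖V‖² brings in the Gram matrix of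
  -- `e`.
  set V : H := ∑ j ∈ J, (((ε * a j : ℝ≥0) : ℝ) * u j : ℂ) • e (j * ε) with hV
  have hSV : (S : ℝ) ≤ 2 * (‖h‖ * ‖V‖) := by
    have e1 : inner ℂ h V = ((∑ j ∈ J, (ε * a j) * ‖inner ℂ h (e (j * ε))‖ : ℝ) : ℂ) := by
      rw [hV, inner_sum]
      push_cast
      refine Finset.sum_congr rfl fun j _ => ?_
      rw [inner_smul_right, mul_assoc, hu2]
    have e2 : (∑ j ∈ J, (ε * a j) * ‖inner ℂ h (e (j * ε))‖ : ℝ) ≤ ‖h‖ * ‖V‖ := by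
      refine le_trans ?_ (norm_inner_le_norm (𝕜 := ℂ) h V)
      rw [e1, Complex.norm_real]
      exact le_abs_self _
    calc (S : ℝ) ≤ 2 * ∑ j ∈ J, (ε * a j) * ‖inner ℂ h (e (j * ε))‖ := by
          rw [hS, Finset.mul_sum]
          push_cast
          refine Finset.sum_le_sum fun j _ => ?_
          have e3 : (N (j * ε) : ℝ) ^ (2 / μ) = a j * N (j * ε) := by
            have h3 : 2 / μ - 1 + 1 ≠ 0 := by rw [sub_add_cancel]; positivity
            rw [ha]
            push_cast
            rw [← Real.rpow_add_one' (by positivity) h3, sub_add_cancel]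
          rw [e3]
          have := hN (j * ε)
          calc _ ≤ (ε : ℝ) * (a j * (2 * ‖inner ℂ h (e (j * ε))‖)) := by gcongr
            _ = _ := by ring
      _ ≤ _ := by gcongr
  set A : ℝ≥0 := S ^ (1 / r) with hA
  have hA0 : A ≠ 0 := by rw [hA]; simp [NNReal.rpow_eq_zero_iff, hS0]
  have hAr : A ^ r = S := by
    rw [hA, ← NNReal.rpow_mul, one_div_mul_cancel hr0.ne', NNReal.rpow_one]
  have hHLS := sum_sum_decay_le h0 h1 (ε := ε) (by exact_mod_cast hε) (by exact_mod_cast hε1) J a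
    hA0 (by
      rw [← hr, ← ENNReal.coe_rpow_of_nonneg _ hr0.le, hAr, hS, ENNReal.ofNNReal_finsetSum]
      refine Finset.sum_le_sum fun j _ => ?_
      rw [ENNReal.ofReal_coe_nnreal, ← ENNReal.coe_rpow_of_nonneg _ hr0.le, ENNReal.coe_mul, ha]
      simp only
      rw [← NNReal.rpow_mul, show (2 / μ - 1) * r = 2 / μ by rw [hr]; field_simp])
  have hV2 : ‖V‖ ^ 2 ≤ D * (B * A ^ 2) := by
    have hHLS' : (∑ i ∈ J, ∑ j ∈ J, (ε : ℝ) * (ε * (a i * a j *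
        (1 + |(i * ε - j * ε : ℝ)|) ^ (-μ)))) ≤ B * A ^ 2 := by
      have hpos : ∀ x : ℝ, 0 ≤ (1 + |x|) ^ (-μ) := fun x => by positivity
      rw [← ENNReal.ofReal_le_ofReal_iff (by positivity)]
      refine le_trans (le_of_eq ?_) (hHLS.trans (le_of_eq ?_))
      · rw [ENNReal.ofReal_sum_of_nonneg fun i _ => Finset.sum_nonneg fun j _ => by positivity]
        refine Finset.sum_congr rfl fun i _ => ?_
        rw [ENNReal.ofReal_sum_of_nonneg fun j _ => by positivity]
        refine Finset.sum_congr rfl fun j _ => ?_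
        rw [ENNReal.ofReal_mul (by positivity), ENNReal.ofReal_mul (by positivity),
          ENNReal.ofReal_mul (by positivity), ENNReal.ofReal_mul (by positivity),
          ENNReal.ofReal_coe_nnreal, ENNReal.ofReal_coe_nnreal, ENNReal.ofReal_coe_nnreal]
      · rw [ENNReal.ofReal_mul (p := (B : ℝ)) (by positivity), ENNReal.ofReal_coe_nnreal,
          ENNReal.ofReal_pow (by positivity), ENNReal.ofReal_coe_nnreal]
        rfl
    calc ‖V‖ ^ 2 = ‖inner ℂ V V‖ := by
          rw [inner_self_eq_norm_sq_to_K]; simp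
      _ ≤ ∑ i ∈ J, ∑ j ∈ J, (ε * a i) * ((ε * a j) *
          (D * (1 + |(i * ε - j * ε : ℝ)|) ^ (-μ))) := by
          rw [hV, sum_inner]
          refine (norm_sum_le _ _).trans (Finset.sum_le_sum fun i _ => ?_)
          rw [inner_sum]
          refine (norm_sum_le _ _).trans (Finset.sum_le_sum fun j _ => ?_)
          rw [inner_smul_left, inner_smul_right, norm_mul, norm_mul, RCLike.norm_conj, norm_mul,
            norm_mul, hu1, hu1, mul_one, mul_one, Complex.norm_real, Complex.norm_real,
            NNReal.norm_eq, NNReal.norm_eq]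
          push_cast
          gcongr
          exact he _ _
      _ = D * ∑ i ∈ J, ∑ j ∈ J, (ε : ℝ) * (ε * (a i * a j *
        (1 + |(i * ε - j * ε : ℝ)|) ^ (-μ))) := by
          simp_rw [Finset.mul_sum]
          refine Finset.sum_congr rfl fun i _ => Finset.sum_congr rfl fun j _ => ?_
          ring
      _ ≤ _ := by gcongr
  have hVA : ‖V‖₊ ≤ NNReal.sqrt (D * B) * A := by
    rw [← NNReal.coe_le_coe, coe_nnnorm, NNReal.coe_mul, Real.coe_sqrt]
    refine le_of_sq_le_sq ?_ (by positivity)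
    rw [mul_pow, Real.sq_sqrt (by positivity)]
    push_cast
    linarith
  have hfin : S ≤ (2 * ‖h‖₊ * NNReal.sqrt (D * B)) * A := by
    have : S ≤ 2 * (‖h‖₊ * ‖V‖₊) := by exact_mod_cast hSV
    calc S ≤ 2 * (‖h‖₊ * ‖V‖₊) := this
      _ ≤ 2 * (‖h‖₊ * (NNReal.sqrt (D * B) * A)) := by gcongr
      _ = _ := by ring
  -- As a finite sum S is finite, so the factor A = S^(1/r) can be cancelled from S ≤ const · A;
  -- here 1 - 1/r = μ/2.
  have hSA : S = S ^ (μ / 2) * A := by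
    rw [hA, ← NNReal.rpow_add hS0, show μ / 2 + 1 / r = 1 by rw [hr]; field_simp; ring,
      NNReal.rpow_one]
  have h9 : S ^ (μ / 2) ≤ 2 * ‖h‖₊ * NNReal.sqrt (D * B) := by
    rw [hSA] at hfin
    exact le_of_mul_le_mul_right hfin (pos_iff_ne_zero.2 hA0)
  calc S = (S ^ (μ / 2)) ^ (2 / μ) := by
        rw [← NNReal.rpow_mul, show μ / 2 * (2 / μ) = 1 by field_simp, NNReal.rpow_one]
    _ ≤ _ := by gcongr

/-- The `TT*` argument: a continuous function bounded by `⟨h, e t⟩`, where the Gram matrix of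
`e` decays like `(1 + |t - s|)^{-μ}`, lies in `L^{2/μ}`. -/
theorem lintegral_rpow_le_of_decay {μ : ℝ} (h0 : 0 < μ) (h1 : μ < 1) {D : ℝ≥0} (h : H)
    {N : ℝ → ℝ≥0} (hNc : Continuous N)
    {e : ℝ → H} (hN : ∀ t, (N t : ℝ) ≤ 2 * ‖inner ℂ h (e t)‖)
    (he : ∀ t s, ‖inner ℂ (e t) (e s)‖ ≤ D * (1 + |t - s|) ^ (-μ)) :
    ∫⁻ t, (N t : ℝ≥0∞) ^ (2 / μ) ≤
      ((2 * ‖h‖₊ * NNReal.sqrt (D * Real.toNNReal (4 * (2 / (1 - μ) + 2))) : ℝ≥0) : ℝ≥0∞)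
        ^ (2 / μ) := by
  have hγ : 0 < 2 / μ := by positivity
  set ε : ℕ → ℝ≥0 := fun m => 1 / (m + 1) with hεdef
  have hε : ∀ m, 0 < ε m := fun m => by positivity
  have hε' : ∀ m, (0 : ℝ) < ε m := fun m => by exact_mod_cast hε m
  have hε1 : ∀ m, ε m ≤ 1 := fun m => by
    rw [hεdef]; simp only
    rw [div_le_one (by positivity)]; simp
  have hεlim : Filter.Tendsto (fun m => (ε m : ℝ)) Filter.atTop (nhds 0) := by
    have := tendsto_one_div_add_atTop_nhds_zero_nat (𝕜 := ℝ)
    simpa [hεdef] using this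
  -- With mesh 1/(m+1) these indices reach from -(m+1) to m+1, so every fixed t is eventually
  -- covered.
  set J : ℕ → Finset ℤ := fun m => Finset.Icc (-((m : ℤ) + 1) ^ 2) (((m : ℤ) + 1) ^ 2) with hJ
  -- No measurability of `e` is available. These step functions converge pointwise because `N` is
  -- continuous, and Fatou's lemma passes to the limit.
  set g : ℕ → ℝ → ℝ≥0∞ := fun m t =>
    if ⌊t / ε m⌋ ∈ J m then (N (⌊t / ε m⌋ * ε m) : ℝ≥0∞) ^ (2 / μ) else 0 with hg
  have hgm : ∀ m, Measurable (g m) := fun m =>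
    (measurable_of_countable
      (fun k : ℤ => if k ∈ J m then (N (k * ε m) : ℝ≥0∞) ^ (2 / μ) else 0)).comp
      (Int.measurable_floor.comp (by fun_prop : Measurable fun t : ℝ => t / ε m))
  have hgb : ∀ m, ∫⁻ t, g m t ≤
      ((2 * ‖h‖₊ * NNReal.sqrt (D * Real.toNNReal (4 * (2 / (1 - μ) + 2))) : ℝ≥0) : ℝ≥0∞)
        ^ (2 / μ) := by
    intro m
    rw [hg, lintegral_step (hε' m) (J m) fun k => (N (k * ε m) : ℝ≥0∞) ^ (2 / μ)]
    have := sum_rpow_le_of_decay h0 h1 h hN he (hε m) (hε1 m) (J m)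
    rw [← ENNReal.coe_rpow_of_nonneg _ hγ.le]
    refine le_trans (le_of_eq ?_) (ENNReal.coe_le_coe.2 this)
    rw [ENNReal.ofNNReal_finsetSum]
    refine Finset.sum_congr rfl fun j _ => ?_
    rw [ENNReal.ofReal_coe_nnreal, ENNReal.coe_mul, ENNReal.coe_rpow_of_nonneg _ hγ.le]
  have hlim : ∀ t, Filter.Tendsto (fun m => g m t) Filter.atTop (nhds ((N t : ℝ≥0∞) ^ (2 / μ))) := by
    intro t
    have h3 : Filter.Tendsto (fun m => (⌊t / ε m⌋ : ℝ) * ε m) Filter.atTop (nhds t) := by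
      have h4 : ∀ m, |(⌊t / ε m⌋ : ℝ) * ε m - t| ≤ ε m := by
        intro m
        have h3 := (le_div_iff₀ (hε' m)).1 (Int.floor_le (t / ε m))
        have h4 := (div_lt_iff₀ (hε' m)).1 (Int.lt_floor_add_one (t / ε m))
        rw [abs_le]
        constructor <;> linarith
      rw [tendsto_iff_dist_tendsto_zero]
      exact squeeze_zero (fun _ => dist_nonneg) h4 hεlim
    have h5 : Filter.Tendsto (fun m => (N (⌊t / ε m⌋ * ε m) : ℝ≥0∞) ^ (2 / μ)) Filter.atTop
        (nhds ((N t : ℝ≥0∞) ^ (2 / μ))) :=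
      (ENNReal.continuous_rpow_const.tendsto _).comp
        ((ENNReal.continuous_coe.tendsto _).comp ((hNc.tendsto t).comp h3))
    refine h5.congr' ?_
    obtain ⟨m0, hm0⟩ := exists_nat_ge (|t| + 1)
    filter_upwards [Filter.eventually_ge_atTop m0] with m hm
    simp only [hg]
    rw [if_pos]
    have hm' : |t| + 1 ≤ m := hm0.trans (by exact_mod_cast hm)
    have e1 : t / ε m = t * (m + 1) := by
      simp [hεdef]
    have e2 : |t * (m + 1)| ≤ (m : ℝ) * (m + 1) := by
      rw [abs_mul, abs_of_pos (by positivity : (0 : ℝ) < m + 1)]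
      gcongr
      linarith
    rw [abs_le] at e2
    rw [hJ, Finset.mem_Icc, e1]
    constructor
    · rw [Int.le_floor]
      push_cast
      nlinarith
    · have : (⌊t * (m + 1)⌋ : ℝ) ≤ (m + 1) ^ 2 := by
        refine (Int.floor_le _).trans ?_
        nlinarith
      exact_mod_cast this
  calc ∫⁻ t, (N t : ℝ≥0∞) ^ (2 / μ) = ∫⁻ t, Filter.liminf (fun m => g m t) Filter.atTop := by
        refine lintegral_congr fun t => ?_
        rw [(hlim t).liminf_eq]
    _ ≤ Filter.liminf (fun m => ∫⁻ t, g m t) Filter.atTop := lintegral_liminf_le hgm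
    _ ≤ _ := Filter.liminf_le_of_frequently_le' (Filter.Frequently.of_forall hgb)

end TTStar

variable {n : ℕ} {ρ : EuclideanSpace ℝ (Fin n) → ℝ}

/-! ### Lattice points and weights -/

@[simp] theorem latticePoint_zero : latticePoint (0 : Fin n → ℤ) = 0 := by
  ext i; simp [latticePoint]

theorem latticePoint_add (k l : Fin n → ℤ) :
    latticePoint (k + l) = latticePoint k + latticePoint l := by
  ext i; simp [latticePoint]

theorem latticePoint_neg (k : Fin n → ℤ) : latticePoint (-k) = -latticePoint k := by
  ext i; simp [latticePoint]

theorem finite_norm_latticePoint_le (R : ℝ) : {k : Fin n → ℤ | ‖latticePoint k‖ ≤ R}.Finite := by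
  refine (Set.Finite.pi (t := fun _ : Fin n => Set.Icc (-⌈R⌉) ⌈R⌉)
    fun i => Set.finite_Icc _ _).subset fun k hk => ?_
  rw [Set.mem_univ_pi]
  intro i
  have h3 := (PiLp.norm_apply_le (latticePoint k) i).trans hk
  simp only [latticePoint, Real.norm_eq_abs, abs_le] at h3
  have h4 := Int.le_ceil R
  constructor
  · have : (-(⌈R⌉ : ℝ)) ≤ k i := by linarith
    exact_mod_cast this
  · have : (k i : ℝ) ≤ ⌈R⌉ := by linarith
    exact_mod_cast this

/-- The displacements `l - k` for which the supports of `σ_k` and `σ_l` may meet. -/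
noncomputable def neighbors (n : ℕ) : Finset (Fin n → ℤ) :=
  (finite_norm_latticePoint_le (n := n) (2 * √n)).toFinset

theorem mem_neighbors {m : Fin n → ℤ} : m ∈ neighbors n ↔ ‖latticePoint m‖ ≤ 2 * √n := by
  simp [neighbors]

theorem neg_mem_neighbors {m : Fin n → ℤ} (h : m ∈ neighbors n) : -m ∈ neighbors n := by
  rw [mem_neighbors] at h ⊢
  rwa [latticePoint_neg, norm_neg]

/-- The weight `(1 + |k|)^s`. -/
noncomputable def weight (s : ℝ) (k : Fin n → ℤ) : ℝ≥0∞ :=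
  ENNReal.ofReal ((1 + ‖latticePoint k‖) ^ s)

theorem weight_ne_zero (s : ℝ) (k : Fin n → ℤ) : weight s k ≠ 0 := by
  rw [weight, ne_eq, ENNReal.ofReal_eq_zero, not_le]
  positivity

theorem weight_ne_top (s : ℝ) (k : Fin n → ℤ) : weight s k ≠ ⊤ := ENNReal.ofReal_ne_top

theorem weight_add (s t : ℝ) (k : Fin n → ℤ) : weight (s + t) k = weight s k * weight t k := by
  rw [weight, weight, weight, ← ENNReal.ofReal_mul (by positivity),
    Real.rpow_add (by positivity)]

@[simp] theorem weight_zero (k : Fin n → ℤ) : weight 0 k = 1 := by simp [weight]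

theorem weight_rpow (s : ℝ) {q : ℝ} (hq : 0 ≤ q) (k : Fin n → ℤ) :
    weight s k ^ q = weight (s * q) k := by
  rw [weight, weight, ENNReal.ofReal_rpow_of_nonneg (by positivity) hq,
    Real.rpow_mul (by positivity)]

/-- Both comparisons are needed, since a negative exponent reverses the order. -/
theorem rpow_le_of_comparable {a b c s : ℝ} (ha : 0 < a) (hb : 0 < b)
    (hab : a ≤ c * b) (hba : b ≤ c * a) : a ^ s ≤ c ^ |s| * b ^ s := by
  have hc : 0 < c := by
    by_contra h
    have := mul_nonpos_of_nonpos_of_nonneg (not_lt.1 h) hb.le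
    linarith
  rcases le_total 0 s with hs | hs
  · rw [abs_of_nonneg hs, ← Real.mul_rpow hc.le hb.le]
    exact Real.rpow_le_rpow ha.le hab hs
  · rw [abs_of_nonpos hs, Real.rpow_neg hc.le, ← Real.inv_rpow hc.le,
      ← Real.mul_rpow (by positivity) hb.le]
    refine Real.rpow_le_rpow_of_nonpos (by positivity) ?_ hs
    rw [inv_mul_le_iff₀ hc]
    exact hba

theorem weight_le_add (s : ℝ) (k : Fin n → ℤ) {m : Fin n → ℤ} (hm : m ∈ neighbors n) :
    weight s k ≤ ENNReal.ofReal ((1 + 2 * √n) ^ |s|) * weight s (k + m) := by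
  rw [mem_neighbors] at hm
  rw [weight, weight, ← ENNReal.ofReal_mul (by positivity)]
  apply ENNReal.ofReal_le_ofReal
  have h1 : ‖latticePoint k‖ ≤ ‖latticePoint (k + m)‖ + ‖latticePoint m‖ := by
    have := norm_sub_le (latticePoint (k + m)) (latticePoint m)
    rw [latticePoint_add] at this ⊢
    rwa [add_sub_cancel_right] at this
  have h2 : ‖latticePoint (k + m)‖ ≤ ‖latticePoint k‖ + ‖latticePoint m‖ := by
    rw [latticePoint_add]; exact norm_add_le _ _
  have h3 := Real.sqrt_nonneg (n : ℝ)
  have h4 := norm_nonneg (latticePoint k)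
  have h5 := norm_nonneg (latticePoint (k + m))
  exact rpow_le_of_comparable (by positivity) (by positivity) (by nlinarith) (by nlinarith)

theorem latticePoint_injective : Function.Injective (latticePoint : (Fin n → ℤ) → _) := by
  intro k l h
  ext i
  have h2 := congrArg (fun v : EuclideanSpace ℝ (Fin n) => v i) h
  simpa [latticePoint] using h2

/-- Containment in some discrete subgroup is enough: summability of powers of the norm passes to
subfamilies. -/
theorem exists_discrete_lattice (n : ℕ) : ∃ L : Submodule ℤ (EuclideanSpace ℝ (Fin n)),
    DiscreteTopology L ∧ ∀ k : Fin n → ℤ, latticePoint k ∈ L := by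
  obtain ⟨b, hb⟩ : ∃ b : Module.Basis (Fin n) ℝ (EuclideanSpace ℝ (Fin n)),
      ∀ i, b i = EuclideanSpace.single i 1 :=
    ⟨(EuclideanSpace.basisFun (Fin n) ℝ).toBasis, by simp⟩
  refine ⟨Submodule.span ℤ (Set.range b), inferInstance, fun k => ?_⟩
  have : latticePoint k = ∑ i, k i • b i := by
    ext i
    simp [latticePoint, hb, Finset.sum_apply, Pi.single_apply]
  rw [this]
  exact Submodule.sum_mem _ fun i _ => Submodule.smul_mem _ _
    (Submodule.subset_span (Set.mem_range_self i))

theorem exists_summable_norm_latticePoint (n : ℕ) : ∃ r : ℝ, 0 < r ∧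
    Summable fun k : Fin n → ℤ => ‖latticePoint k‖ ^ (-r) := by
  obtain ⟨L, hdisc, hmem⟩ := exists_discrete_lattice n
  obtain ⟨d, hd⟩ : ∃ d, d = Module.finrank ℤ L := ⟨_, rfl⟩
  have hs := ZLattice.summable_norm_rpow L (-(d + 1 : ℝ)) (by rw [← hd]; linarith)
  have hinj : Function.Injective fun k : Fin n → ℤ => (⟨latticePoint k, hmem k⟩ : L) :=
    fun k l h => latticePoint_injective (congrArg Subtype.val h)
  refine ⟨d + 1, by positivity, ?_⟩
  have := hs.comp_injective hinj
  simpa only [Function.comp_def, Submodule.coe_norm] using this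

theorem exists_tsum_weight_ne_top (n : ℕ) : ∃ r : ℝ, 0 < r ∧
    ∑' k : Fin n → ℤ, weight (-r) k ≠ ⊤ := by
  obtain ⟨r, hr0, hs⟩ := exists_summable_norm_latticePoint n
  refine ⟨r, hr0, ?_⟩
  have hs2 : Summable fun k : Fin n → ℤ => (1 + ‖latticePoint k‖) ^ (-r) := by
    refine Summable.of_norm_bounded_eventually hs ?_
    -- The origin is exceptional: in Lean the real power 0^(-r) is 0, which does not dominate (1 +
    -- 0)^(-r) = 1.
    refine (Set.finite_singleton (0 : Fin n → ℤ)).subset fun k hk => ?_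
    by_contra h
    apply hk
    have h3 : 0 < ‖latticePoint k‖ := by
      rw [norm_pos_iff]
      intro h0
      exact h (latticePoint_injective (h0.trans latticePoint_zero.symm))
    simp only [Set.mem_ofPred_eq]
    rw [Real.norm_of_nonneg (by positivity)]
    exact Real.rpow_le_rpow_of_nonpos h3 (by linarith) (by linarith)
  simp only [weight]
  exact hs2.tsum_ofReal_ne_top

/-! ### The symbols `σ_k` -/

theorem IsBump.summable (hρ : IsBump ρ) (ξ) :
    Summable fun l : Fin n → ℤ => ρ (ξ - latticePoint l) :=
  summable_of_hasFiniteSupport (hρ.locallyFinite.point_finite ξ)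

theorem IsBump.sigma_nonneg (hρ : IsBump ρ) (k ξ) : 0 ≤ sigma ρ k ξ :=
  div_nonneg (hρ.mem_Icc _).1 (zero_le_one.trans (hρ.one_le_tsum ξ))

theorem IsBump.sigma_le_one (hρ : IsBump ρ) (k ξ) : sigma ρ k ξ ≤ 1 := by
  refine div_le_one_of_le₀ ?_ (zero_le_one.trans (hρ.one_le_tsum ξ))
  exact (hρ.mem_Icc _).2.trans (hρ.one_le_tsum ξ)

theorem IsBump.norm_sub_lt (hρ : IsBump ρ) {k ξ} (h : sigma ρ k ξ ≠ 0) :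
    ‖ξ - latticePoint k‖ < √n := by
  by_contra h'
  exact h (by rw [sigma, hρ.eq_zero _ (not_lt.1 h'), zero_div])

theorem sigma_eq_sub (ρ : EuclideanSpace ℝ (Fin n) → ℝ) (k ξ) :
    sigma ρ k ξ = sigma ρ 0 (ξ - latticePoint k) := by
  rw [sigma, sigma, latticePoint_zero, sub_zero,
    ← (Equiv.addLeft k).tsum_eq fun l => ρ (ξ - latticePoint l)]
  simp [latticePoint_add, sub_sub]

theorem IsBump.hasSum_sigma (hρ : IsBump ρ) (ξ) : HasSum (fun k => sigma ρ k ξ) 1 := by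
  have h := (hρ.summable ξ).hasSum.div_const (∑' l : Fin n → ℤ, ρ (ξ - latticePoint l))
  rwa [div_self (by have := hρ.one_le_tsum ξ; positivity)] at h

theorem IsBump.sub_mem_neighbors (hρ : IsBump ρ) {k l ξ} (hk : sigma ρ k ξ ≠ 0)
    (hl : sigma ρ l ξ ≠ 0) : l - k ∈ neighbors n := by
  rw [mem_neighbors, sub_eq_add_neg, latticePoint_add, latticePoint_neg, ← sub_eq_add_neg]
  have h1 := hρ.norm_sub_lt hk
  have h2 := hρ.norm_sub_lt hl
  have h3 : latticePoint l - latticePoint k =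
    (ξ - latticePoint k) - (ξ - latticePoint l) := by abel
  rw [h3]
  linarith [norm_sub_le (ξ - latticePoint k) (ξ - latticePoint l)]

/-- This lets a block be reproduced from its neighbours: σ_k = σ_k ∑ σ_{k+m}. -/
theorem IsBump.sum_neighbors_sigma (hρ : IsBump ρ) {k ξ} (hk : sigma ρ k ξ ≠ 0) :
    ∑ m ∈ neighbors n, sigma ρ (k + m) ξ = 1 := by
  have h : HasSum (fun m => sigma ρ (k + m) ξ) 1 :=
    (Equiv.addLeft k).hasSum_iff (f := fun l => sigma ρ l ξ) |>.2 (hρ.hasSum_sigma ξ)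
  refine (hasSum_sum_of_ne_finset_zero fun m hm => ?_).unique h
  by_contra h'
  exact hm (by simpa using hρ.sub_mem_neighbors hk h')

/-! ### The weighted sequence norms -/

theorem weightedSeqNorm_eq {s : ℝ} {q : ℝ≥0∞} (hq : q ≠ ⊤) (a : (Fin n → ℤ) → ℝ≥0∞) :
    weightedSeqNorm s q a = (∑' k, (weight s k * a k) ^ q.toReal) ^ (1 / q.toReal) := by
  rw [weightedSeqNorm, if_neg hq]
  congr 2
  ext k
  rw [ENNReal.mul_rpow_of_nonneg _ _ ENNReal.toReal_nonneg, weight_rpow _ ENNReal.toReal_nonneg,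
    weight]

theorem weight_mul_le_weightedSeqNorm {s : ℝ} {q : ℝ≥0∞} (hq1 : 1 ≤ q) (hq : q ≠ ⊤)
    (a : (Fin n → ℤ) → ℝ≥0∞) (k : Fin n → ℤ) : weight s k * a k ≤ weightedSeqNorm s q a := by
  have hq0 : 0 < q.toReal := ENNReal.toReal_pos (zero_lt_one.trans_le hq1).ne' hq
  rw [weightedSeqNorm_eq hq]
  calc weight s k * a k = ((weight s k * a k) ^ q.toReal) ^ (1 / q.toReal) := by
        rw [← ENNReal.rpow_mul, mul_one_div_cancel hq0.ne', ENNReal.rpow_one]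
    _ ≤ _ := by gcongr; exact ENNReal.le_tsum k

theorem weightedSeqNorm_mono {s : ℝ} {q : ℝ≥0∞} (hq : q ≠ ⊤) {a b : (Fin n → ℤ) → ℝ≥0∞}
    (h : ∀ k, a k ≤ b k) : weightedSeqNorm s q a ≤ weightedSeqNorm s q b := by
  rw [weightedSeqNorm_eq hq, weightedSeqNorm_eq hq]
  gcongr with k
  exact h k

/-- The shifts are finitely many, each preserves the unweighted ℓ^q norm, and each changes the
weight by a bounded factor. -/
theorem weightedSeqNorm_le_of_le_sum {s d : ℝ} {q : ℝ≥0∞} (hq1 : 1 ≤ q) (hq : q ≠ ⊤) :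
    ∃ M : ℝ≥0, ∀ (C : ℝ≥0∞) (a b : (Fin n → ℤ) → ℝ≥0∞),
      (∀ k, a k ≤ C * (weight d k * ∑ m ∈ neighbors n, b (k + m))) →
      weightedSeqNorm s q a ≤ M * C * weightedSeqNorm (s + d) q b := by
  have hq0 : 0 < q.toReal := ENNReal.toReal_pos (zero_lt_one.trans_le hq1).ne' hq
  set c : ℝ≥0∞ := ENNReal.ofReal ((1 + 2 * √n) ^ |s + d|) with hc
  have hctop : c ≠ ⊤ := ENNReal.ofReal_ne_top
  set L : ℝ≥0∞ := ((neighbors n).card : ℝ≥0∞) with hL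
  -- The factor `c` moves the weight from k to k + m, `L` bounds a sum over the neighbours by its
  -- ℓ^q norm, and `L ^ (1 / q.toReal)` comes from summing over all shifts.
  have hM : c * L * L ^ (1 / q.toReal) ≠ ⊤ := by
    have : L ^ (1 / q.toReal) ≠ ⊤ := ENNReal.rpow_ne_top_of_nonneg (by positivity) (by simp [hL])
    finiteness
  refine ⟨(c * L * L ^ (1 / q.toReal)).toNNReal, fun C a b h => ?_⟩
  rw [ENNReal.coe_toNNReal hM]
  set β : (Fin n → ℤ) → ℝ≥0∞ := fun k => weight (s + d) k * b k with hβ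
  have h1 : ∀ k, (weight s k * a k) ^ q.toReal ≤
      (c * C * L) ^ q.toReal * ∑ m ∈ neighbors n, β (k + m) ^ q.toReal := by
    intro k
    have h2 : weight s k * a k ≤ c * C * ∑ m ∈ neighbors n, β (k + m) := by
      calc weight s k * a k ≤ weight s k * (C * (weight d k * ∑ m ∈ neighbors n, b (k + m))) := by
            gcongr; exact h k
        _ = C * ∑ m ∈ neighbors n, weight (s + d) k * b (k + m) := by
            rw [← Finset.mul_sum, weight_add]; ring
        _ ≤ C * ∑ m ∈ neighbors n, c * β (k + m) := by
            refine mul_le_mul_right (Finset.sum_le_sum fun m hm => ?_) _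
            rw [hβ, ← mul_assoc]
            exact mul_le_mul_left (weight_le_add _ _ hm) _
        _ = _ := by rw [← Finset.mul_sum]; ring
    have h3 : (∑ m ∈ neighbors n, β (k + m)) ^ q.toReal ≤
        L ^ q.toReal * ∑ m ∈ neighbors n, β (k + m) ^ q.toReal := by
      have h4 : ∀ m ∈ neighbors n, β (k + m) ≤
          (∑ m ∈ neighbors n, β (k + m) ^ q.toReal) ^ (1 / q.toReal) := by
        intro m hm
        calc β (k + m) = (β (k + m) ^ q.toReal) ^ (1 / q.toReal) := by
              rw [← ENNReal.rpow_mul, mul_one_div_cancel hq0.ne', ENNReal.rpow_one]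
          _ ≤ _ := by
              gcongr
              exact Finset.single_le_sum (f := fun m => β (k + m) ^ q.toReal)
                (fun _ _ => zero_le) hm
      calc (∑ m ∈ neighbors n, β (k + m)) ^ q.toReal ≤
          (L * (∑ m ∈ neighbors n, β (k + m) ^ q.toReal) ^ (1 / q.toReal)) ^ q.toReal := by
            gcongr
            refine (Finset.sum_le_card_nsmul _ _ _ h4).trans ?_
            rw [nsmul_eq_mul]
        _ = _ := by
            rw [ENNReal.mul_rpow_of_nonneg _ _ hq0.le, ← ENNReal.rpow_mul,
              one_div_mul_cancel hq0.ne', ENNReal.rpow_one]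
    calc (weight s k * a k) ^ q.toReal ≤ (c * C * ∑ m ∈ neighbors n, β (k + m)) ^ q.toReal := by
          gcongr
      _ = (c * C) ^ q.toReal * (∑ m ∈ neighbors n, β (k + m)) ^ q.toReal :=
          ENNReal.mul_rpow_of_nonneg _ _ hq0.le
      _ ≤ (c * C) ^ q.toReal * (L ^ q.toReal * ∑ m ∈ neighbors n, β (k + m) ^ q.toReal) := by
          gcongr
      _ = _ := by rw [← mul_assoc, ← ENNReal.mul_rpow_of_nonneg _ _ hq0.le]
  rw [weightedSeqNorm_eq hq, weightedSeqNorm_eq hq]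
  calc (∑' k, (weight s k * a k) ^ q.toReal) ^ (1 / q.toReal)
      ≤ (∑' k, (c * C * L) ^ q.toReal * ∑ m ∈ neighbors n, β (k + m) ^ q.toReal)
        ^ (1 / q.toReal) := by gcongr with k; exact h1 k
    _ = ((c * C * L) ^ q.toReal * (L * ∑' k, β k ^ q.toReal)) ^ (1 / q.toReal) := by
        rw [ENNReal.tsum_mul_left]
        congr 2
        rw [Summable.tsum_finsetSum fun _ _ => ENNReal.summable]
        have : ∀ m, ∑' k, β (k + m) ^ q.toReal = ∑' k, β k ^ q.toReal := fun m =>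
          (Equiv.addRight m).tsum_eq fun k => β k ^ q.toReal
        simp_rw [this]
        rw [Finset.sum_const, nsmul_eq_mul]
    _ = _ := by
        rw [ENNReal.mul_rpow_of_nonneg _ _ (by positivity), ← ENNReal.rpow_mul,
          mul_one_div_cancel hq0.ne', ENNReal.rpow_one,
          ENNReal.mul_rpow_of_nonneg _ _ (by positivity)]
        ring

/-- Such a sequence is dominated by the neighbour sums of the point mass `B` at k; the symmetry of
`neighbors n` exchanges l - k and k - l. -/
theorem weightedSeqNorm_le_of_local {s : ℝ} {q : ℝ≥0∞} (hq1 : 1 ≤ q) (hq : q ≠ ⊤) :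
    ∃ M : ℝ≥0, ∀ (a : (Fin n → ℤ) → ℝ≥0∞) (k : Fin n → ℤ) (B : ℝ≥0∞),
      (∀ l, l - k ∉ neighbors n → a l = 0) → (∀ l, a l ≤ B) →
      weightedSeqNorm s q a ≤ M * (weight s k * B) := by
  have hq0 : 0 < q.toReal := ENNReal.toReal_pos (zero_lt_one.trans_le hq1).ne' hq
  obtain ⟨M, hM⟩ := weightedSeqNorm_le_of_le_sum (n := n) (s := s) (d := 0) hq1 hq
  refine ⟨M, fun a k B h0 hB => ?_⟩
  have := hM 1 a (Pi.single k B) fun l => by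
    rw [one_mul, weight_zero, one_mul]
    by_cases hl : l - k ∈ neighbors n
    · refine (hB l).trans ?_
      have h1 : k - l ∈ neighbors n := by simpa using neg_mem_neighbors hl
      calc B = (Pi.single k B : (Fin n → ℤ) → ℝ≥0∞) (l + (k - l)) := by simp
        _ ≤ _ := Finset.single_le_sum (f := fun m => (Pi.single k B : (Fin n → ℤ) → ℝ≥0∞) (l + m))
            (fun _ _ => zero_le) h1
    · rw [h0 l hl]; exact zero_le
  rw [mul_one, add_zero] at this
  refine this.trans (le_of_eq ?_)
  congr 1
  rw [weightedSeqNorm_eq hq, tsum_eq_single k]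
  · rw [Pi.single_eq_same, ← ENNReal.rpow_mul, mul_one_div_cancel hq0.ne', ENNReal.rpow_one]
  · intro l hl
    rw [Pi.single_eq_of_ne hl, mul_zero, ENNReal.zero_rpow_of_pos hq0]

/-! ### Young's inequality -/

/-- Hölder's inequality for the measure with density a, through the splitting a = a^(1/r') a^(1/r).
-/
theorem lintegral_mul_rpow_le {X : Type*} [MeasurableSpace X] (ν : Measure X) {r : ℝ} (hr : 1 < r)
    {a b : X → ℝ≥0∞} (ha : Measurable a) (hb : Measurable b) :
    (∫⁻ y, a y * b y ∂ν) ^ r ≤ (∫⁻ y, a y ∂ν) ^ (r - 1) * ∫⁻ y, a y * b y ^ r ∂ν := by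
  have hr0 : 0 < r := by linarith
  have hconj := (Real.HolderConjugate.conjExponent hr).symm
  set r' := r.conjExponent with hr'
  have hr'0 : 0 < r' := hconj.pos
  have hsum : 1 / r' + 1 / r = 1 := by simpa [one_div] using hconj.inv_add_inv_eq_one
  have e : ∀ y, a y * b y = a y ^ (1 / r') * (a y ^ (1 / r) * b y) := by
    intro y
    rw [← mul_assoc, ← ENNReal.rpow_add_of_nonneg _ _ (by positivity) (by positivity), hsum,
      ENNReal.rpow_one]
  have h := ENNReal.lintegral_mul_le_Lp_mul_Lq ν hconj
    (f := fun y => a y ^ (1 / r')) (g := fun y => a y ^ (1 / r) * b y)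
    (by fun_prop) (by fun_prop)
  simp only [Pi.mul_apply] at h
  simp_rw [← e] at h
  have e1 : ∀ y, (a y ^ (1 / r')) ^ r' = a y := fun y => by
    rw [← ENNReal.rpow_mul, one_div_mul_cancel hr'0.ne', ENNReal.rpow_one]
  have e2 : ∀ y, (a y ^ (1 / r) * b y) ^ r = a y * b y ^ r := fun y => by
    rw [ENNReal.mul_rpow_of_nonneg _ _ hr0.le, ← ENNReal.rpow_mul, one_div_mul_cancel hr0.ne',
      ENNReal.rpow_one]
  simp_rw [e1, e2] at h
  calc (∫⁻ y, a y * b y ∂ν) ^ r ≤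
      ((∫⁻ y, a y ∂ν) ^ (1 / r') * (∫⁻ y, a y * b y ^ r ∂ν) ^ (1 / r)) ^ r := by gcongr
    _ = _ := by
      rw [ENNReal.mul_rpow_of_nonneg _ _ hr0.le, ← ENNReal.rpow_mul, ← ENNReal.rpow_mul,
        one_div_mul_cancel hr0.ne', ENNReal.rpow_one]
      congr 2
      have : 1 / r' = 1 - 1 / r := by linarith
      rw [this]; field_simp

section Young

variable {E : Type*} [NormedAddCommGroup E] [InnerProductSpace ℝ E] [FiniteDimensional ℝ E]
  [MeasurableSpace E] [BorelSpace E]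

theorem lintegral_convolution_rpow_le {r : ℝ} (hr : 1 < r) {a b : E → ℝ≥0∞} (ha : Measurable a)
    (hb : Measurable b) :
    ∫⁻ x, (∫⁻ y, a y * b (x - y)) ^ r ≤ (∫⁻ y, a y) ^ r * ∫⁻ x, b x ^ r := by
  calc ∫⁻ x, (∫⁻ y, a y * b (x - y)) ^ r
      ≤ ∫⁻ x, (∫⁻ y, a y) ^ (r - 1) * ∫⁻ y, a y * b (x - y) ^ r :=
        lintegral_mono fun x => lintegral_mul_rpow_le volume hr ha (by fun_prop)
    _ = (∫⁻ y, a y) ^ (r - 1) * ∫⁻ x, ∫⁻ y, a y * b (x - y) ^ r :=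
        lintegral_const_mul _ (Measurable.lintegral_prod_right'
          (f := fun p : E × E => a p.2 * b (p.1 - p.2) ^ r) (by fun_prop))
    _ = (∫⁻ y, a y) ^ (r - 1) * ∫⁻ y, ∫⁻ x, a y * b (x - y) ^ r := by
        rw [lintegral_lintegral_swap (f := fun x y => a y * b (x - y) ^ r)
          (by unfold Function.uncurry; fun_prop)]
    _ = (∫⁻ y, a y) ^ (r - 1) * ((∫⁻ y, a y) * ∫⁻ x, b x ^ r) := by
        congr 1
        rw [← lintegral_mul_const _ ha]
        refine lintegral_congr fun y => ?_
        rw [lintegral_const_mul _ (by fun_prop),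
          lintegral_sub_right_eq_self (fun x => b x ^ r) y]
    _ = _ := by
        rw [← mul_assoc]
        congr 1
        nth_rw 2 [← ENNReal.rpow_one (∫⁻ y, a y)]
        rw [← ENNReal.rpow_add_of_nonneg _ _ (by linarith) (by norm_num)]
        congr 1; ring

theorem eLpNorm_convolution_le {p : ℝ≥0∞} (hp : 1 < p) (hp' : p ≠ ⊤) (κ g : 𝓢(E, ℂ)) :
    eLpNorm (SchwartzMap.convolution (ContinuousLinearMap.mul ℂ ℂ) κ g) p volume ≤
      eLpNorm κ 1 volume * eLpNorm g p volume := by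
  have hp0 : p ≠ 0 := (zero_lt_one.trans hp).ne'
  have hr : 1 < p.toReal := by
    rw [← ENNReal.toReal_one]; exact (ENNReal.toReal_lt_toReal (by simp) hp').2 hp
  have hr0 : 0 < p.toReal := by linarith
  rw [eLpNorm_eq_lintegral_rpow_enorm_toReal hp0 hp', eLpNorm_eq_lintegral_rpow_enorm_toReal hp0 hp',
    eLpNorm_one_eq_lintegral_enorm]
  have h : ∀ x, ‖SchwartzMap.convolution (ContinuousLinearMap.mul ℂ ℂ) κ g x‖ₑ ≤
      ∫⁻ y, ‖κ y‖ₑ * ‖g (x - y)‖ₑ := by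
    intro x
    rw [SchwartzMap.convolution_apply, convolution_def]
    refine (enorm_integral_le_lintegral_enorm _).trans (le_of_eq ?_)
    simp [enorm_mul]
  calc _ ≤ (∫⁻ x, (∫⁻ y, ‖κ y‖ₑ * ‖g (x - y)‖ₑ) ^ p.toReal) ^ (1 / p.toReal) := by
        gcongr with x; exact h x
    _ ≤ ((∫⁻ y, ‖κ y‖ₑ) ^ p.toReal * ∫⁻ x, ‖g x‖ₑ ^ p.toReal) ^ (1 / p.toReal) := by
        gcongr
        exact lintegral_convolution_rpow_le hr (by fun_prop) (by fun_prop)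
    _ = _ := by
        rw [ENNReal.mul_rpow_of_nonneg _ _ (by positivity), ← ENNReal.rpow_mul,
          mul_one_div_cancel hr0.ne', ENNReal.rpow_one]

end Young

/-! ### Frequency-uniform decomposition of Schwartz functions -/

theorem IsBump.hasCompactSupport_sigma (hρ : IsBump ρ) (k) :
    HasCompactSupport fun ξ => ((sigma ρ k ξ : ℝ) : ℂ) := by
  apply HasCompactSupport.of_support_subset_isCompact
    (isCompact_closedBall (latticePoint k) (√n))
  intro ξ hξ
  have h : sigma ρ k ξ ≠ 0 := by simpa using hξ
  rw [mem_closedBall_iff_norm]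
  exact (hρ.norm_sub_lt h).le

/-- The symbol `σ_k` as a Schwartz function. -/
noncomputable def sigmaSchwartz (hρ : IsBump ρ) (k : Fin n → ℤ) : 𝓢(EuclideanSpace ℝ (Fin n), ℂ) :=
  (hρ.hasCompactSupport_sigma k).toSchwartzMap (hρ.hasTemperateGrowth_sigma k).1

/-- The operator `□_k` on Schwartz functions. -/
noncomputable def boxSchwartz (ρ : EuclideanSpace ℝ (Fin n) → ℝ) (k : Fin n → ℤ)
    (g : 𝓢(EuclideanSpace ℝ (Fin n), ℂ)) : 𝓢(EuclideanSpace ℝ (Fin n), ℂ) :=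
  SchwartzMap.fourierMultiplierCLM ℂ (fun ξ => ((sigma ρ k ξ : ℝ) : ℂ)) g

theorem schwartz_fourier_injective :
    Function.Injective fun f : 𝓢(EuclideanSpace ℝ (Fin n), ℂ) =>
      (𝓕 f : 𝓢(EuclideanSpace ℝ (Fin n), ℂ)) := by
  intro f g h
  have := congrArg (fun u : 𝓢(EuclideanSpace ℝ (Fin n), ℂ) =>
    (𝓕⁻ u : 𝓢(EuclideanSpace ℝ (Fin n), ℂ))) h
  simpa using this

theorem IsBump.fourier_boxSchwartz (hρ : IsBump ρ) (k g ξ) :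
    𝓕 (boxSchwartz ρ k g) ξ = sigma ρ k ξ * 𝓕 g ξ := by
  rw [boxSchwartz, SchwartzMap.fourierMultiplierCLM_apply, FourierTransform.fourier_fourierInv_eq,
    SchwartzMap.smulLeftCLM_apply_apply (hρ.hasTemperateGrowth_sigma k), smul_eq_mul]

theorem IsBump.box_coe (hρ : IsBump ρ) (k) (g : 𝓢(EuclideanSpace ℝ (Fin n), ℂ)) :
    box ρ k (g : 𝓢'(EuclideanSpace ℝ (Fin n), ℂ)) = boxSchwartz ρ k g :=
  TemperedDistribution.fourierMultiplierCLM_toTemperedDistributionCLM_eq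
    (hρ.hasTemperateGrowth_sigma k) g

theorem IsBump.boxSchwartz_boxSchwartz_eq_zero (hρ : IsBump ρ) {k l} (h : l - k ∉ neighbors n) (g) :
    boxSchwartz ρ l (boxSchwartz ρ k g) = 0 := by
  apply schwartz_fourier_injective
  ext ξ
  simp only [FourierTransform.fourier_zero]
  rw [hρ.fourier_boxSchwartz, hρ.fourier_boxSchwartz]
  by_cases hk : sigma ρ k ξ = 0
  · simp [hk]
  by_cases hl : sigma ρ l ξ = 0
  · simp [hl]
  exact absurd (hρ.sub_mem_neighbors hk hl) h

theorem IsBump.boxSchwartz_eq_convolution (hρ : IsBump ρ) (k g) :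
    boxSchwartz ρ k g =
      SchwartzMap.convolution (ContinuousLinearMap.mul ℂ ℂ) (𝓕⁻ (sigmaSchwartz hρ k)) g := by
  apply schwartz_fourier_injective
  ext ξ
  simp only
  rw [hρ.fourier_boxSchwartz, SchwartzMap.fourier_convolution,
    FourierTransform.fourier_fourierInv_eq, SchwartzMap.pairing_apply_apply]
  rfl

/-- The symbols are translates of σ_0, so the kernels differ by a factor of modulus one. This makes
the L^p bound of □_k uniform in k. -/
theorem IsBump.norm_fourierInv_sigmaSchwartz (hρ : IsBump ρ) (k x) :
    ‖𝓕⁻ (sigmaSchwartz hρ k) x‖ = ‖𝓕⁻ (sigmaSchwartz hρ 0) x‖ := by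
  rw [SchwartzMap.fourierInv_coe, SchwartzMap.fourierInv_coe, Real.fourierInv_eq_fourier_neg,
    Real.fourierInv_eq_fourier_neg]
  have : (sigmaSchwartz hρ k : EuclideanSpace ℝ (Fin n) → ℂ) =
      sigmaSchwartz hρ 0 ∘ fun v => v + -latticePoint k := by
    ext ξ
    change ((sigma ρ k ξ : ℝ) : ℂ) = ((sigma ρ 0 (ξ + -latticePoint k) : ℝ) : ℂ)
    rw [sigma_eq_sub, sub_eq_add_neg]
  rw [this, Real.fourier_eq, Real.fourier_eq]
  have h := congrFun (VectorFourier.fourierIntegral_comp_add_right Real.fourierChar volume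
    (innerₗ (EuclideanSpace ℝ (Fin n))) (sigmaSchwartz hρ 0) (-latticePoint k)) (-x)
  simp only [VectorFourier.fourierIntegral] at h
  simp only [innerₗ_apply_apply] at h
  rw [h, Circle.norm_smul]

/-- The common operator bound of the `□_k` on Lebesgue spaces. -/
noncomputable def boxBound (hρ : IsBump ρ) : ℝ≥0∞ :=
  eLpNorm (𝓕⁻ (sigmaSchwartz hρ 0) : 𝓢(EuclideanSpace ℝ (Fin n), ℂ)) 1 volume

theorem boxBound_ne_top (hρ : IsBump ρ) : boxBound hρ ≠ ⊤ :=
  ((𝓕⁻ (sigmaSchwartz hρ 0)).memLp 1 volume).2.ne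

theorem IsBump.eLpNorm_boxSchwartz_le (hρ : IsBump ρ) {p : ℝ≥0∞} (hp : 1 < p) (hp' : p ≠ ⊤) (k g) :
    eLpNorm (boxSchwartz ρ k g) p volume ≤ boxBound hρ * eLpNorm g p volume := by
  rw [hρ.boxSchwartz_eq_convolution]
  refine (eLpNorm_convolution_le hp hp' _ _).trans (le_of_eq ?_)
  congr 1
  exact eLpNorm_congr_norm_ae (Filter.Eventually.of_forall
    fun x => hρ.norm_fourierInv_sigmaSchwartz k x)

/-! ### Lebesgue norms of tempered distributions -/

theorem representedBy_coe (g : 𝓢(EuclideanSpace ℝ (Fin n), ℂ)) :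
    RepresentedBy (g : 𝓢'(EuclideanSpace ℝ (Fin n), ℂ)) g := by
  intro φ
  have h : ∀ x, g x * φ x = SchwartzMap.pairing (ContinuousLinearMap.mul ℂ ℂ) g φ x := by
    intro x; simp [SchwartzMap.pairing_apply_apply]
  refine ⟨?_, ?_⟩
  · simp_rw [h]
    exact SchwartzMap.integrable _
  · rw [SchwartzMap.coe_apply]
    simp [mul_comm]

theorem lebesgueNorm_le {p : ℝ≥0∞} {u : 𝓢'(EuclideanSpace ℝ (Fin n), ℂ)}
    {g : EuclideanSpace ℝ (Fin n) → ℂ} (hg : MemLp g p volume) (h : RepresentedBy u g) :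
    lebesgueNorm p u ≤ eLpNorm g p volume :=
  iInf_le_of_le g (iInf_le_of_le hg (iInf_le_of_le h le_rfl))

theorem lebesgueNorm_coe_le (p : ℝ≥0∞) (g : 𝓢(EuclideanSpace ℝ (Fin n), ℂ)) :
    lebesgueNorm p (g : 𝓢'(EuclideanSpace ℝ (Fin n), ℂ)) ≤ eLpNorm g p volume :=
  lebesgueNorm_le (g.memLp p volume) (representedBy_coe g)

theorem enorm_apply_le {p p' : ℝ≥0∞} (hpp' : p⁻¹ + p'⁻¹ = 1)
    (u : 𝓢'(EuclideanSpace ℝ (Fin n), ℂ)) (φ : 𝓢(EuclideanSpace ℝ (Fin n), ℂ)) :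
    ‖u φ‖ₑ ≤ lebesgueNorm p u * eLpNorm φ p' volume := by
  have : ENNReal.HolderConjugate p p' := ENNReal.holderConjugate_iff.2 hpp'
  -- If `lebesgueNorm p u` is infinite, the right side is ∞ * 0 = 0 when φ has norm zero; that case
  -- is settled by φ = 0.
  rcases eq_or_ne (eLpNorm φ p' volume) 0 with h0 | h0
  · have hp'0 : p' ≠ 0 := by
      rintro rfl
      simp at hpp'
    rw [eLpNorm_eq_zero_iff φ.continuous.aestronglyMeasurable hp'0] at h0
    have h1 : (φ : EuclideanSpace ℝ (Fin n) → ℂ) = 0 :=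
      Continuous.ae_eq_iff_eq volume φ.continuous continuous_zero |>.1 h0
    have h2 : φ = 0 := by ext x; exact congrFun h1 x
    simp [h2]
  · have hfin : eLpNorm φ p' volume ≠ ⊤ := (φ.memLp p' volume).2.ne
    rw [← ENNReal.div_le_iff h0 hfin]
    refine le_iInf fun g => le_iInf fun hg => le_iInf fun hu => ?_
    rw [ENNReal.div_le_iff h0 hfin, (hu φ).2]
    refine (enorm_integral_le_lintegral_enorm _).trans ?_
    rw [← eLpNorm_one_eq_lintegral_enorm]
    exact eLpNorm_smul_le_mul_eLpNorm (𝕜 := ℂ) (φ := g) (f := φ)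
      φ.continuous.aestronglyMeasurable hg.1

/-- Only the blocks near k survive, and there the weight is comparable to its value at k; each of
the two operators □ costs one `boxBound`. -/
theorem modulationNorm_boxSchwartz_le (hρ : IsBump ρ) (s : ℝ) {p q : ℝ≥0∞} (hp : 1 < p)
    (hp' : p ≠ ⊤) (hq1 : 1 ≤ q) (hq : q ≠ ⊤) :
    ∃ M : ℝ≥0, ∀ k (g : 𝓢(EuclideanSpace ℝ (Fin n), ℂ)),
      modulationNorm ρ s p q (boxSchwartz ρ k g : 𝓢'(EuclideanSpace ℝ (Fin n), ℂ)) ≤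
        M * (weight s k * eLpNorm g p volume) := by
  obtain ⟨M, hM⟩ := weightedSeqNorm_le_of_local (n := n) (s := s) hq1 hq
  have hb := boxBound_ne_top hρ
  refine ⟨M * ((boxBound hρ).toNNReal * (boxBound hρ).toNNReal), fun k g => ?_⟩
  have h := hM (fun l => lebesgueNorm p
      (box ρ l (boxSchwartz ρ k g : 𝓢'(EuclideanSpace ℝ (Fin n), ℂ)))) k
      (boxBound hρ * (boxBound hρ * eLpNorm g p volume)) (fun l hl => by
        rw [hρ.box_coe, hρ.boxSchwartz_boxSchwartz_eq_zero hl]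
        refine le_antisymm ((lebesgueNorm_coe_le p _).trans ?_) zero_le
        simp) (fun l => by
        rw [hρ.box_coe]
        refine (lebesgueNorm_coe_le p _).trans ((hρ.eLpNorm_boxSchwartz_le hp hp' _ _).trans ?_)
        gcongr
        exact hρ.eLpNorm_boxSchwartz_le hp hp' _ _)
  refine h.trans (le_of_eq ?_)
  push_cast
  rw [ENNReal.coe_toNNReal hb]
  ring

/-- The dispersive estimate for a single frequency block. -/
theorem exists_box_dispersive_bound (hρ : IsBump ρ) {P : EuclideanSpace ℝ (Fin n) → ℝ}
    {p p' q : ℝ≥0∞} (hp : 1 < p') (hp' : p' ≠ ⊤) (hq1 : 1 ≤ q) (hq : q ≠ ⊤) {α δ μ : ℝ}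
    (hU : ∃ A : ℝ≥0, ∀ (t : ℝ) (f : 𝓢(EuclideanSpace ℝ (Fin n), ℂ)),
      modulationNorm ρ α p q (dispersiveGroup P t (f : 𝓢'(EuclideanSpace ℝ (Fin n), ℂ))) ≤
        A * ENNReal.ofReal ((1 + |t|) ^ (-μ)) *
          modulationNorm ρ (α + δ) p' q (f : 𝓢'(EuclideanSpace ℝ (Fin n), ℂ))) :
    ∃ D : ℝ≥0, ∀ k t (g : 𝓢(EuclideanSpace ℝ (Fin n), ℂ)),
      lebesgueNorm p (box ρ k (dispersiveGroup P t
        (boxSchwartz ρ k g : 𝓢'(EuclideanSpace ℝ (Fin n), ℂ)))) ≤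
        D * weight δ k * ENNReal.ofReal ((1 + |t|) ^ (-μ)) * eLpNorm g p' volume := by
  obtain ⟨A, hA⟩ := hU
  obtain ⟨M, hM⟩ := modulationNorm_boxSchwartz_le hρ (α + δ) hp hp' hq1 hq
  refine ⟨A * M, fun k t g => ?_⟩
  have h1 : weight α k * lebesgueNorm p (box ρ k (dispersiveGroup P t
      (boxSchwartz ρ k g : 𝓢'(EuclideanSpace ℝ (Fin n), ℂ)))) ≤
      weight α k * ((A * M : ℝ≥0) * weight δ k * ENNReal.ofReal ((1 + |t|) ^ (-μ)) *
        eLpNorm g p' volume) := by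
    -- Of the norm on the left only the k-th term is kept. Its weight of order α cancels against the
    -- order α + δ on the right, which removes α from the problem.
    refine (weight_mul_le_weightedSeqNorm hq1 hq (fun l => lebesgueNorm p (box ρ l
      (dispersiveGroup P t (boxSchwartz ρ k g : 𝓢'(EuclideanSpace ℝ (Fin n), ℂ))))) k).trans ?_
    refine (hA t (boxSchwartz ρ k g)).trans ?_
    calc _ ≤ A * ENNReal.ofReal ((1 + |t|) ^ (-μ)) *
          (M * (weight (α + δ) k * eLpNorm g p' volume)) := by gcongr; exact hM k g
      _ = _ := by rw [weight_add]; push_cast; ring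
  exact (ENNReal.mul_le_mul_iff_right (weight_ne_zero _ _) (weight_ne_top _ _)).1 h1

/-! ### Localization of tempered distributions -/

section Cutoff

variable {E : Type*} [NormedAddCommGroup E] [InnerProductSpace ℝ E] [FiniteDimensional ℝ E]

/-- A compactly supported smooth function which is `1` on the unit ball. -/
noncomputable def cutoff (E : Type*) [NormedAddCommGroup E] [InnerProductSpace ℝ E]
    [FiniteDimensional ℝ E] : 𝓢(E, ℂ) :=
  let b : ContDiffBump (0 : E) := ⟨1, 2, one_pos, one_lt_two⟩
  (b.hasCompactSupport.comp_left Complex.ofReal_zero : HasCompactSupport fun x => ((b x : ℝ) : ℂ))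
    |>.toSchwartzMap (Complex.ofRealCLM.contDiff.comp b.contDiff)

theorem cutoff_eq_one {x : E} (hx : ‖x‖ ≤ 1) : cutoff E x = 1 := by
  let b : ContDiffBump (0 : E) := ⟨1, 2, one_pos, one_lt_two⟩
  have h : b x = 1 := b.one_of_mem_closedBall (by simpa [mem_closedBall_iff_norm] using hx)
  change ((b x : ℝ) : ℂ) = 1
  rw [h, Complex.ofReal_one]

theorem cutoff_eq_zero {x : E} (hx : 2 ≤ ‖x‖) : cutoff E x = 0 := by
  let b : ContDiffBump (0 : E) := ⟨1, 2, one_pos, one_lt_two⟩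
  have h : b x = 0 := b.zero_of_le_dist (by simpa using hx)
  change ((b x : ℝ) : ℂ) = 0
  rw [h, Complex.ofReal_zero]

theorem norm_cutoff_sub_one_le (x : E) : ‖cutoff E x - 1‖ ≤ 1 := by
  let b : ContDiffBump (0 : E) := ⟨1, 2, one_pos, one_lt_two⟩
  change ‖((b x : ℝ) : ℂ) - 1‖ ≤ 1
  rw [← Complex.ofReal_one, ← Complex.ofReal_sub, Complex.norm_real, Real.norm_eq_abs, abs_le]
  constructor <;> linarith [b.nonneg (x := x), b.le_one (x := x)]

theorem contDiff_cutoff_comp_smul (a : ℝ) : ContDiff ℝ ∞ fun x : E => cutoff E (a • x) :=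
  ((cutoff E).smooth ⊤).comp (contDiff_const_smul a)

/-- The Schwartz function `x ↦ cutoff (a x) φ x`. -/
noncomputable def cutoffMul (a : ℝ) (φ : 𝓢(E, ℂ)) : 𝓢(E, ℂ) :=
  SchwartzMap.smulLeftCLM ℂ (fun x => cutoff E (a • x)) φ

theorem hasTemperateGrowth_cutoff_comp_smul (a : ℝ) :
    (fun x : E => cutoff E (a • x)).HasTemperateGrowth :=
  (cutoff E).hasTemperateGrowth.comp (by fun_prop)

theorem cutoffMul_apply (a : ℝ) (φ : 𝓢(E, ℂ)) (x : E) :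
    cutoffMul a φ x = cutoff E (a • x) * φ x :=
  SchwartzMap.smulLeftCLM_apply_apply (hasTemperateGrowth_cutoff_comp_smul a) _ _

/-- For i = 0 the difference vanishes unless ‖a x‖ > 1, and there it is at most 1 ≤ a ‖x‖; for i > 0
the chain rule gives a^i ≤ a. The growth 1 + ‖x‖ is later absorbed by a Schwartz seminorm with one
more power of ‖x‖. -/
theorem exists_norm_iteratedFDeriv_cutoff_sub_one_le (i : ℕ) :
    ∃ C : ℝ, 0 ≤ C ∧ ∀ a : ℝ, 0 < a → a ≤ 1 → ∀ x : E,
      ‖iteratedFDeriv ℝ i (fun x : E => cutoff E (a • x) - 1) x‖ ≤ C * a * (1 + ‖x‖) := by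
  rcases Nat.eq_zero_or_pos i with rfl | hi
  · refine ⟨1, zero_le_one, fun a ha _ x => ?_⟩
    rw [norm_iteratedFDeriv_zero, one_mul]
    by_cases hx : ‖a • x‖ ≤ 1
    · rw [cutoff_eq_one hx, sub_self, norm_zero]
      positivity
    · refine (norm_cutoff_sub_one_le _).trans ?_
      rw [norm_smul, Real.norm_of_nonneg ha.le] at hx
      nlinarith
  · refine ⟨SchwartzMap.seminorm ℝ 0 i (cutoff E), apply_nonneg _ _, fun a ha ha1 x => ?_⟩
    have h1 : iteratedFDeriv ℝ i (fun x : E => cutoff E (a • x) - 1) x =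
        iteratedFDeriv ℝ i (fun x : E => cutoff E (a • x)) x := by
      have := iteratedFDeriv_sub_apply (𝕜 := ℝ) (i := i) (x := x)
        (f := fun x : E => cutoff E (a • x)) (g := fun _ => (1 : ℂ))
        ((contDiff_cutoff_comp_smul a).contDiffAt.of_le (by exact_mod_cast le_top))
        contDiffAt_const
      rw [iteratedFDeriv_const_of_ne hi.ne', Pi.zero_apply, sub_zero] at this
      exact this
    rw [h1, iteratedFDeriv_comp_const_smul a ((cutoff E).smooth i)]
    simp only
    rw [norm_smul, norm_pow, Real.norm_of_nonneg ha.le]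
    calc a ^ i * ‖iteratedFDeriv ℝ i (cutoff E) (a • x)‖
        ≤ a * SchwartzMap.seminorm ℝ 0 i (cutoff E) := by
          gcongr
          · exact pow_le_of_le_one ha.le ha1 hi.ne'
          · exact SchwartzMap.norm_iteratedFDeriv_le_seminorm ℝ _ _ _
      _ = SchwartzMap.seminorm ℝ 0 i (cutoff E) * a * 1 := by ring
      _ ≤ _ := by
          gcongr
          linarith [norm_nonneg x]

theorem tendsto_cutoffMul (φ : 𝓢(E, ℂ)) :
    Filter.Tendsto (fun m : ℕ => cutoffMul (1 / ((m : ℝ) + 1)) φ) Filter.atTop (nhds φ) := by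
  rw [(schwartz_withSeminorms ℝ E ℂ).tendsto_nhds_atTop _ _]
  rintro ⟨k, N⟩ ε hε
  choose C hC0 hC using fun i => exists_norm_iteratedFDeriv_cutoff_sub_one_le (E := E) i
  set M : ℝ := ∑ i ∈ Finset.range (N + 1), (N.choose i : ℝ) * C i *
    (SchwartzMap.seminorm ℝ k (N - i) φ + SchwartzMap.seminorm ℝ (k + 1) (N - i) φ) with hM
  have hM0 : 0 ≤ M := Finset.sum_nonneg fun i _ => by
    have := hC0 i
    have h1 := apply_nonneg (SchwartzMap.seminorm ℝ k (N - i)) φ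
    have h2 := apply_nonneg (SchwartzMap.seminorm ℝ (k + 1) (N - i)) φ
    positivity
  have key : ∀ a : ℝ, 0 < a → a ≤ 1 →
      SchwartzMap.seminorm ℝ k N (cutoffMul a φ - φ) ≤ M * a := by
    intro a ha ha1
    refine SchwartzMap.seminorm_le_bound ℝ k N _ (by positivity) fun x => ?_
    have e : (⇑(cutoffMul a φ - φ) : E → ℂ) = fun x => (cutoff E (a • x) - 1) * φ x := by
      ext y
      rw [sub_apply, cutoffMul_apply]; ring
    rw [e]
    have hb := norm_iteratedFDeriv_mul_le (𝕜 := ℝ) (n := N) (N := ∞)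
      (f := fun x : E => cutoff E (a • x) - 1) (g := φ)
      ((contDiff_cutoff_comp_smul a).sub contDiff_const) (φ.smooth ⊤) x
      (by exact_mod_cast le_top)
    calc _ ≤ ‖x‖ ^ k * ∑ i ∈ Finset.range (N + 1), (N.choose i : ℝ) *
          ‖iteratedFDeriv ℝ i (fun x : E => cutoff E (a • x) - 1) x‖ *
            ‖iteratedFDeriv ℝ (N - i) φ x‖ := by gcongr
      _ ≤ M * a := by
        rw [hM, Finset.mul_sum, Finset.sum_mul]
        refine Finset.sum_le_sum fun i _ => ?_
        have h1 := SchwartzMap.le_seminorm ℝ k (N - i) φ x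
        have h2 := SchwartzMap.le_seminorm ℝ (k + 1) (N - i) φ x
        have h3 := hC0 i
        calc ‖x‖ ^ k * ((N.choose i : ℝ) *
              ‖iteratedFDeriv ℝ i (fun x : E => cutoff E (a • x) - 1) x‖ *
                ‖iteratedFDeriv ℝ (N - i) φ x‖)
            ≤ ‖x‖ ^ k * ((N.choose i : ℝ) * (C i * a * (1 + ‖x‖)) *
                ‖iteratedFDeriv ℝ (N - i) φ x‖) := by
              gcongr
              exact hC i a ha ha1 x
          _ = (N.choose i : ℝ) * C i * (‖x‖ ^ k * ‖iteratedFDeriv ℝ (N - i) φ x‖ +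
                ‖x‖ ^ (k + 1) * ‖iteratedFDeriv ℝ (N - i) φ x‖) * a := by ring
          _ ≤ _ := by gcongr
  obtain ⟨m0, hm0⟩ := exists_nat_gt (M / ε)
  refine ⟨m0, fun m hm => ?_⟩
  have hm1 : (0 : ℝ) < m + 1 := by positivity
  have hlt : M < ε * (m + 1) := by
    rw [div_lt_iff₀ hε] at hm0
    have : (m0 : ℝ) ≤ m := by exact_mod_cast hm
    nlinarith
  refine (key (1 / (m + 1)) (by positivity) ?_).trans_lt ?_
  · rw [div_le_one hm1]; linarith [(Nat.cast_nonneg m : (0 : ℝ) ≤ m)]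
  · rw [mul_one_div, div_lt_iff₀ hm1]; exact hlt

end Cutoff

/-- A compactly supported test function is a finite sum of its pieces σ_l φ, which T annihilates;
truncation by cutoffs then reaches every Schwartz function. -/
theorem IsBump.eq_zero_of_smulLeftCLM_eq_zero (hρ : IsBump ρ)
    {T : 𝓢'(EuclideanSpace ℝ (Fin n), ℂ)}
    (hT : ∀ l, TemperedDistribution.smulLeftCLM ℂ (fun ξ => ((sigma ρ l ξ : ℝ) : ℂ)) T = 0) :
    T = 0 := by
  have hcs : ∀ (φ : 𝓢(EuclideanSpace ℝ (Fin n), ℂ)) (R : ℝ), (∀ x, R ≤ ‖x‖ → φ x = 0) →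
      T φ = 0 := by
    intro φ R hR
    set F := (finite_norm_latticePoint_le (n := n) (R + √n)).toFinset
    have e : φ = ∑ l ∈ F, SchwartzMap.smulLeftCLM ℂ (fun ξ => ((sigma ρ l ξ : ℝ) : ℂ)) φ := by
      ext ξ
      rw [sum_apply]
      simp_rw [SchwartzMap.smulLeftCLM_apply_apply (hρ.hasTemperateGrowth_sigma _), smul_eq_mul]
      rw [← Finset.sum_mul]
      by_cases hξ : R ≤ ‖ξ‖
      · simp [hR ξ hξ]
      · have h1 : ∑ l ∈ F, sigma ρ l ξ = 1 := by
          refine (hasSum_sum_of_ne_finset_zero fun l hl => ?_).unique (hρ.hasSum_sigma ξ)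
          by_contra h
          apply hl
          have h2 := hρ.norm_sub_lt h
          have h3 := norm_sub_norm_le (latticePoint l) ξ
          rw [norm_sub_rev] at h2
          simp only [F, Set.Finite.mem_toFinset, Set.mem_ofPred_eq]
          linarith
        rw [← Complex.ofReal_sum, h1, Complex.ofReal_one, one_mul]
    rw [e, map_sum]
    refine Finset.sum_eq_zero fun l _ => ?_
    have := congrArg (fun S : 𝓢'(EuclideanSpace ℝ (Fin n), ℂ) => S φ) (hT l)
    simpa using this
  ext φ
  have h0 : ∀ m : ℕ, T (cutoffMul (1 / ((m : ℝ) + 1)) φ) = 0 := by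
    intro m
    have hm1 : (0 : ℝ) < m + 1 := by positivity
    refine hcs _ (2 * (m + 1)) fun x hx => ?_
    rw [cutoffMul_apply, cutoff_eq_zero, zero_mul]
    rw [norm_smul, Real.norm_of_nonneg (by positivity), one_div, inv_mul_eq_div, le_div_iff₀ hm1]
    exact hx
  have h1 := (T.continuous.tendsto φ).comp (tendsto_cutoffMul φ)
  have h2 : Filter.Tendsto (fun _ : ℕ => (0 : ℂ)) Filter.atTop (nhds (T φ)) := by
    refine h1.congr fun m => ?_
    exact h0 m
  exact tendsto_nhds_unique h2 tendsto_const_nhds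

theorem IsBump.ext_smulLeftCLM (hρ : IsBump ρ) {S T : 𝓢'(EuclideanSpace ℝ (Fin n), ℂ)}
    (h : ∀ l, TemperedDistribution.smulLeftCLM ℂ (fun ξ => ((sigma ρ l ξ : ℝ) : ℂ)) S =
      TemperedDistribution.smulLeftCLM ℂ (fun ξ => ((sigma ρ l ξ : ℝ) : ℂ)) T) : S = T := by
  rw [← sub_eq_zero]
  refine hρ.eq_zero_of_smulLeftCLM_eq_zero fun l => ?_
  rw [map_sub, h l, sub_self]

/-! ### Tempered distributions represented by functions -/

theorem RepresentedBy.congr {u : 𝓢'(EuclideanSpace ℝ (Fin n), ℂ)}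
    {F G : EuclideanSpace ℝ (Fin n) → ℂ} (h : RepresentedBy u F) (hFG : F =ᵐ[volume] G) :
    RepresentedBy u G := by
  intro φ
  have e : (fun x => F x * φ x) =ᵐ[volume] fun x => G x * φ x := by
    filter_upwards [hFG] with x hx
    rw [hx]
  exact ⟨(h φ).1.congr e, (h φ).2.trans (integral_congr_ae e)⟩

theorem RepresentedBy.ext {u v : 𝓢'(EuclideanSpace ℝ (Fin n), ℂ)}
    {F G : EuclideanSpace ℝ (Fin n) → ℂ} (hu : RepresentedBy u F) (hv : RepresentedBy v G)
    (hFG : F =ᵐ[volume] G) : u = v := by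
  ext φ
  rw [((hu.congr hFG) φ).2, (hv φ).2]

theorem RepresentedBy.locallyIntegrable {u : 𝓢'(EuclideanSpace ℝ (Fin n), ℂ)}
    {F : EuclideanSpace ℝ (Fin n) → ℂ} (h : RepresentedBy u F) : LocallyIntegrable F volume := by
  rw [locallyIntegrable_iff]
  intro K hK
  obtain ⟨R, hR⟩ := hK.isBounded.exists_norm_le
  let b : ContDiffBump (0 : EuclideanSpace ℝ (Fin n)) :=
    ⟨|R| + 1, |R| + 2, by positivity, by linarith⟩
  have hb1 : HasCompactSupport fun x => ((b x : ℝ) : ℂ) :=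
    b.hasCompactSupport.comp_left Complex.ofReal_zero
  have hb2 : ContDiff ℝ ∞ fun x => ((b x : ℝ) : ℂ) := Complex.ofRealCLM.contDiff.comp b.contDiff
  have hi := (h (hb1.toSchwartzMap hb2)).1.integrableOn (s := K)
  refine hi.congr_fun (fun x hx => ?_) hK.measurableSet
  have : b x = 1 := b.one_of_mem_closedBall (by
    rw [mem_closedBall_iff_norm, sub_zero]
    exact (hR x hx).trans ((le_abs_self R).trans (by linarith)))
  change F x * ((b x : ℝ) : ℂ) = F x
  rw [this, Complex.ofReal_one, mul_one]

theorem RepresentedBy.ae_eq {u : 𝓢'(EuclideanSpace ℝ (Fin n), ℂ)}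
    {F G : EuclideanSpace ℝ (Fin n) → ℂ} (hF : RepresentedBy u F) (hG : RepresentedBy u G) :
    F =ᵐ[volume] G := by
  refine ae_eq_of_integral_contDiff_smul_eq hF.locallyIntegrable hG.locallyIntegrable
    fun g hg hgc => ?_
  have hb1 : HasCompactSupport fun x => ((g x : ℝ) : ℂ) := hgc.comp_left Complex.ofReal_zero
  have hb2 : ContDiff ℝ ∞ fun x => ((g x : ℝ) : ℂ) := Complex.ofRealCLM.contDiff.comp hg
  have h1 := (hF (hb1.toSchwartzMap hb2)).2
  rw [(hG (hb1.toSchwartzMap hb2)).2] at h1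
  have e : ∀ F : EuclideanSpace ℝ (Fin n) → ℂ, ∫ x, g x • F x =
      ∫ x, F x * (hb1.toSchwartzMap hb2) x := by
    intro F
    refine integral_congr_ae (Filter.Eventually.of_forall fun x => ?_)
    change (g x : ℝ) • F x = F x * ((g x : ℝ) : ℂ)
    rw [Complex.real_smul, mul_comm]
  rw [e, e, h1]

theorem RepresentedBy.smulLeftCLM {u : 𝓢'(EuclideanSpace ℝ (Fin n), ℂ)}
    {F m : EuclideanSpace ℝ (Fin n) → ℂ} (h : RepresentedBy u F) (hm : m.HasTemperateGrowth) :
    RepresentedBy (TemperedDistribution.smulLeftCLM ℂ m u) fun ξ => m ξ * F ξ := by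
  intro φ
  have e : (fun x => m x * F x * φ x) =
      fun x => F x * SchwartzMap.smulLeftCLM ℂ m φ x := by
    ext x
    rw [SchwartzMap.smulLeftCLM_apply_apply hm, smul_eq_mul]; ring
  rw [e]
  exact ⟨(h _).1, (h _).2⟩

theorem RepresentedBy.const_smul {u : 𝓢'(EuclideanSpace ℝ (Fin n), ℂ)}
    {F : EuclideanSpace ℝ (Fin n) → ℂ} (h : RepresentedBy u F) (c : ℂ) :
    RepresentedBy (c • u) (c • F) := by
  intro φ
  have e : (fun x => (c • F) x * φ x) = fun x => c * (F x * φ x) := by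
    ext x
    rw [Pi.smul_apply, smul_eq_mul, mul_assoc]
  rw [e]
  refine ⟨(h φ).1.const_mul c, ?_⟩
  rw [integral_const_mul, ← (h φ).2]
  rfl

theorem representedBy_toTemperedDistribution {p : ℝ≥0∞} [Fact (1 ≤ p)]
    (f : Lp ℂ p (volume : Measure (EuclideanSpace ℝ (Fin n)))) :
    RepresentedBy (f : 𝓢'(EuclideanSpace ℝ (Fin n), ℂ)) f := by
  intro φ
  have : ENNReal.HolderConjugate p (1 - p⁻¹)⁻¹ :=
    ENNReal.HolderConjugate.inv_one_sub_inv' Fact.out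
  refine ⟨(Lp.memLp f).integrable_mul (φ.memLp (1 - p⁻¹)⁻¹ volume), ?_⟩
  rw [Lp.toTemperedDistribution_apply]
  simp [mul_comm]

theorem RepresentedBy.eq_toTemperedDistribution {p : ℝ≥0∞} [Fact (1 ≤ p)]
    {u : 𝓢'(EuclideanSpace ℝ (Fin n), ℂ)} {g : EuclideanSpace ℝ (Fin n) → ℂ}
    (h : RepresentedBy u g) (hg : MemLp g p volume) : u = hg.toLp g :=
  h.ext (representedBy_toTemperedDistribution _) hg.coeFn_toLp.symm

theorem exists_fourier_representedBy {u : 𝓢'(EuclideanSpace ℝ (Fin n), ℂ)}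
    (hu : lebesgueNorm 2 u ≠ ⊤) : ∃ G : EuclideanSpace ℝ (Fin n) → ℂ, MemLp G 2 volume ∧
      RepresentedBy (𝓕 u) G ∧ eLpNorm G 2 volume ≤ lebesgueNorm 2 u := by
  obtain ⟨g, hg, hug⟩ : ∃ g : EuclideanSpace ℝ (Fin n) → ℂ, MemLp g 2 volume ∧
      RepresentedBy u g := by
    by_contra! h
    apply hu
    simp only [lebesgueNorm, iInf_eq_top]
    intro g hg hg'
    exact absurd hg' (h g hg)
  have hu' := hug.eq_toTemperedDistribution hg
  refine ⟨(𝓕 (hg.toLp g) : Lp ℂ 2 (volume : Measure (EuclideanSpace ℝ (Fin n)))),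
    Lp.memLp _, ?_, ?_⟩
  · rw [hu', Lp.fourier_toTemperedDistribution_eq]
    exact representedBy_toTemperedDistribution _
  · have h1 : eLpNorm (𝓕 (hg.toLp g) : Lp ℂ 2 (volume : Measure (EuclideanSpace ℝ (Fin n)))) 2
        volume = eLpNorm g 2 volume := by
      rw [← Lp.enorm_def, ← ofReal_norm, Lp.norm_fourier_eq, ofReal_norm, Lp.enorm_def,
        eLpNorm_congr_ae hg.coeFn_toLp]
    rw [h1]
    refine le_iInf fun g' => le_iInf fun hg' => le_iInf fun hu'' => ?_
    rw [eLpNorm_congr_ae (hug.ae_eq hu'')]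

theorem IsBump.representedBy_fourier_box (hρ : IsBump ρ) {u : 𝓢'(EuclideanSpace ℝ (Fin n), ℂ)}
    {F : EuclideanSpace ℝ (Fin n) → ℂ} (h : RepresentedBy (𝓕 u) F) (k) :
    RepresentedBy (𝓕 (box ρ k u)) fun ξ => sigma ρ k ξ * F ξ := by
  rw [box, FourierTransform.fourier_fourierInv_eq]
  exact h.smulLeftCLM (hρ.hasTemperateGrowth_sigma k)

/-- The measurable functions that are integrable against some negative power of
`1 + |ξ|²`. -/
def ModerateGrowth (F : EuclideanSpace ℝ (Fin n) → ℂ) : Prop :=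
  ∃ m : ℕ, Integrable (fun ξ => F ξ / (((1 + ‖ξ‖ ^ 2) ^ m : ℝ) : ℂ)) volume

/-- The quotient of F by the weight is in L¹, hence a tempered distribution, and multiplication by
the weight preserves temperedness. -/
theorem ModerateGrowth.exists_representedBy {F : EuclideanSpace ℝ (Fin n) → ℂ}
    (hF : ModerateGrowth F) : ∃ T : 𝓢'(EuclideanSpace ℝ (Fin n), ℂ), RepresentedBy T F := by
  obtain ⟨m, hm⟩ := hF
  have h1 : MemLp (fun ξ => F ξ / (((1 + ‖ξ‖ ^ 2) ^ m : ℝ) : ℂ)) 1 volume :=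
    memLp_one_iff_integrable.2 hm
  have hw : (fun x : EuclideanSpace ℝ (Fin n) =>
      (((1 + ‖x‖ ^ 2) ^ m : ℝ) : ℂ)).HasTemperateGrowth := by fun_prop
  refine ⟨TemperedDistribution.smulLeftCLM ℂ
    (fun x : EuclideanSpace ℝ (Fin n) => (((1 + ‖x‖ ^ 2) ^ m : ℝ) : ℂ))
    (h1.toLp _ : Lp ℂ 1 (volume : Measure (EuclideanSpace ℝ (Fin n)))), ?_⟩
  refine ((representedBy_toTemperedDistribution _).smulLeftCLM hw).congr ?_
  filter_upwards [h1.coeFn_toLp] with x hx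
  rw [hx, mul_div_cancel₀]
  have : ((1 + ‖x‖ ^ 2) ^ m : ℝ) ≠ 0 := by positivity
  exact_mod_cast this

theorem norm_exp_I_mul_ofReal_mul_ofReal (t x : ℝ) :
    ‖Complex.exp (Complex.I * (t : ℂ) * (x : ℂ))‖ = 1 := by
  rw [mul_assoc, ← Complex.ofReal_mul, mul_comm]
  exact Complex.norm_exp_ofReal_mul_I _

theorem ModerateGrowth.mul_phase {F : EuclideanSpace ℝ (Fin n) → ℂ} (hF : ModerateGrowth F)
    {P : EuclideanSpace ℝ (Fin n) → ℝ} (hP : Measurable P) (t : ℝ) :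
    ModerateGrowth fun ξ => Complex.exp (Complex.I * (t : ℂ) * (P ξ : ℂ)) * F ξ := by
  obtain ⟨m, hm⟩ := hF
  refine ⟨m, ?_⟩
  simp_rw [mul_div_assoc]
  refine hm.bdd_mul (c := 1) (by fun_prop) ?_
  exact Filter.Eventually.of_forall fun ξ => (norm_exp_I_mul_ofReal_mul_ofReal t (P ξ)).le

theorem isEvolution_dispersiveGroup {P : EuclideanSpace ℝ (Fin n) → ℝ} (hP : Measurable P)
    {f : 𝓢'(EuclideanSpace ℝ (Fin n), ℂ)} {F : EuclideanSpace ℝ (Fin n) → ℂ}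
    (hF : ModerateGrowth F) (h : RepresentedBy (𝓕 f) F) (t : ℝ) :
    IsEvolution P t f (dispersiveGroup P t f) := by
  obtain ⟨T, hT⟩ := (hF.mul_phase hP t).exists_representedBy
  have hex : ∃ u, IsEvolution P t f u := by
    refine ⟨𝓕⁻ T, F, h, ?_⟩
    rwa [FourierTransform.fourier_fourierInv_eq]
  rw [dispersiveGroup, dif_pos hex]
  exact hex.choose_spec

/-- The chosen evolution comes with its own representative of 𝓕 f; uniqueness of representatives
almost everywhere identifies it with the given `F`. -/
theorem representedBy_fourier_dispersiveGroup {P : EuclideanSpace ℝ (Fin n) → ℝ}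
    (hP : Measurable P) {f : 𝓢'(EuclideanSpace ℝ (Fin n), ℂ)} {F : EuclideanSpace ℝ (Fin n) → ℂ}
    (hF : ModerateGrowth F) (h : RepresentedBy (𝓕 f) F) (t : ℝ) :
    RepresentedBy (𝓕 (dispersiveGroup P t f))
      fun ξ => Complex.exp (Complex.I * (t : ℂ) * (P ξ : ℂ)) * F ξ := by
  obtain ⟨G, hG, hG'⟩ := isEvolution_dispersiveGroup hP hF h t
  refine hG'.congr ?_
  filter_upwards [hG.ae_eq h] with ξ hξ
  rw [hξ]

theorem moderateGrowth_schwartz (g : 𝓢(EuclideanSpace ℝ (Fin n), ℂ)) : ModerateGrowth g :=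
  ⟨0, by simpa using g.integrable⟩

/-! ### The Fourier transform of an element of `M^s_{2,q}` -/

/-- On the ball around k, 1 + |k| ≤ (1 + √n)(1 + |ξ|) ≤ 2 (1 + √n)(1 + |ξ|²). -/
theorem norm_div_one_add_sq_pow_le {z : ℂ} {ξ : EuclideanSpace ℝ (Fin n)} {k : Fin n → ℤ}
    (hξ : ‖ξ - latticePoint k‖ ≤ √n) (m : ℕ) :
    ‖z / (((1 + ‖ξ‖ ^ 2) ^ m : ℝ) : ℂ)‖ₑ ≤
      ENNReal.ofReal ((2 * (1 + √n)) ^ m) * (weight (-m) k * ‖z‖ₑ) := by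
  rw [weight, ← ofReal_norm, ← ofReal_norm, ← ENNReal.ofReal_mul (by positivity),
    ← ENNReal.ofReal_mul (by positivity)]
  apply ENNReal.ofReal_le_ofReal
  rw [norm_div, Complex.norm_real, Real.norm_of_nonneg (by positivity), Real.rpow_neg (by positivity),
    Real.rpow_natCast, div_eq_mul_inv, mul_comm, ← mul_assoc]
  gcongr
  rw [← div_eq_mul_inv, ← div_pow, ← inv_pow]
  gcongr
  rw [le_div_iff₀ (by positivity), inv_mul_le_iff₀ (by positivity)]
  have h1 : ‖latticePoint k‖ ≤ ‖ξ‖ + √n := by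
    have := norm_sub_norm_le (latticePoint k) ξ
    rw [norm_sub_rev] at this
    linarith
  have h2 := Real.sqrt_nonneg (n : ℝ)
  nlinarith [norm_nonneg ξ, sq_nonneg (‖ξ‖ - 1), mul_nonneg h2 (norm_nonneg ξ),
    mul_nonneg h2 (sq_nonneg ‖ξ‖), mul_nonneg h2 (sq_nonneg (‖ξ‖ - 1))]

theorem IsBump.lintegral_div_le (hρ : IsBump ρ) {G : EuclideanSpace ℝ (Fin n) → ℂ}
    (hG : MemLp G 2 volume) {k} (hGk : ∀ᵐ ξ, sigma ρ k ξ = 0 → G ξ = 0) (m : ℕ) :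
    ∫⁻ ξ, ‖G ξ / (((1 + ‖ξ‖ ^ 2) ^ m : ℝ) : ℂ)‖ₑ ≤
      ENNReal.ofReal ((2 * (1 + √n)) ^ m) *
        (weight (-m) k * (eLpNorm G 2 volume *
          volume (Metric.closedBall (0 : EuclideanSpace ℝ (Fin n)) (√n)) ^ (1 / 2 : ℝ))) := by
  set B := Metric.closedBall (latticePoint k) (√n) with hB
  have hBv : volume B = volume (Metric.closedBall (0 : EuclideanSpace ℝ (Fin n)) (√n)) := by
    rw [hB, Measure.addHaar_closedBall_center]
  calc _ ≤ ∫⁻ ξ, B.indicator (fun ξ => ENNReal.ofReal ((2 * (1 + √n)) ^ m) *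
        (weight (-m) k * ‖G ξ‖ₑ)) ξ := by
        refine lintegral_mono_ae ?_
        filter_upwards [hGk] with ξ hξ
        by_cases h : ξ ∈ B
        · rw [Set.indicator_of_mem h]
          exact norm_div_one_add_sq_pow_le (by rwa [hB, mem_closedBall_iff_norm] at h) m
        · have h0 : sigma ρ k ξ = 0 := by
            by_contra h'
            apply h
            rw [hB, mem_closedBall_iff_norm]
            exact (hρ.norm_sub_lt h').le
          rw [hξ h0, zero_div, enorm_zero]
          exact zero_le
    _ = ENNReal.ofReal ((2 * (1 + √n)) ^ m) * (weight (-m) k * ∫⁻ ξ in B, ‖G ξ‖ₑ) := by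
        rw [lintegral_indicator Metric.isClosed_closedBall.measurableSet,
          lintegral_const_mul' _ _ ENNReal.ofReal_ne_top,
          lintegral_const_mul' _ _ (weight_ne_top _ _)]
    _ ≤ _ := by
        gcongr
        rw [← eLpNorm_one_eq_lintegral_enorm, ← hBv]
        refine (eLpNorm_le_eLpNorm_mul_rpow_measure_univ (q := 2) (by norm_num)
          hG.1.restrict).trans ?_
        rw [Measure.restrict_apply_univ]
        norm_num
        gcongr
        exact Measure.restrict_le_self

/-- By Plancherel the blocks of 𝓕 f are L² functions G_l, and σ_k G_l = σ_l G_k. Hence F = ∑ G_l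
satisfies σ_l F = ∑ σ_k G_l = G_l. Cauchy–Schwarz on the supporting balls gives moderate growth, and
F represents 𝓕 f because the two agree after multiplication by every σ_l. -/
theorem exists_fourier_moderateGrowth (hρ : IsBump ρ) {s : ℝ} {q : ℝ≥0∞} (hq1 : 1 ≤ q)
    (hq : q ≠ ⊤) {f : 𝓢'(EuclideanSpace ℝ (Fin n), ℂ)} (hf : modulationNorm ρ s 2 q f ≠ ⊤) :
    ∃ F : EuclideanSpace ℝ (Fin n) → ℂ, ModerateGrowth F ∧ RepresentedBy (𝓕 f) F ∧
      ∀ l, MemLp (fun ξ => sigma ρ l ξ * F ξ) 2 volume ∧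
        eLpNorm (fun ξ => sigma ρ l ξ * F ξ) 2 volume ≤ lebesgueNorm 2 (box ρ l f) := by
  have hbound : ∀ l, weight s l * lebesgueNorm 2 (box ρ l f) ≤ modulationNorm ρ s 2 q f :=
    fun l => weight_mul_le_weightedSeqNorm hq1 hq (fun l => lebesgueNorm 2 (box ρ l f)) l
  have hfin : ∀ l, lebesgueNorm 2 (box ρ l f) ≠ ⊤ := by
    intro l h
    have := hbound l
    rw [h, ENNReal.mul_top (weight_ne_zero _ _)] at this
    exact hf (top_le_iff.1 this)
  choose G hG2 hGr hGn using fun l => exists_fourier_representedBy (hfin l)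
  have hGr' : ∀ l, RepresentedBy (TemperedDistribution.smulLeftCLM ℂ
      (fun ξ => ((sigma ρ l ξ : ℝ) : ℂ)) (𝓕 f)) (G l) := by
    intro l
    have := hGr l
    rwa [box, FourierTransform.fourier_fourierInv_eq] at this
  have hsymm : ∀ᵐ ξ, ∀ k l, (sigma ρ k ξ : ℂ) * G l ξ = sigma ρ l ξ * G k ξ := by
    rw [ae_all_iff]
    intro k
    rw [ae_all_iff]
    intro l
    have h1 := (hGr' l).smulLeftCLM (hρ.hasTemperateGrowth_sigma k)
    have h2 := (hGr' k).smulLeftCLM (hρ.hasTemperateGrowth_sigma l)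
    rw [TemperedDistribution.smulLeftCLM_smulLeftCLM_apply (hρ.hasTemperateGrowth_sigma _)
      (hρ.hasTemperateGrowth_sigma _)] at h1 h2
    rw [mul_comm] at h2
    exact h1.ae_eq h2
  set F : EuclideanSpace ℝ (Fin n) → ℂ := fun ξ => ∑' l, G l ξ with hF
  have hFm : AEStronglyMeasurable F volume :=
    (AEMeasurable.tsum fun l => (hG2 l).1.aemeasurable).aestronglyMeasurable
  have hFl : ∀ᵐ ξ, ∀ l, (sigma ρ l ξ : ℂ) * F ξ = G l ξ := by
    filter_upwards [hsymm] with ξ hξ l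
    have hs : HasSum (fun k => ((sigma ρ k ξ : ℝ) : ℂ)) ((1 : ℝ) : ℂ) :=
      Complex.hasSum_ofReal.2 (hρ.hasSum_sigma ξ)
    rw [hF, ← tsum_mul_left]
    simp_rw [← hξ _ l]
    rw [tsum_mul_right, hs.tsum_eq, Complex.ofReal_one, one_mul]
  have hFl' : ∀ l, (fun ξ => (sigma ρ l ξ : ℂ) * F ξ) =ᵐ[volume] G l := fun l => by
    filter_upwards [hFl] with ξ hξ
    exact hξ l
  have hmod : ModerateGrowth F := by
    obtain ⟨r, hr0, hr⟩ := exists_tsum_weight_ne_top n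
    -- The decay of order m has to compensate a possibly negative s and still leave the summable
    -- weight of order -r.
    obtain ⟨m, hm⟩ := exists_nat_ge (r - s)
    have hwm : AEMeasurable (fun ξ : EuclideanSpace ℝ (Fin n) =>
        (((1 + ‖ξ‖ ^ 2) ^ m : ℝ) : ℂ)) volume := by fun_prop
    refine ⟨m, (hFm.aemeasurable.div hwm).aestronglyMeasurable, ?_⟩
    rw [hasFiniteIntegral_iff_enorm]
    set c : ℝ≥0∞ := ENNReal.ofReal ((2 * (1 + √n)) ^ m) with hc
    set v : ℝ≥0∞ := volume (Metric.closedBall (0 : EuclideanSpace ℝ (Fin n)) (√n)) ^ (1 / 2 : ℝ)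
      with hv
    have hvtop : v ≠ ⊤ := ENNReal.rpow_ne_top_of_nonneg (by norm_num) measure_closedBall_lt_top.ne
    -- There is no loss here: G_l = σ_l F with σ_l ≥ 0 and ∑ σ_l = 1.
    have hpt : ∀ᵐ ξ, ‖F ξ / (((1 + ‖ξ‖ ^ 2) ^ m : ℝ) : ℂ)‖ₑ =
        ∑' l, ‖G l ξ / (((1 + ‖ξ‖ ^ 2) ^ m : ℝ) : ℂ)‖ₑ := by
      filter_upwards [hFl] with ξ hξ
      have hs : ∑' k, ENNReal.ofReal (sigma ρ k ξ) = 1 := by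
        rw [← ENNReal.ofReal_tsum_of_nonneg (fun k => hρ.sigma_nonneg k ξ)
          (hρ.hasSum_sigma ξ).summable, (hρ.hasSum_sigma ξ).tsum_eq, ENNReal.ofReal_one]
      have e : ∀ l, ‖G l ξ / (((1 + ‖ξ‖ ^ 2) ^ m : ℝ) : ℂ)‖ₑ =
          ENNReal.ofReal (sigma ρ l ξ) * ‖F ξ / (((1 + ‖ξ‖ ^ 2) ^ m : ℝ) : ℂ)‖ₑ := by
        intro l
        rw [← hξ l, mul_div_assoc, enorm_mul, ← ofReal_norm (sigma ρ l ξ : ℂ), Complex.norm_real,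
          Real.norm_of_nonneg (hρ.sigma_nonneg l ξ)]
      simp_rw [e]
      rw [ENNReal.tsum_mul_right, hs, one_mul]
    calc ∫⁻ ξ, ‖F ξ / (((1 + ‖ξ‖ ^ 2) ^ m : ℝ) : ℂ)‖ₑ
        = ∑' l, ∫⁻ ξ, ‖G l ξ / (((1 + ‖ξ‖ ^ 2) ^ m : ℝ) : ℂ)‖ₑ := by
          rw [lintegral_congr_ae hpt, lintegral_tsum]
          exact fun l => ((hG2 l).1.aemeasurable.div hwm).enorm
      _ ≤ ∑' l, c * modulationNorm ρ s 2 q f * v * weight (-r) l := by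
          refine ENNReal.tsum_le_tsum fun l => ?_
          refine (hρ.lintegral_div_le (hG2 l) (k := l) ?_ m).trans ?_
          · filter_upwards [hFl] with ξ hξ h0
            rw [← hξ l, h0, Complex.ofReal_zero, zero_mul]
          · have h3 : weight (-m) l ≤ weight (-r) l * weight s l := by
              rw [← weight_add]
              refine ENNReal.ofReal_le_ofReal (Real.rpow_le_rpow_of_exponent_le ?_ ?_)
              · linarith [norm_nonneg (latticePoint l)]
              · linarith
            calc _ ≤ c * ((weight (-r) l * weight s l) * (lebesgueNorm 2 (box ρ l f) * v)) := by
                  gcongr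
                  exact hGn l
              _ = c * (weight s l * lebesgueNorm 2 (box ρ l f)) * v * weight (-r) l := by ring
              _ ≤ _ := by
                  gcongr
                  exact hbound l
      _ < ⊤ := by
          rw [ENNReal.tsum_mul_left, lt_top_iff_ne_top]
          finiteness
  refine ⟨F, hmod, ?_, fun l => ⟨(memLp_congr_ae (hFl' l)).2 (hG2 l), ?_⟩⟩
  · obtain ⟨T, hT⟩ := hmod.exists_representedBy
    have : 𝓕 f = T := hρ.ext_smulLeftCLM fun l =>
      (hGr' l).ext (hT.smulLeftCLM (hρ.hasTemperateGrowth_sigma l)) (hFl' l).symm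
    rwa [this]
  · rw [eLpNorm_congr_ae (hFl' l)]
    exact hGn l

/-! ### Norming Schwartz functions -/

/-- The equality case of Hölder's inequality: the conjugate of w times |w|^(p-2), normalised. -/
theorem exists_norming_function {X : Type*} [MeasurableSpace X] {ν : Measure X} {p p' : ℝ≥0∞}
    (hp : 1 < p) (hp_top : p ≠ ⊤) (hpp' : p⁻¹ + p'⁻¹ = 1) {w : X → ℂ} (hw : MemLp w p ν)
    (h0 : eLpNorm w p ν ≠ 0) :
    ∃ g : X → ℂ, MemLp g p' ν ∧ eLpNorm g p' ν = 1 ∧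
      ∫ x, w x * g x ∂ν = ((eLpNorm w p ν).toReal : ℂ) := by
  have hconj : ENNReal.HolderConjugate p p' := ENNReal.holderConjugate_iff.2 hpp'
  set r := p.toReal with hr
  have hr1 : 1 < r := by
    rw [← ENNReal.toReal_one]; exact (ENNReal.toReal_lt_toReal (by simp) hp_top).2 hp
  have hr0 : 0 < r := by linarith
  set a := (eLpNorm w p ν).toReal with ha
  have ha0 : 0 < a := ENNReal.toReal_pos h0 hw.2.ne
  have haE : eLpNorm w p ν = ENNReal.ofReal a := (ENNReal.ofReal_toReal hw.2.ne).symm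
  have hp0 : p ≠ 0 := (zero_lt_one.trans hp).ne'
  have hp'0 : p' ≠ 0 := by
    rintro rfl
    simp at hpp'
  have hp't : p' ≠ ⊤ := by
    rintro rfl
    rw [ENNReal.inv_top, add_zero, ENNReal.inv_eq_one] at hpp'
    exact hp.ne' hpp'
  have hmul : p' * ENNReal.ofReal (r - 1) = p := by
    have h1 : r.HolderConjugate p'.toReal := hconj.toReal hr1
    rw [← ENNReal.ofReal_toReal hp't, ← ENNReal.ofReal_mul ENNReal.toReal_nonneg,
      ← ENNReal.ofReal_toReal hp_top]
    congr 1
    rw [mul_comm]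
    exact h1.sub_one_mul_conj
  set g0 : X → ℂ := fun x => (starRingEnd ℂ) (w x) * ((‖w x‖ ^ (r - 2) : ℝ) : ℂ) with hg0
  have hg0m : AEStronglyMeasurable g0 ν :=
    (Complex.continuous_conj.comp_aestronglyMeasurable hw.1).mul
      (Complex.continuous_ofReal.comp_aestronglyMeasurable
        (hw.1.norm.aemeasurable.pow_const _).aestronglyMeasurable)
  have hnorm : ∀ x, ‖g0 x‖ = ‖w x‖ ^ (r - 1) := by
    intro x
    rw [hg0, norm_mul, RCLike.norm_conj, Complex.norm_real, Real.norm_of_nonneg (by positivity)]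
    rcases eq_or_ne (‖w x‖) 0 with h | h
    · rw [h, zero_mul, Real.zero_rpow (by linarith)]
    · have : 0 < ‖w x‖ := lt_of_le_of_ne (norm_nonneg _) h.symm
      rw [show r - 1 = 1 + (r - 2) by ring, Real.rpow_add this, Real.rpow_one]
  have hg0n : eLpNorm g0 p' ν = ENNReal.ofReal (a ^ (r - 1)) := by
    rw [eLpNorm_congr_norm_ae (g := fun x => ‖w x‖ ^ (r - 1)) (Filter.Eventually.of_forall fun x => by
      rw [hnorm, Real.norm_of_nonneg (by positivity)]), eLpNorm_norm_rpow _ (by linarith), hmul, haE,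
      ENNReal.ofReal_rpow_of_nonneg ha0.le (by linarith)]
  have hint : ∫ x, w x * g0 x ∂ν = ((a ^ r : ℝ) : ℂ) := by
    have e : ∀ x, w x * g0 x = ((‖w x‖ ^ r : ℝ) : ℂ) := by
      intro x
      rw [hg0, ← mul_assoc, Complex.mul_conj, ← Complex.ofReal_mul, Complex.normSq_eq_norm_sq]
      congr 1
      rcases eq_or_ne (‖w x‖) 0 with h | h
      · rw [h, Real.zero_rpow hr0.ne']; simp
      · have : 0 < ‖w x‖ := lt_of_le_of_ne (norm_nonneg _) h.symm
        rw [← Real.rpow_natCast, ← Real.rpow_add this]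
        congr 1; push_cast; ring
    simp_rw [e]
    have hi : 0 ≤ ∫ x, ‖w x‖ ^ r ∂ν := integral_nonneg fun x => by positivity
    rw [integral_complex_ofReal, ha, hw.eLpNorm_eq_integral_rpow_norm hp0 hp_top,
      ENNReal.toReal_ofReal (by positivity), ← hr, Real.rpow_inv_rpow hi hr0.ne']
  have har : 0 < a ^ (r - 1) := by positivity
  refine ⟨fun x => (((a ^ (r - 1))⁻¹ : ℝ) : ℂ) • g0 x, ?_, ?_, ?_⟩
  · exact MemLp.const_smul (f := g0) ⟨hg0m, by rw [hg0n]; exact ENNReal.ofReal_lt_top⟩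
      (((a ^ (r - 1))⁻¹ : ℝ) : ℂ)
  · change eLpNorm ((((a ^ (r - 1))⁻¹ : ℝ) : ℂ) • g0) p' ν = 1
    rw [eLpNorm_const_smul, hg0n, ← ofReal_norm, Complex.norm_real, Real.norm_of_nonneg
      (by positivity), ← ENNReal.ofReal_mul (by positivity), inv_mul_cancel₀ har.ne',
      ENNReal.ofReal_one]
  · simp_rw [smul_eq_mul, mul_left_comm (w _)]
    rw [integral_const_mul, hint, ← Complex.ofReal_mul]
    congr 1
    rw [inv_mul_eq_div, ← Real.rpow_sub ha0]
    rw [sub_sub_cancel, Real.rpow_one]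

theorem enorm_integral_mul_le {X : Type*} [MeasurableSpace X] {ν : Measure X} {p p' : ℝ≥0∞}
    (hpp' : p⁻¹ + p'⁻¹ = 1) {w g : X → ℂ} (hw : AEStronglyMeasurable w ν)
    (hg : AEStronglyMeasurable g ν) :
    ‖∫ x, w x * g x ∂ν‖ₑ ≤ eLpNorm w p ν * eLpNorm g p' ν := by
  have : ENNReal.HolderConjugate p p' := ENNReal.holderConjugate_iff.2 hpp'
  refine (enorm_integral_le_lintegral_enorm _).trans ?_
  rw [← eLpNorm_one_eq_lintegral_enorm]
  exact eLpNorm_smul_le_mul_eLpNorm (𝕜 := ℂ) (φ := w) (f := g) hg hw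

theorem exists_norming_schwartz {p p' : ℝ≥0∞} (hp : 1 < p) (hp_top : p ≠ ⊤)
    (hpp' : p⁻¹ + p'⁻¹ = 1) {w : EuclideanSpace ℝ (Fin n) → ℂ} (hw : MemLp w p volume) :
    ∃ G : 𝓢(EuclideanSpace ℝ (Fin n), ℂ), eLpNorm G p' volume ≤ 1 ∧
      eLpNorm w p volume ≤ 2 * ‖∫ x, w x * G x‖ₑ := by
  rcases eq_or_ne (eLpNorm w p volume) 0 with h0 | h0
  · refine ⟨0, ?_, by rw [h0]; exact zero_le⟩
    refine le_trans (le_of_eq ?_) zero_le_one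
    exact eLpNorm_zero
  have hconj : ENNReal.HolderConjugate p p' := ENNReal.holderConjugate_iff.2 hpp'
  have hp'1 : 1 ≤ p' := hconj.symm.one_le
  have hp't : p' ≠ ⊤ := by
    rintro rfl
    rw [ENNReal.inv_top, add_zero, ENNReal.inv_eq_one] at hpp'
    exact hp.ne' hpp'
  obtain ⟨g, hg, hg1, hgi⟩ := exists_norming_function hp hp_top hpp' hw h0
  -- With tolerance 1/4 and the scaling by 4/5 below, the norm is at most 4/5 · 5/4 = 1, and the
  -- pairing is at least 4/5 · 3/4 = 3/5 of ‖w‖_p, more than the half that is needed.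
  obtain ⟨φ, hφ1, hφ2, hφ3⟩ := MemLp.exist_eLpNorm_sub_le hp't hp'1 hg
    (ε := 1 / 4) (by norm_num)
  set H : 𝓢(EuclideanSpace ℝ (Fin n), ℂ) := hφ1.toSchwartzMap hφ2
  have hH : (H : EuclideanSpace ℝ (Fin n) → ℂ) = φ := rfl
  have hHm : MemLp H p' volume := H.memLp p' volume
  rw [← hH] at hφ3
  set a := (eLpNorm w p volume).toReal with ha
  have haE : eLpNorm w p volume = ENNReal.ofReal a := (ENNReal.ofReal_toReal hw.2.ne).symm
  have ha0 : 0 < a := ENNReal.toReal_pos h0 hw.2.ne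
  have hi1 : Integrable (fun x => w x * g x) volume := hw.integrable_mul hg
  have hi2 : Integrable (fun x => w x * H x) volume := hw.integrable_mul hHm
  have hdiff : ‖(∫ x, w x * g x) - ∫ x, w x * H x‖ ≤ a * (1 / 4) := by
    rw [← integral_sub hi1 hi2]
    simp_rw [← mul_sub]
    rw [← ENNReal.ofReal_le_ofReal_iff (by positivity), ofReal_norm, ENNReal.ofReal_mul ha0.le,
      ← haE]
    refine (enorm_integral_mul_le hpp' hw.1 (hg.1.sub hHm.1)).trans ?_
    gcongr
  rw [hgi] at hdiff
  have hlow : a * (3 / 4) ≤ ‖∫ x, w x * H x‖ := by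
    have h1 := norm_sub_norm_le ((a : ℝ) : ℂ) (∫ x, w x * H x)
    rw [Complex.norm_real, Real.norm_of_nonneg ha0.le] at h1
    linarith
  refine ⟨((4 / 5 : ℝ) : ℂ) • H, ?_, ?_⟩
  · have h1 : eLpNorm H p' volume ≤ 1 + ENNReal.ofReal (1 / 4) := by
      have e : (H : EuclideanSpace ℝ (Fin n) → ℂ) = g - (g - H) := by simp
      rw [e]
      refine (eLpNorm_sub_le hg.1 (hg.1.sub hHm.1) hp'1).trans ?_
      rw [hg1]
      gcongr
    change eLpNorm (((4 / 5 : ℝ) : ℂ) • (H : EuclideanSpace ℝ (Fin n) → ℂ)) p' volume ≤ 1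
    rw [eLpNorm_const_smul, ← ofReal_norm, Complex.norm_real, Real.norm_of_nonneg (by norm_num)]
    calc _ ≤ ENNReal.ofReal (4 / 5) * (1 + ENNReal.ofReal (1 / 4)) := by gcongr
      _ = 1 := by
        rw [← ENNReal.ofReal_one, ← ENNReal.ofReal_add (by norm_num) (by norm_num),
          ← ENNReal.ofReal_mul (by norm_num)]
        norm_num
  · have e : ∫ x, w x * (((4 / 5 : ℝ) : ℂ) • H) x = ((4 / 5 : ℝ) : ℂ) * ∫ x, w x * H x := by
      rw [← integral_const_mul]
      refine integral_congr_ae (Filter.Eventually.of_forall fun x => ?_)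
      change w x * (((4 / 5 : ℝ) : ℂ) * H x) = _
      ring
    rw [e, haE, ← ofReal_norm, norm_mul, Complex.norm_real, Real.norm_of_nonneg (by norm_num)]
    calc ENNReal.ofReal a ≤ ENNReal.ofReal (2 * (4 / 5 * ‖∫ x, w x * H x‖)) :=
          ENNReal.ofReal_le_ofReal (by linarith)
      _ = _ := by rw [ENNReal.ofReal_mul zero_le_two, ENNReal.ofReal_ofNat]

/-! ### Bernstein's inequality -/

theorem enorm_fourierInv_le (W : EuclideanSpace ℝ (Fin n) → ℂ) (x) :
    ‖𝓕⁻ W x‖ₑ ≤ eLpNorm W 1 volume := by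
  rw [Real.fourierInv_eq, eLpNorm_one_eq_lintegral_enorm]
  refine (enorm_integral_le_lintegral_enorm _).trans (le_of_eq ?_)
  refine lintegral_congr fun y => ?_
  rw [← ofReal_norm, Circle.norm_smul, ofReal_norm]

theorem continuous_fourierInv {W : EuclideanSpace ℝ (Fin n) → ℂ} (hW : Integrable W volume) :
    Continuous (𝓕⁻ W) :=
  VectorFourier.fourierIntegral_continuous Real.continuous_fourierChar
    (L := -innerₗ (EuclideanSpace ℝ (Fin n))) (by
      simp only [LinearMap.neg_apply, innerₗ_apply_apply]; fun_prop) hW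

theorem RepresentedBy.of_fourier {u : 𝓢'(EuclideanSpace ℝ (Fin n), ℂ)}
    {W : EuclideanSpace ℝ (Fin n) → ℂ} (h : RepresentedBy (𝓕 u) W) (hW : Integrable W volume) :
    RepresentedBy u (𝓕⁻ W) := by
  intro φ
  constructor
  · have hb : eLpNorm W 1 volume ≠ ⊤ := (memLp_one_iff_integrable.2 hW).2.ne
    refine φ.integrable.bdd_mul (c := (eLpNorm W 1 volume).toReal)
      (continuous_fourierInv hW).aestronglyMeasurable (Filter.Eventually.of_forall fun x => ?_)
    rw [← toReal_enorm]
    exact ENNReal.toReal_mono hb (enorm_fourierInv_le W x)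
  · have h1 := (h (𝓕⁻ φ)).2
    rw [TemperedDistribution.fourier_apply, FourierTransform.fourier_fourierInv_eq] at h1
    rw [h1]
    have h2 := VectorFourier.integral_fourierIntegral_smul_eq_flip
      (L := -innerₗ (EuclideanSpace ℝ (Fin n))) Real.continuous_fourierChar (by
      simp only [LinearMap.neg_apply, innerₗ_apply_apply]; fun_prop) hW
      (φ.integrable (μ := volume))
    have hflip : (-innerₗ (EuclideanSpace ℝ (Fin n))).flip = -innerₗ (EuclideanSpace ℝ (Fin n)) := by
      ext x y
      simp [real_inner_comm]
    rw [hflip] at h2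
    simp only [smul_eq_mul] at h2
    refine Eq.trans ?_ h2.symm
    simp_rw [SchwartzMap.fourierInv_coe]
    rfl

theorem RepresentedBy.sub {u v : 𝓢'(EuclideanSpace ℝ (Fin n), ℂ)}
    {F G : EuclideanSpace ℝ (Fin n) → ℂ} (hu : RepresentedBy u F) (hv : RepresentedBy v G) :
    RepresentedBy (u - v) (F - G) := by
  intro φ
  have e : (fun x => (F - G) x * φ x) = fun x => F x * φ x - G x * φ x := by
    ext x; rw [Pi.sub_apply, sub_mul]
  rw [e, integral_sub (hu φ).1 (hv φ).1, ← (hu φ).2, ← (hv φ).2]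
  exact ⟨(hu φ).1.sub (hv φ).1, rfl⟩

/-- The volume of the balls that contain the supports of the symbols `σ_k`. -/
noncomputable def ballVolume (n : ℕ) : ℝ≥0∞ :=
  volume (Metric.closedBall (0 : EuclideanSpace ℝ (Fin n)) (√n))

theorem ballVolume_ne_top : ballVolume n ≠ ⊤ := measure_closedBall_lt_top.ne

theorem IsBump.eLpNorm_one_le (hρ : IsBump ρ) {W : EuclideanSpace ℝ (Fin n) → ℂ}
    (hW : MemLp W 2 volume) {k} (hWk : ∀ᵐ ξ, sigma ρ k ξ = 0 → W ξ = 0) :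
    eLpNorm W 1 volume ≤ eLpNorm W 2 volume * ballVolume n ^ (1 / 2 : ℝ) := by
  have h := hρ.lintegral_div_le hW hWk 0
  simp only [pow_zero, Complex.ofReal_one, div_one, ENNReal.ofReal_one, one_mul, Nat.cast_zero,
    neg_zero, weight_zero] at h
  rw [eLpNorm_one_eq_lintegral_enorm]
  exact h

/-- Interpolation between L² and L^∞, from |v|^p ≤ M^(p-2) |v|². -/
theorem eLpNorm_le_of_bounded {X : Type*} [MeasurableSpace X] {ν : Measure X} {p : ℝ≥0∞}
    (hp : 2 ≤ p) (hp_top : p ≠ ⊤) {v : X → ℂ} (hv : AEStronglyMeasurable v ν) {M : ℝ≥0∞}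
    (hM : ∀ᵐ x ∂ν, ‖v x‖ₑ ≤ M) :
    eLpNorm v p ν ≤ (M ^ (p.toReal - 2) * eLpNorm v 2 ν ^ 2) ^ (1 / p.toReal) := by
  have hp0 : p ≠ 0 := (two_pos.trans_le hp).ne'
  have hr : 2 ≤ p.toReal := by
    have := ENNReal.toReal_mono hp_top hp
    simpa using this
  rw [eLpNorm_eq_lintegral_rpow_enorm_toReal hp0 hp_top]
  gcongr
  have h2 : eLpNorm v 2 ν ^ 2 = ∫⁻ x, ‖v x‖ₑ ^ (2 : ℝ) ∂ν := by
    rw [eLpNorm_eq_lintegral_rpow_enorm_toReal two_ne_zero ENNReal.ofNat_ne_top,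
      ← ENNReal.rpow_natCast, ← ENNReal.rpow_mul]
    simp
  rw [h2, ← lintegral_const_mul'' _ (by fun_prop)]
  refine lintegral_mono_ae ?_
  filter_upwards [hM] with x hx
  calc ‖v x‖ₑ ^ p.toReal = ‖v x‖ₑ ^ (p.toReal - 2) * ‖v x‖ₑ ^ (2 : ℝ) := by
        rw [← ENNReal.rpow_add_of_nonneg _ _ (by linarith) (by norm_num)]
        congr 1; ring
    _ ≤ _ := by gcongr

/-- **Bernstein's inequality** -/
theorem IsBump.exists_representedBy_of_fourier (hρ : IsBump ρ) {p : ℝ≥0∞}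
    (hp : 2 ≤ p) (hp_top : p ≠ ⊤) : ∃ c : ℝ≥0, ∀ k (u : 𝓢'(EuclideanSpace ℝ (Fin n), ℂ))
      (W : EuclideanSpace ℝ (Fin n) → ℂ), RepresentedBy (𝓕 u) W → MemLp W 2 volume →
      (∀ᵐ ξ, sigma ρ k ξ = 0 → W ξ = 0) →
      ∃ v : EuclideanSpace ℝ (Fin n) → ℂ, MemLp v p volume ∧ RepresentedBy u v ∧
        eLpNorm v p volume ≤ c * eLpNorm W 2 volume := by
  have hr : 2 ≤ p.toReal := by
    have := ENNReal.toReal_mono hp_top hp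
    simpa using this
  -- For v the inverse transform of W, sup |v| ≤ ‖W‖_1, which Cauchy–Schwarz bounds by ‖W‖_2 times
  -- the root of the ball volume, while ‖v‖_2 = ‖W‖_2. Interpolation produces this power, the same
  -- for all k.
  set b : ℝ≥0∞ := (ballVolume n ^ (1 / 2 : ℝ)) ^ ((p.toReal - 2) / p.toReal) with hb
  have hbt : b ≠ ⊤ := by
    have := ballVolume_ne_top (n := n)
    exact ENNReal.rpow_ne_top_of_nonneg (div_nonneg (by linarith) (by linarith))
      (ENNReal.rpow_ne_top_of_nonneg (by norm_num) this)
  refine ⟨b.toNNReal, fun k u W hu hW hWk => ?_⟩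
  rw [ENNReal.coe_toNNReal hbt]
  have h1 := hρ.eLpNorm_one_le hW hWk
  have hWi : Integrable W volume := by
    rw [← memLp_one_iff_integrable]
    refine ⟨hW.1, h1.trans_lt ?_⟩
    have := ballVolume_ne_top (n := n)
    have := hW.2.ne
    rw [lt_top_iff_ne_top]
    finiteness
  have hv := hu.of_fourier hWi
  set v := 𝓕⁻ W with hvdef
  have hvc : Continuous v := continuous_fourierInv hWi
  have hv2 : eLpNorm v 2 volume = eLpNorm W 2 volume := by
    have h2 : u = ((𝓕⁻ (hW.toLp W) : Lp ℂ 2 (volume : Measure (EuclideanSpace ℝ (Fin n)))) :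
        𝓢'(EuclideanSpace ℝ (Fin n), ℂ)) := by
      rw [← Lp.fourierInv_toTemperedDistribution_eq, ← hu.eq_toTemperedDistribution hW,
        FourierTransform.fourierInv_fourier_eq]
    have h3 := representedBy_toTemperedDistribution
      (𝓕⁻ (hW.toLp W) : Lp ℂ 2 (volume : Measure (EuclideanSpace ℝ (Fin n))))
    rw [← h2] at h3
    rw [eLpNorm_congr_ae (hv.ae_eq h3), ← Lp.enorm_def, ← ofReal_norm]
    rw [← Lp.norm_fourier_eq, FourierTransform.fourier_fourierInv_eq, ofReal_norm, Lp.enorm_def,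
      eLpNorm_congr_ae hW.coeFn_toLp]
  have hle : eLpNorm v p volume ≤ b * eLpNorm W 2 volume := by
    refine (eLpNorm_le_of_bounded hp hp_top hvc.aestronglyMeasurable
      (Filter.Eventually.of_forall fun x => (enorm_fourierInv_le W x).trans h1)).trans
      (le_of_eq ?_)
    rw [hv2, ENNReal.mul_rpow_of_nonneg _ _ (by linarith : 0 ≤ p.toReal - 2),
      mul_right_comm, ← ENNReal.rpow_natCast, ← ENNReal.rpow_add_of_nonneg _ _ (by linarith)
      (by norm_num), Nat.cast_ofNat, sub_add_cancel, mul_comm,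
      ENNReal.mul_rpow_of_nonneg _ _ (by positivity), ← ENNReal.rpow_mul _ p.toReal,
      mul_one_div_cancel (by linarith), ENNReal.rpow_one, ← ENNReal.rpow_mul, mul_one_div]
  refine ⟨v, ⟨hvc.aestronglyMeasurable, hle.trans_lt ?_⟩, hv, hle⟩
  have := hW.2.ne
  rw [lt_top_iff_ne_top]
  finiteness

/-! ### Strichartz estimates for a single frequency block -/

/-- The multiplier `e^{itP}`. -/
noncomputable def phase (P : EuclideanSpace ℝ (Fin n) → ℝ) (t : ℝ) (ξ : EuclideanSpace ℝ (Fin n)) :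
    ℂ :=
  Complex.exp (Complex.I * (t : ℂ) * (P ξ : ℂ))

theorem norm_phase (P : EuclideanSpace ℝ (Fin n) → ℝ) (t ξ) : ‖phase P t ξ‖ = 1 :=
  norm_exp_I_mul_ofReal_mul_ofReal t (P ξ)

theorem measurable_phase {P : EuclideanSpace ℝ (Fin n) → ℝ} (hP : Measurable P) (t : ℝ) :
    Measurable (phase P t) := by
  unfold phase
  fun_prop

theorem phase_mul_conj (P : EuclideanSpace ℝ (Fin n) → ℝ) (t s ξ) :
    phase P s ξ * (starRingEnd ℂ) (phase P t ξ) = phase P (s - t) ξ := by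
  simp only [phase, ← Complex.exp_conj, ← Complex.exp_add, map_mul, Complex.conj_I,
    Complex.conj_ofReal]
  congr 1
  push_cast
  ring

theorem memLp_phase_mul {P : EuclideanSpace ℝ (Fin n) → ℝ} (hP : Measurable P)
    {H : EuclideanSpace ℝ (Fin n) → ℂ} {p : ℝ≥0∞} (hH : MemLp H p volume) (t : ℝ) :
    MemLp (fun ξ => phase P t ξ * H ξ) p volume :=
  (memLp_congr_norm ((measurable_phase hP t).aestronglyMeasurable.mul hH.1) hH.1
    (Filter.Eventually.of_forall fun ξ => by
      rw [Pi.mul_apply, norm_mul, norm_phase, one_mul])).2 hH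

/-- For each fixed ξ the phase is continuous in t, so dominated convergence applies without any
regularity or growth condition on P. -/
theorem tendsto_eLpNorm_phase_mul_sub {P : EuclideanSpace ℝ (Fin n) → ℝ} (hP : Measurable P)
    {H : EuclideanSpace ℝ (Fin n) → ℂ} (hH : MemLp H 2 volume) (s : ℝ) :
    Filter.Tendsto (fun t => eLpNorm (fun ξ => phase P t ξ * H ξ - phase P s ξ * H ξ) 2 volume)
      (nhds s) (nhds 0) := by
  have hlim : Filter.Tendsto (fun t => ∫⁻ ξ, ‖phase P t ξ * H ξ - phase P s ξ * H ξ‖ₑ ^ (2 : ℝ))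
      (nhds s) (nhds (∫⁻ _ : EuclideanSpace ℝ (Fin n), 0)) := by
    refine tendsto_lintegral_filter_of_dominated_convergence'
      (fun ξ => 4 * ‖H ξ‖ₑ ^ (2 : ℝ)) ?_ ?_ ?_ ?_
    · refine Filter.Eventually.of_forall fun t => ?_
      exact ((memLp_phase_mul hP hH t).1.sub (memLp_phase_mul hP hH s).1).enorm.pow_const _
    · refine Filter.Eventually.of_forall fun t => Filter.Eventually.of_forall fun ξ => ?_
      have : ‖phase P t ξ * H ξ - phase P s ξ * H ξ‖ₑ ≤ 2 * ‖H ξ‖ₑ := by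
        refine enorm_sub_le.trans (le_of_eq ?_)
        rw [enorm_mul, enorm_mul, ← ofReal_norm (phase P t ξ), ← ofReal_norm (phase P s ξ),
          norm_phase, norm_phase, ENNReal.ofReal_one]
        ring
      calc _ ≤ (2 * ‖H ξ‖ₑ) ^ (2 : ℝ) := by gcongr
        _ = _ := by
          rw [ENNReal.mul_rpow_of_nonneg _ _ zero_le_two, ENNReal.rpow_two 2]
          norm_num
    · rw [lintegral_const_mul' _ _ (by simp)]
      have := (eLpNorm_lt_top_iff_lintegral_rpow_enorm_lt_top two_ne_zero ENNReal.ofNat_ne_top).1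
        hH.2
      rw [ENNReal.toReal_ofNat] at this
      exact ENNReal.mul_ne_top (by simp) this.ne
    · refine Filter.Eventually.of_forall fun ξ => ?_
      have hc : Continuous fun t : ℝ => ‖phase P t ξ * H ξ - phase P s ξ * H ξ‖ₑ ^ (2 : ℝ) := by
        refine (ENNReal.continuous_rpow_const).comp (continuous_enorm.comp ?_)
        unfold phase
        fun_prop
      have := hc.tendsto s
      simpa using this
  have h2 := ((ENNReal.continuous_rpow_const (y := 1 / 2)).tendsto _).comp hlim
  rw [lintegral_zero, ENNReal.zero_rpow_of_pos (by norm_num)] at h2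
  refine h2.congr fun t => ?_
  rw [eLpNorm_eq_lintegral_rpow_enorm_toReal two_ne_zero ENNReal.ofNat_ne_top]
  simp

theorem RepresentedBy.apply_eq {u : 𝓢'(EuclideanSpace ℝ (Fin n), ℂ)}
    {W : EuclideanSpace ℝ (Fin n) → ℂ} (h : RepresentedBy (𝓕 u) W)
    (φ : 𝓢(EuclideanSpace ℝ (Fin n), ℂ)) : u φ = ∫ ξ, W ξ * 𝓕⁻ φ ξ := by
  rw [← (h (𝓕⁻ φ)).2, TemperedDistribution.fourier_apply, FourierTransform.fourier_fourierInv_eq]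

/-- The complex conjugate of a Schwartz function. -/
noncomputable def conjSchwartz (g : 𝓢(EuclideanSpace ℝ (Fin n), ℂ)) :
    𝓢(EuclideanSpace ℝ (Fin n), ℂ) :=
  SchwartzMap.postcompCLM (Complex.conjCLE : ℂ →L[ℝ] ℂ) g

theorem conjSchwartz_apply (g : 𝓢(EuclideanSpace ℝ (Fin n), ℂ)) (x) :
    conjSchwartz g x = (starRingEnd ℂ) (g x) := rfl

theorem eLpNorm_conjSchwartz (g : 𝓢(EuclideanSpace ℝ (Fin n), ℂ)) (p : ℝ≥0∞) :
    eLpNorm (conjSchwartz g) p volume = eLpNorm g p volume :=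
  eLpNorm_congr_norm_ae (Filter.Eventually.of_forall fun x => by
    rw [conjSchwartz_apply, RCLike.norm_conj])

theorem fourier_conjSchwartz (g : 𝓢(EuclideanSpace ℝ (Fin n), ℂ)) (ξ) :
    𝓕 (conjSchwartz g) ξ = (starRingEnd ℂ) (𝓕⁻ g ξ) := by
  rw [SchwartzMap.fourier_coe, SchwartzMap.fourierInv_coe, Real.fourier_eq, Real.fourierInv_eq,
    ← integral_conj]
  refine integral_congr_ae (Filter.Eventually.of_forall fun x => ?_)
  simp only [Circle.smul_def, smul_eq_mul, map_mul, conjSchwartz_apply, Real.fourierChar_apply,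
    ← Complex.exp_conj, Complex.conj_ofReal, Complex.conj_I]
  congr 2
  push_cast
  ring

theorem inner_toLp {A B : EuclideanSpace ℝ (Fin n) → ℂ} (hA : MemLp A 2 volume)
    (hB : MemLp B 2 volume) :
    inner ℂ (hA.toLp A) (hB.toLp B) = ∫ ξ, B ξ * (starRingEnd ℂ) (A ξ) := by
  rw [L2.inner_def]
  refine integral_congr_ae ?_
  filter_upwards [hA.coeFn_toLp, hB.coeFn_toLp] with ξ h1 h2
  rw [h1, h2, RCLike.inner_apply]

theorem IsBump.memLp_sigma_mul (hρ : IsBump ρ) {H : EuclideanSpace ℝ (Fin n) → ℂ} {p : ℝ≥0∞}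
    (hH : MemLp H p volume) (k) : MemLp (fun ξ => (sigma ρ k ξ : ℂ) * H ξ) p volume := by
  refine hH.of_le ((hρ.hasTemperateGrowth_sigma k).1.continuous.aestronglyMeasurable.mul hH.1)
    (Filter.Eventually.of_forall fun ξ => ?_)
  rw [norm_mul, Complex.norm_real, Real.norm_of_nonneg (hρ.sigma_nonneg k ξ)]
  exact mul_le_of_le_one_left (norm_nonneg _) (hρ.sigma_le_one k ξ)

/-- Bernstein's inequality, applied to differences u t - u s, turns the L² continuity of the phases
into continuity in L^p. -/
theorem IsBump.exists_continuous_block (hρ : IsBump ρ) {P : EuclideanSpace ℝ (Fin n) → ℝ}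
    (hP : Measurable P) {p : ℝ≥0∞} [Fact (1 ≤ p)] (hp : 2 ≤ p) (hp_top : p ≠ ⊤) {k}
    {u : ℝ → 𝓢'(EuclideanSpace ℝ (Fin n), ℂ)} {H : EuclideanSpace ℝ (Fin n) → ℂ}
    (hH : MemLp H 2 volume) (hHk : ∀ ξ, sigma ρ k ξ = 0 → H ξ = 0)
    (hu : ∀ t, RepresentedBy (𝓕 (u t)) fun ξ => phase P t ξ * H ξ) :
    ∃ w : ℝ → Lp ℂ p (volume : Measure (EuclideanSpace ℝ (Fin n))), Continuous w ∧
      ∀ t, RepresentedBy (u t) (w t) := by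
  obtain ⟨c, hc⟩ := hρ.exists_representedBy_of_fourier hp hp_top
  choose v hvp hv _ using fun t => hc k (u t) _ (hu t) (memLp_phase_mul hP hH t)
    (Filter.Eventually.of_forall fun ξ h => by rw [hHk ξ h, mul_zero])
  have hrep : ∀ t, RepresentedBy (u t) ((hvp t).toLp (v t)) := fun t =>
    (hv t).congr (hvp t).coeFn_toLp.symm
  refine ⟨fun t => (hvp t).toLp (v t), ?_, hrep⟩
  rw [continuous_iff_continuousAt]
  intro s
  rw [ContinuousAt, tendsto_iff_edist_tendsto_0]
  have hlim := ENNReal.Tendsto.const_mul (tendsto_eLpNorm_phase_mul_sub hP hH s)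
    (Or.inr (ENNReal.coe_ne_top (r := c)))
  rw [mul_zero] at hlim
  refine tendsto_of_tendsto_of_tendsto_of_le_of_le tendsto_const_nhds hlim (fun _ => zero_le)
    fun t => ?_
  have hsub : RepresentedBy (𝓕 (u t - u s))
      ((fun ξ => phase P t ξ * H ξ) - fun ξ => phase P s ξ * H ξ) := by
    have := (hu t).sub (hu s)
    rwa [show 𝓕 (u t) - 𝓕 (u s) = 𝓕 (u t - u s) by ext φ; rfl] at this
  obtain ⟨v', _, hv', hle⟩ := hc k (u t - u s) _ hsub
    ((memLp_phase_mul hP hH t).sub (memLp_phase_mul hP hH s))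
    (Filter.Eventually.of_forall fun ξ h => by simp [hHk ξ h])
  simp only
  rw [Lp.edist_toLp_toLp, eLpNorm_congr_ae (((hv t).sub (hv s)).ae_eq hv')]
  exact hle

theorem exists_block_bound (hρ : IsBump ρ) {P : EuclideanSpace ℝ (Fin n) → ℝ}
    (hP : Measurable P) {p p' q : ℝ≥0∞} [Fact (1 ≤ p)] (hp : 2 ≤ p) (hp_top : p ≠ ⊤)
    (hpp' : p⁻¹ + p'⁻¹ = 1) (hq1 : 1 ≤ q) (hq : q ≠ ⊤) {α δ μ : ℝ} (hμ0 : 0 < μ) (hμ1 : μ < 1)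
    (hU : ∃ A : ℝ≥0, ∀ (t : ℝ) (f : 𝓢(EuclideanSpace ℝ (Fin n), ℂ)),
      modulationNorm ρ α p q (dispersiveGroup P t (f : 𝓢'(EuclideanSpace ℝ (Fin n), ℂ))) ≤
        A * ENNReal.ofReal ((1 + |t|) ^ (-μ)) *
          modulationNorm ρ (α + δ) p' q (f : 𝓢'(EuclideanSpace ℝ (Fin n), ℂ))) :
    ∃ C : ℝ≥0, ∀ (f : 𝓢'(EuclideanSpace ℝ (Fin n), ℂ)) (F : EuclideanSpace ℝ (Fin n) → ℂ),
      ModerateGrowth F → RepresentedBy (𝓕 f) F →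
      (∀ l, MemLp (fun ξ => (sigma ρ l ξ : ℂ) * F ξ) 2 volume ∧
        eLpNorm (fun ξ => (sigma ρ l ξ : ℂ) * F ξ) 2 volume ≤ lebesgueNorm 2 (box ρ l f)) →
      ∀ k, ∃ w : ℝ → Lp ℂ p (volume : Measure (EuclideanSpace ℝ (Fin n))), Continuous w ∧
        (∀ t, RepresentedBy (box ρ k (dispersiveGroup P t f)) (w t)) ∧
        eLpNorm w (ENNReal.ofReal (2 / μ)) volume ≤
          C * (weight (δ / 2) k * ∑ m ∈ neighbors n, lebesgueNorm 2 (box ρ (k + m) f)) := by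
  have hp1 : 1 < p := ENNReal.one_lt_two.trans_le hp
  have hconj : ENNReal.HolderConjugate p p' := ENNReal.holderConjugate_iff.2 hpp'
  have hp'1 : 1 < p' := by
    refine lt_of_le_of_ne hconj.symm.one_le ?_
    rintro rfl
    have h1 : p⁻¹ + 1 = 0 + 1 := by simpa using hpp'
    exact hp_top (ENNReal.inv_eq_zero.1 ((ENNReal.add_left_inj ENNReal.one_ne_top).1 h1))
  have hp't : p' ≠ ⊤ := by
    rintro rfl
    rw [ENNReal.inv_top, add_zero, ENNReal.inv_eq_one] at hpp'
    exact hp1.ne' hpp'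
  obtain ⟨D, hD⟩ := exists_box_dispersive_bound hρ hp'1 hp't hq1 hq hU
  set c0 : ℝ≥0 := Real.toNNReal (4 * (2 / (1 - μ) + 2)) with hc0
  refine ⟨2 * NNReal.sqrt (D * c0), fun f F hFmod hF hσ k => ?_⟩
  set u : ℝ → 𝓢'(EuclideanSpace ℝ (Fin n), ℂ) := fun t => box ρ k (dispersiveGroup P t f) with hu
  have hurep : ∀ t, RepresentedBy (𝓕 (u t)) fun ξ => phase P t ξ * (sigma ρ k ξ * F ξ) := by
    intro t
    have := hρ.representedBy_fourier_box (representedBy_fourier_dispersiveGroup hP hFmod hF t) k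
    refine this.congr (Filter.Eventually.of_forall fun ξ => ?_)
    simp only [phase]
    ring
  obtain ⟨w, hwc, hw⟩ := hρ.exists_continuous_block hP hp hp_top (hσ k).1
    (fun ξ h => by rw [h, Complex.ofReal_zero, zero_mul]) hurep
  refine ⟨w, hwc, hw, ?_⟩
  choose G hG1 hG2 using fun t => exists_norming_schwartz hp1 hp_top hpp' (Lp.memLp (w t))
  -- The factor σ_k is spent on `e`, so that both copies of □_k appear in the Gram matrix. What
  -- remains is F, which need not be in L²; it is replaced by K, which is in L² and agrees with F
  -- where σ_k does not vanish.
  set K : EuclideanSpace ℝ (Fin n) → ℂ := fun ξ =>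
    ∑ m ∈ neighbors n, (sigma ρ (k + m) ξ : ℂ) * F ξ with hK
  have hKm : MemLp K 2 volume := memLp_finsetSum _ fun m _ => (hσ (k + m)).1
  have hKn : eLpNorm K 2 volume ≤ ∑ m ∈ neighbors n, lebesgueNorm 2 (box ρ (k + m) f) := by
    have e : K = ∑ m ∈ neighbors n, fun ξ => (sigma ρ (k + m) ξ : ℂ) * F ξ := by
      ext ξ; simp [hK]
    rw [e]
    refine (eLpNorm_sum_le (fun m _ => (hσ (k + m)).1.1) one_le_two).trans ?_
    exact Finset.sum_le_sum fun m _ => (hσ (k + m)).2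
  have hKσ : ∀ ξ, (sigma ρ k ξ : ℂ) * K ξ = sigma ρ k ξ * F ξ := by
    intro ξ
    by_cases h : sigma ρ k ξ = 0
    · rw [h, Complex.ofReal_zero, zero_mul, zero_mul]
    · rw [hK]
      simp only
      rw [← Finset.sum_mul, ← Complex.ofReal_sum, hρ.sum_neighbors_sigma h, Complex.ofReal_one,
        one_mul]
  have hKc : MemLp (fun ξ => (starRingEnd ℂ) (K ξ)) 2 volume := hKm.star
  have hE : ∀ t, MemLp (fun ξ => (sigma ρ k ξ : ℂ) * (phase P t ξ * 𝓕⁻ (G t) ξ)) 2 volume :=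
    fun t => hρ.memLp_sigma_mul (memLp_phase_mul hP ((𝓕⁻ (G t)).memLp 2 volume) t) k
  set h : Lp ℂ 2 (volume : Measure (EuclideanSpace ℝ (Fin n))) := hKc.toLp _ with hh
  set e : ℝ → Lp ℂ 2 (volume : Measure (EuclideanSpace ℝ (Fin n))) := fun t => (hE t).toLp _ with he
  have hhe : ∀ t, inner ℂ h (e t) = u t (G t) := by
    intro t
    rw [hh, he, inner_toLp, (hurep t).apply_eq]
    refine integral_congr_ae (Filter.Eventually.of_forall fun ξ => ?_)
    simp only [Complex.conj_conj]
    rw [← hKσ]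
    ring
  -- The kernel of TT*: the phases at times t and s combine to U(s - t), and the two symbols σ_k
  -- give the inner and outer □_k. Conjugating the inverse transform of `G t` gives the Fourier
  -- transform of its conjugate.
  have hee : ∀ t s, inner ℂ (e t) (e s) =
      box ρ k (dispersiveGroup P (s - t) (boxSchwartz ρ k (conjSchwartz (G t)) :
        𝓢'(EuclideanSpace ℝ (Fin n), ℂ))) (G s) := by
    intro t s
    have h1 : RepresentedBy (𝓕 ((boxSchwartz ρ k (conjSchwartz (G t)) :
        𝓢(EuclideanSpace ℝ (Fin n), ℂ)) : 𝓢'(EuclideanSpace ℝ (Fin n), ℂ)))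
        (𝓕 (boxSchwartz ρ k (conjSchwartz (G t))) : 𝓢(EuclideanSpace ℝ (Fin n), ℂ)) := by
      rw [TemperedDistribution.fourier_toTemperedDistributionCLM_eq]
      exact representedBy_coe _
    have h2 := hρ.representedBy_fourier_box
      (representedBy_fourier_dispersiveGroup hP (moderateGrowth_schwartz _) h1 (s - t)) k
    rw [he, inner_toLp, h2.apply_eq]
    refine integral_congr_ae (Filter.Eventually.of_forall fun ξ => ?_)
    simp only [hρ.fourier_boxSchwartz, fourier_conjSchwartz, map_mul, Complex.conj_ofReal]
    change _ = _ * (phase P (s - t) ξ * _) * _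
    rw [← phase_mul_conj]
    ring
  set D' : ℝ≥0 := D * (weight δ k).toNNReal with hD'
  have hwt : ((weight δ k).toNNReal : ℝ≥0∞) = weight δ k := ENNReal.coe_toNNReal (weight_ne_top _ _)
  have hN : ∀ t, ((‖w t‖₊ : ℝ≥0) : ℝ) ≤ 2 * ‖inner ℂ h (e t)‖ := by
    intro t
    rw [hhe, coe_nnnorm, ← ENNReal.ofReal_le_ofReal_iff (by positivity), ofReal_norm, Lp.enorm_def,
      ENNReal.ofReal_mul zero_le_two, ofReal_norm, ENNReal.ofReal_ofNat, (hw t (G t)).2]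
    exact hG2 t
  have he' : ∀ t s, ‖inner ℂ (e t) (e s)‖ ≤ D' * (1 + |t - s|) ^ (-μ) := by
    intro t s
    rw [hee, ← ENNReal.ofReal_le_ofReal_iff (by positivity), ofReal_norm,
      ENNReal.ofReal_mul D'.coe_nonneg, abs_sub_comm]
    calc _ ≤ (D * weight δ k * ENNReal.ofReal ((1 + |s - t|) ^ (-μ)) *
          eLpNorm (conjSchwartz (G t)) p' volume) * eLpNorm (G s) p' volume := by
          refine (enorm_apply_le hpp' _ _).trans ?_
          gcongr
          exact hD k (s - t) _
      _ ≤ (D * weight δ k * ENNReal.ofReal ((1 + |s - t|) ^ (-μ)) * 1) * 1 := by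
          rw [eLpNorm_conjSchwartz]
          gcongr
          · exact hG1 t
          · exact hG1 s
      _ = _ := by
          rw [mul_one, mul_one, ENNReal.ofReal_coe_nnreal, hD', ENNReal.coe_mul, hwt]
  have key := lintegral_rpow_le_of_decay hμ0 hμ1 (D := D') h (N := fun t => ‖w t‖₊) (by fun_prop)
    (e := e) hN he'
  have hγ : 0 < 2 / μ := by positivity
  rw [eLpNorm_eq_lintegral_rpow_enorm_toReal (by simpa using hγ) ENNReal.ofReal_ne_top,
    ENNReal.toReal_ofReal hγ.le]
  calc _ ≤ ((((2 * ‖h‖₊ * NNReal.sqrt (D' * c0) : ℝ≥0) : ℝ≥0∞)) ^ (2 / μ)) ^ (1 / (2 / μ)) := by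
        gcongr
        exact key
    _ = ((2 * ‖h‖₊ * NNReal.sqrt (D' * c0) : ℝ≥0) : ℝ≥0∞) := by
        rw [← ENNReal.rpow_mul, mul_one_div_cancel hγ.ne', ENNReal.rpow_one]
    _ = ((2 * NNReal.sqrt (D * c0) : ℝ≥0) : ℝ≥0∞) * (weight (δ / 2) k * eLpNorm K 2 volume) := by
        have h1 : ((‖h‖₊ : ℝ≥0) : ℝ≥0∞) = eLpNorm K 2 volume := by
          rw [← enorm_eq_nnnorm, hh, Lp.enorm_toLp]
          exact eLpNorm_congr_norm_ae (Filter.Eventually.of_forall fun ξ => RCLike.norm_conj _)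
        -- The Gram bound enters under a square root; this is where δ becomes δ/2.
        have h2 : ((NNReal.sqrt (weight δ k).toNNReal : ℝ≥0) : ℝ≥0∞) = weight (δ / 2) k := by
          rw [NNReal.sqrt_eq_rpow, ENNReal.coe_rpow_of_nonneg _ (by norm_num), hwt,
            weight_rpow _ (by norm_num), mul_one_div]
        rw [hD', mul_right_comm D, NNReal.sqrt_mul]
        push_cast
        rw [h1, h2]
        ring
    _ ≤ _ := by gcongr

/-! ### Minkowski's inequality for sequence spaces -/

section Minkowski

variable {T : Type*} [MeasurableSpace T] {ν : Measure T} {ι : Type*}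

theorem lintegral_finsetSum_rpow_le {r : ℝ} (hr : 1 ≤ r) {a : ι → T → ℝ≥0∞}
    (ha : ∀ k, AEMeasurable (a k) ν) (s : Finset ι) :
    (∫⁻ t, (∑ k ∈ s, a k t) ^ r ∂ν) ^ (1 / r) ≤ ∑ k ∈ s, (∫⁻ t, a k t ^ r ∂ν) ^ (1 / r) := by
  classical
  have hr0 : 0 < r := by linarith
  induction s using Finset.induction_on with
  | empty => simp [hr0]
  | insert k s hk ih =>
    simp_rw [Finset.sum_insert hk]
    refine (ENNReal.lintegral_Lp_add_le (f := a k) (g := fun t => ∑ k ∈ s, a k t) (ha k)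
      (Finset.aemeasurable_fun_sum _ fun k _ => ha k) hr).trans ?_
    gcongr

theorem lintegral_tsum_rpow_le [Countable ι] {r : ℝ} (hr : 1 ≤ r) {a : ι → T → ℝ≥0∞}
    (ha : ∀ k, AEMeasurable (a k) ν) :
    (∫⁻ t, (∑' k, a k t) ^ r ∂ν) ^ (1 / r) ≤ ∑' k, (∫⁻ t, a k t ^ r ∂ν) ^ (1 / r) := by
  have hr0 : 0 < r := by linarith
  rw [one_div, ENNReal.rpow_inv_le_iff hr0]
  have e : ∀ t, (∑' k, a k t) ^ r = ⨆ s : Finset ι, (∑ k ∈ s, a k t) ^ r := by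
    intro t
    rw [ENNReal.tsum_eq_iSup_sum]
    exact (ENNReal.orderIsoRpow r hr0).map_iSup _
  simp_rw [e]
  rw [lintegral_iSup_directed
    (fun s => (Finset.aemeasurable_fun_sum s fun k _ => ha k).pow_const _)
    (Monotone.directed_le fun s s' h t => by
      simp only
      gcongr)]
  refine iSup_le fun s => ?_
  rw [← ENNReal.rpow_inv_le_iff hr0, ← one_div]
  exact (lintegral_finsetSum_rpow_le hr ha s).trans (ENNReal.sum_le_tsum s)

variable {X : Type*} [NormedAddCommGroup X]

theorem memℓp_of_tsum_enorm_ne_top {q : ℝ≥0∞} {v : ι → X}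
    (h : ∑' k, ‖v k‖ₑ ^ q.toReal ≠ ⊤) : Memℓp v q := by
  apply memℓp_gen
  have := ENNReal.summable_toReal h
  refine this.congr fun k => ?_
  rw [← ENNReal.toReal_rpow, toReal_enorm]

theorem enorm_lp_eq {q : ℝ≥0∞} [Fact (1 ≤ q)] (hq : q ≠ ⊤) (v : lp (fun _ : ι => X) q) :
    ‖v‖ₑ = (∑' k, ‖v k‖ₑ ^ q.toReal) ^ (1 / q.toReal) := by
  have hq0 : 0 < q.toReal := ENNReal.toReal_pos (zero_lt_one.trans_le Fact.out).ne' hq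
  rw [← ofReal_norm, lp.norm_eq_tsum_rpow hq0, ← ENNReal.ofReal_rpow_of_nonneg
    (tsum_nonneg fun k => by positivity) (by positivity),
    ENNReal.ofReal_tsum_of_nonneg (fun k => by positivity) (lp.hasSum_norm hq0 v).summable]
  congr 1
  refine tsum_congr fun k => ?_
  rw [← ENNReal.ofReal_rpow_of_nonneg (norm_nonneg _) hq0.le, ofReal_norm]

theorem eLpNorm_ofReal_eq {g : ℝ} (hg : 0 < g) (v : T → X) :
    eLpNorm v (ENNReal.ofReal g) ν = (∫⁻ t, ‖v t‖ₑ ^ g ∂ν) ^ (1 / g) := by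
  rw [eLpNorm_eq_lintegral_rpow_enorm_toReal (by simpa using hg) ENNReal.ofReal_ne_top,
    ENNReal.toReal_ofReal hg.le]

/-- Minkowski's inequality in L^(g/q) for the functions ‖w k‖^q; the exponent is at least one
precisely when q ≤ g. -/
theorem exists_lp_valued_of_tsum_ne_top [Countable ι] {q : ℝ≥0∞} [Fact (1 ≤ q)] (hq : q ≠ ⊤)
    {g : ℝ} (hg : q.toReal ≤ g) {w : ι → T → X} (hw : ∀ k, AEStronglyMeasurable (w k) ν)
    (hfin : ∑' k, eLpNorm (w k) (ENNReal.ofReal g) ν ^ q.toReal ≠ ⊤) :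
    ∃ W : T → lp (fun _ : ι => X) q, AEStronglyMeasurable W ν ∧ (∀ᵐ t ∂ν, ∀ k, W t k = w k t) ∧
      eLpNorm W (ENNReal.ofReal g) ν ≤
        (∑' k, eLpNorm (w k) (ENNReal.ofReal g) ν ^ q.toReal) ^ (1 / q.toReal) := by
  classical
  have hq1 : 1 ≤ q.toReal := by
    rw [← ENNReal.toReal_one]
    exact ENNReal.toReal_mono hq Fact.out
  have hq0 : 0 < q.toReal := by linarith
  set Q := q.toReal with hQ
  have hg0 : 0 < g := by linarith
  have hmeas : ∀ k, AEMeasurable (fun t => ‖w k t‖ₑ ^ Q) ν := fun k => (hw k).enorm.pow_const _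
  have hkey : (∫⁻ t, (∑' k, ‖w k t‖ₑ ^ Q) ^ (g / Q) ∂ν) ^ (1 / g) ≤
      (∑' k, eLpNorm (w k) (ENNReal.ofReal g) ν ^ Q) ^ (1 / Q) := by
    have h := lintegral_tsum_rpow_le (r := g / Q) ((one_le_div hq0).2 hg) hmeas
    have e : ∀ k, (∫⁻ t, (‖w k t‖ₑ ^ Q) ^ (g / Q) ∂ν) ^ (1 / (g / Q)) =
        eLpNorm (w k) (ENNReal.ofReal g) ν ^ Q := by
      intro k
      simp_rw [← ENNReal.rpow_mul, mul_div_cancel₀ g hq0.ne']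
      rw [eLpNorm_ofReal_eq hg0, ← ENNReal.rpow_mul]
      congr 1
      field_simp
    simp_rw [e] at h
    calc _ = ((∫⁻ t, (∑' k, ‖w k t‖ₑ ^ Q) ^ (g / Q) ∂ν) ^ (1 / (g / Q))) ^ (1 / Q) := by
          rw [← ENNReal.rpow_mul]
          congr 1
          field_simp
      _ ≤ _ := by gcongr
  have hae : ∀ᵐ t ∂ν, ∑' k, ‖w k t‖ₑ ^ Q ≠ ⊤ := by
    have h1 : ∫⁻ t, (∑' k, ‖w k t‖ₑ ^ Q) ^ (g / Q) ∂ν ≠ ⊤ := by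
      intro h
      rw [h, ENNReal.top_rpow_of_pos (by positivity), top_le_iff] at hkey
      exact ENNReal.rpow_ne_top_of_nonneg (by positivity) hfin hkey
    have h2 := ae_lt_top' ((AEMeasurable.tsum hmeas).pow_const (g / Q)) h1
    filter_upwards [h2] with t ht htop
    rw [htop, ENNReal.top_rpow_of_pos (by positivity)] at ht
    exact lt_irrefl _ ht
  -- The default 0 can differ from the intended sequence only on the null set where summability
  -- fails.
  set W : T → lp (fun _ : ι => X) q := fun t =>
    if h : Memℓp (fun k => w k t) q then ⟨fun k => w k t, h⟩ else 0 with hW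
  have hWk : ∀ᵐ t ∂ν, ∀ k, W t k = w k t := by
    filter_upwards [hae] with t ht k
    simp only [hW]
    rw [dif_pos (memℓp_of_tsum_enorm_ne_top ht)]
  refine ⟨W, ?_, hWk, ?_⟩
  · refine aestronglyMeasurable_of_tendsto_ae (Filter.atTop : Filter (Finset ι))
      (f := fun s t => ∑ k ∈ s, lp.single q k (w k t)) (fun s => ?_) ?_
    · refine Finset.aestronglyMeasurable_fun_sum s fun k _ => ?_
      have hc : Continuous fun x : X => (lp.single q k x : lp (fun _ : ι => X) q) := by
        refine (AddMonoidHomClass.isometry_of_norm (lp.singleAddMonoidHom (E := fun _ : ι => X) q k)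
          fun x => ?_).continuous
        exact lp.norm_single (E := fun _ : ι => X) (zero_lt_one.trans_le Fact.out) k x
      exact hc.comp_aestronglyMeasurable (hw k)
    · filter_upwards [hWk] with t ht
      have := lp.hasSum_single hq (W t)
      simp_rw [ht] at this
      exact this
  · rw [eLpNorm_ofReal_eq hg0]
    refine le_trans (le_of_eq ?_) hkey
    congr 1
    refine lintegral_congr_ae ?_
    filter_upwards [hWk] with t ht
    rw [enorm_lp_eq hq, ← ENNReal.rpow_mul]
    simp_rw [ht]
    congr 1
    ring

end Minkowski

/-! ### From single blocks to the space-time norms -/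

theorem timeLebesgueNorm_le {γ p : ℝ≥0∞} [Fact (1 ≤ p)] {v : ℝ → 𝓢'(EuclideanSpace ℝ (Fin n), ℂ)}
    {w : ℝ → Lp ℂ p (volume : Measure (EuclideanSpace ℝ (Fin n)))}
    (hw : AEStronglyMeasurable w volume) (h : ∀ᵐ t : ℝ, RepresentedBy (v t) (w t)) :
    timeLebesgueNorm γ p v ≤ eLpNorm w γ volume :=
  iInf_le_of_le w (iInf_le_of_le hw (iInf_le_of_le h le_rfl))

theorem timeModulationNorm_le_weightedSeqNorm {p q : ℝ≥0∞} [Fact (1 ≤ p)] [Fact (1 ≤ q)]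
    (hq : q ≠ ⊤) {g : ℝ} (hg : q ≤ ENNReal.ofReal g) (s : ℝ)
    {u : ℝ → 𝓢'(EuclideanSpace ℝ (Fin n), ℂ)}
    {w : (Fin n → ℤ) → ℝ → Lp ℂ p (volume : Measure (EuclideanSpace ℝ (Fin n)))}
    (hw : ∀ k, AEStronglyMeasurable (w k) volume) (h : ∀ k t, RepresentedBy (box ρ k (u t)) (w k t)) :
    timeModulationNorm ρ (ENNReal.ofReal g) s p q u ≤
      weightedSeqNorm s q fun k => eLpNorm (w k) (ENNReal.ofReal g) volume := by
  rcases eq_or_ne (weightedSeqNorm s q fun k => eLpNorm (w k) (ENNReal.ofReal g) volume) ⊤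
    with htop | htop
  · rw [htop]; exact le_top
  have hq1 : 1 ≤ q.toReal := by
    rw [← ENNReal.toReal_one]
    exact ENNReal.toReal_mono hq Fact.out
  have hq0 : 0 < q.toReal := by linarith
  have hg' : q.toReal ≤ g := by
    have h1 := ENNReal.toReal_mono ENNReal.ofReal_ne_top hg
    rcases le_total 0 g with h0 | h0
    · rwa [ENNReal.toReal_ofReal h0] at h1
    · rw [ENNReal.ofReal_of_nonpos h0, ENNReal.toReal_zero] at h1
      linarith
  rw [weightedSeqNorm_eq hq] at htop ⊢
  set c : (Fin n → ℤ) → ℂ := fun k => (((1 + ‖latticePoint k‖) ^ s : ℝ) : ℂ) with hc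
  have hcn : ∀ k, ‖c k‖ₑ = weight s k := by
    intro k
    rw [← ofReal_norm, hc, Complex.norm_real, Real.norm_of_nonneg (by positivity), weight]
  have e : ∀ k, eLpNorm (c k • w k) (ENNReal.ofReal g) volume =
      weight s k * eLpNorm (w k) (ENNReal.ofReal g) volume := by
    intro k
    rw [eLpNorm_const_smul, hcn]
  obtain ⟨W, hWm, hW, hWle⟩ := exists_lp_valued_of_tsum_ne_top hq hg' (w := fun k => c k • w k)
    (fun k => (hw k).const_smul (c k)) (by
      simp_rw [e]
      intro h
      rw [h, ENNReal.top_rpow_of_pos (by positivity)] at htop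
      exact htop rfl)
  simp_rw [e] at hWle
  refine le_trans ?_ hWle
  refine iInf_le_of_le W (iInf_le_of_le hWm (iInf_le_of_le ?_ le_rfl))
  filter_upwards [hW] with t ht k
  rw [ht k]
  exact ((h k t).const_smul (c k)).congr (Lp.coeFn_smul (c k) (w k t)).symm

end Strichartz

theorem mainTheorem10 {n : ℕ} (hn : 1 ≤ n)
    (ρ : EuclideanSpace ℝ (Fin n) → ℝ) (hρ : Strichartz.IsBump ρ)
    (P : EuclideanSpace ℝ (Fin n) → ℝ) (hP : Measurable P)
    (p p' q : ℝ≥0∞) [Fact (1 ≤ p)] [Fact (1 ≤ q)]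
    (hp : 2 ≤ p) (hp_top : p ≠ ⊤) (hpp' : p⁻¹ + p'⁻¹ = 1) (hq_top : q ≠ ⊤)
    (α δ μ : ℝ) (hμ_pos : 0 < μ) (hμ_lt : μ < 1)
    (hU : ∃ A : ℝ≥0, ∀ (t : ℝ) (f : 𝓢(EuclideanSpace ℝ (Fin n), ℂ)),
      Strichartz.modulationNorm ρ α p q
          (Strichartz.dispersiveGroup P t (f : 𝓢'(EuclideanSpace ℝ (Fin n), ℂ))) ≤
        A * ENNReal.ofReal ((1 + |t|) ^ (-μ)) *
          Strichartz.modulationNorm ρ (α + δ) p' q (f : 𝓢'(EuclideanSpace ℝ (Fin n), ℂ)))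
    (s : ℝ) :
    ∃ C : ℝ≥0, ∀ f : 𝓢'(EuclideanSpace ℝ (Fin n), ℂ),
      Strichartz.modulationNorm ρ (s + δ / 2) 2 q f ≠ ⊤ →
        (∀ t : ℝ, Strichartz.IsEvolution P t f (Strichartz.dispersiveGroup P t f)) ∧
        Strichartz.boxNorm ρ s q (ENNReal.ofReal (2 / μ)) p
            (fun t => Strichartz.dispersiveGroup P t f) ≤
          C * Strichartz.modulationNorm ρ (s + δ / 2) 2 q f ∧
        (q ≤ ENNReal.ofReal (2 / μ) →
          Strichartz.timeModulationNorm ρ (ENNReal.ofReal (2 / μ)) s p q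
              (fun t => Strichartz.dispersiveGroup P t f) ≤
            C * Strichartz.modulationNorm ρ (s + δ / 2) 2 q f) := by
  have hq1 : 1 ≤ q := Fact.out
  obtain ⟨C, hC⟩ := Strichartz.exists_block_bound hρ hP hp hp_top hpp' hq1 hq_top hμ_pos hμ_lt hU
  obtain ⟨M, hM⟩ := Strichartz.weightedSeqNorm_le_of_le_sum (n := n) (s := s) (d := δ / 2) hq1 hq_top
  refine ⟨M * C, fun f hf => ?_⟩
  obtain ⟨F, hFmod, hF, hσ⟩ := Strichartz.exists_fourier_moderateGrowth hρ hq1 hq_top hf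
  choose w hwc hw hwle using hC f F hFmod hF hσ
  -- Both conclusions reduce to this bound: each space-time norm is controlled by the weighted
  -- sequence norm of the block norms of `w k`.
  have hbound := hM C _ (fun l => Strichartz.lebesgueNorm 2 (Strichartz.box ρ l f)) hwle
  rw [ENNReal.coe_mul]
  refine ⟨Strichartz.isEvolution_dispersiveGroup hP hFmod hF,
    le_trans (Strichartz.weightedSeqNorm_mono hq_top fun k => ?_) hbound,
    fun hγ => (Strichartz.timeModulationNorm_le_weightedSeqNorm hq_top hγ s
      (fun k => (hwc k).aestronglyMeasurable) hw).trans hbound⟩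
  exact Strichartz.timeLebesgueNorm_le (hwc k).aestronglyMeasurable
    (Filter.Eventually.of_forall (hw k))
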